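/- **Setting.** Let $PU(n)$ be the projective unitary group, $U(n)$ modulo global phases. In the basis $|00\rangle,|01\rangle,|10\rangle,|11\rangle$ let $\mathrm{CZ}=\mathrm{diag}(1,1,1,-1)$, let $i\mathrm{SWAP}$ fix $|00\rangle,|11\rangle$ and send $|01\rangle\mapsto i|10\rangle$, $|10\rangle\mapsto i|01\rangle$, and let $$X_\alpha=\begin{pmatrix}\cos\frac\alpha2&-i\sin\frac\alpha2\\-i\sin\frac\alpha2&\cos\frac\alpha2\end{pmatrix},\qquad Y_\alpha=\begin{pmatrix}\cos\frac\alpha2&-\sin\frac\alpha2\\ \sin\frac\alpha2&\cos\frac\alpha2\end{pmatrix}.$$ For a two-qubit gate $S\in PU(4)$ and $n\ge 0$, let $P^n_S\subseteq PU(4)$ be the set of all programs $L_0 S L_1 S\cdots S L_n$ with exactly $n$ factors $S$, where each $L_j=A_j\otimes B_j$ is local ($A_j,B_j\in PU(2)$). Let $\mathcal L_S(U)\in\mathbb N\cup\{\infty\}$ be the least $n$ with $U\in P^n_S$. Let $\mathfrak A_{C_2}$ be the set of $(\delta_1,\dots,\delta_4)\in\mathbb R^4$ with $\delta_1\ge\delta_2\ge\delta_3\ge\delta_4\ge\delta_1-1$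 and $\sum_j\delta_j=0$ such that either $\delta_3+\frac12>\delta_1$, or both $\delta_3+\frac12=\delta_1$ and $\delta_4+\frac12\le\delta_2$. Let $$Q=\frac1{\sqrt2}\begin{pmatrix}1&0&0&i\\0&i&1&0\\0&i&-1&0\\1&0&0&-i\end{pmatrix}.$$ For $U\in PU(4)$ let $\Pi(U)$ be the element $\delta\in\mathfrak A_{C_2}$ such that, for some lift $\tilde U\in SU(4)$ of $U$, the matrix $VV^T$ with $V=Q^\dagger\tilde UQ$ has eigenvalues $e^{2\pi i\delta_1},\dots,e^{2\pi i\delta_4}$ with multiplicity. Put $$e_1=(0,0,0,0),\quad e_2=(\tfrac14,\tfrac14,-\tfrac14,-\tfrac14),\quad e_3=(\tfrac12,0,0,-\tfrac12),\quad e_4=(\tfrac14,\tfrac14,\tfrac14,-\tfrac34).$$ Let $\mathrm{vol}^{\mathrm{Haar}}$ be the Haar probability measure on $PU(4)$, and $\mathrm{vol}^{\mathfrak A_{C_2}}$ the three-dimensional Euclidean volume on $\mathfrak A_{C_2}$, inside the hyperplane $\sum_j\delta_j=0$, normalized so that $\mathfrak A_{C_2}$ has volume $1$. Put $$\langle\mathcal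 L_S\rangle^{\mathrm{Haar}}=\int_{PU(4)}\mathcal L_S\,d\,\mathrm{vol}^{\mathrm{Haar}},\qquad \langle\mathcal L_S\rangle^{\mathfrak A_{C_2}}=\int_{\mathfrak A_{C_2}}\mathcal L_S(\Pi^{-1}(x))\,d\,\mathrm{vol}^{\mathfrak A_{C_2}}(x),$$ where $\mathcal L_S(\Pi^{-1}(x))$ is the minimum of $\mathcal L_S$ over the fibre $\Pi^{-1}(x)$. **Statement.** For every $U\in PU(4)$ the point $\Pi(U)$ exists and is unique, and the following hold. 1. $P^2_{i\mathrm{SWAP}}=P^2_{\mathrm{CZ}}$. Moreover $$\Pi(P^2_{i\mathrm{SWAP}})=\{\delta\in\mathfrak A_{C_2}:\delta_1=-\delta_4,\ \delta_2=-\delta_3\},$$ a program $U$ lies in $P^2_{i\mathrm{SWAP}}$ if and only if $\Pi(U)$ lies in this set, the set is the convex hull of $\{e_1,e_2,e_3\}$, and its extreme points are exactly $e_1,e_2,e_3$. These are realized by circuits (the rightmost factor acts first; $S=i\mathrm{SWAP}$): $$\Pi(SS)=e_1,\qquad \Pi\big(S(1\otimes X_{\pi/2})S\big)=e_2,\qquad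 \Pi\big(S(X_{\pi/2}\otimes X_{\pi/2})S\big)=e_3.$$ 2. $P^3_{i\mathrm{SWAP}}=P^3_{\mathrm{CZ}}=PU(4)$ and $\Pi(P^3_{i\mathrm{SWAP}})=\mathfrak A_{C_2}$. Moreover $$\Pi\big(S(X_{\pi/2}\otimes X_{\pi/2})S(Y_{\pi/2}\otimes Y_{\pi/2})S\big)=e_1,\qquad \Pi\big(S(X_{\pi/2}\otimes X_{\pi/2})S(X_{\pi/2}\otimes Y_{\pi/2})S\big)=e_2,$$ $$\Pi\big(S(X_{\pi/2}\otimes X_{\pi/2})S(X_{\pi/2}\otimes X_{\pi/2})S\big)=e_3,\qquad \Pi\big(S(1\otimes X_{\pi/2})S(X_{-\pi/2}\otimes 1)S\big)=e_4.$$ 3. $\mathrm{vol}^{\mathrm{Haar}}(P^2_{i\mathrm{SWAP}})=0$ and $\mathrm{vol}^{\mathfrak A_{C_2}}(\Pi(P^2_{i\mathrm{SWAP}}))=0$. 4. $\langle\mathcal L_{i\mathrm{SWAP}}\rangle^{\mathrm{Haar}}=3$ and $\langle\mathcal L_{i\mathrm{SWAP}}\rangle^{\mathfrak A_{C_2}}=3$.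 -/

import Mathlib

open scoped Kronecker ENNReal

noncomputable section

namespace TwoQubit

/-! ### Programs: the projective unitary groups -/

/-- The unitary group `U(n)`. -/
abbrev U (n : ℕ) : Type := Matrix.unitaryGroup (Fin n) ℂ

/-- The projective unitary group `PU(n)`, the quotient of `U(n)` by its centre (global phases). -/
def PU (n : ℕ) : Type := U n ⧸ Subgroup.center (U n)

instance (n : ℕ) : Group (PU n) := inferInstanceAs (Group (U n ⧸ Subgroup.center (U n)))

instance (n : ℕ) : TopologicalSpace (PU n) :=
  inferInstanceAs (TopologicalSpace (U n ⧸ Subgroup.center (U n)))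

instance (n : ℕ) : IsTopologicalGroup (PU n) :=
  inferInstanceAs (IsTopologicalGroup (U n ⧸ Subgroup.center (U n)))

instance (n : ℕ) : CompactSpace (U n) := by
  refine isCompact_iff_compactSpace.mp ?_
  have hc : IsClosed (Matrix.unitaryGroup (Fin n) ℂ : Set (Matrix (Fin n) (Fin n) ℂ)) :=
    isClosed_unitary
  have hK : IsCompact (Set.univ.pi fun _ : Fin n => Set.univ.pi
      fun _ : Fin n => Metric.closedBall (0 : ℂ) 1) :=
    isCompact_univ_pi fun _ => isCompact_univ_pi fun _ => isCompact_closedBall (0 : ℂ) 1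
  refine hK.of_isClosed_subset hc ?_
  intro M hM i _ j _
  simpa using entry_norm_bound_of_unitary hM i j

instance (n : ℕ) : CompactSpace (PU n) :=
  inferInstanceAs (CompactSpace (U n ⧸ Subgroup.center (U n)))

instance (n : ℕ) : MeasurableSpace (PU n) := borel (PU n)

instance (n : ℕ) : BorelSpace (PU n) := ⟨rfl⟩

/-- The class of a unitary matrix up to global phase. -/
def toPU {n : ℕ} : U n →* PU n := QuotientGroup.mk' (Subgroup.center (U n))

/-- The Haar measure on `PU(n)`, of total mass one. -/
def haarPU (n : ℕ) : MeasureTheory.Measure (PU n) :=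
  MeasureTheory.Measure.haarMeasure (⊤ : TopologicalSpace.PositiveCompacts (PU n))

/-! ### Gates -/

/-- `A ⊗ B` on two qubits, in the computational basis `00, 01, 10, 11`. -/
def tensor (A B : U 2) : U 4 :=
  ⟨Matrix.reindex (finProdFinEquiv : Fin 2 × Fin 2 ≃ Fin 4) finProdFinEquiv
      ((A : Matrix (Fin 2) (Fin 2) ℂ) ⊗ₖ (B : Matrix (Fin 2) (Fin 2) ℂ)), by
    have h := Matrix.kronecker_mem_unitary A.2 B.2
    rw [Matrix.mem_unitaryGroup_iff, Matrix.star_eq_conjTranspose] at h ⊢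
    rw [Matrix.reindex_apply, Matrix.conjTranspose_submatrix, Matrix.submatrix_mul_equiv, h,
      Matrix.submatrix_one_equiv]⟩

/-- The local two-qubit programs: the classes of `A ⊗ B`. -/
def localGates : Set (PU 4) := {g | ∃ A B : U 2, g = toPU (tensor A B)}

/-- The rotation `X_α`. -/
def rotX (α : ℝ) : U 2 :=
  ⟨!![(Real.cos (α / 2) : ℂ), -Complex.I * (Real.sin (α / 2) : ℂ);
      -Complex.I * (Real.sin (α / 2) : ℂ), (Real.cos (α / 2) : ℂ)], by
    have h : (Real.cos (α / 2) : ℂ) ^ 2 + (Real.sin (α / 2) : ℂ) ^ 2 = 1 := by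
      exact_mod_cast Real.cos_sq_add_sin_sq (α / 2)
    rw [Matrix.mem_unitaryGroup_iff, Matrix.star_eq_conjTranspose]
    generalize Real.cos (α / 2) = c at h ⊢
    generalize Real.sin (α / 2) = s at h ⊢
    have hI := Complex.I_mul_I
    ext i j
    fin_cases i <;> fin_cases j <;>
      simp [Matrix.mul_apply, Fin.sum_univ_two, Complex.conj_ofReal] <;> grind⟩

/-- The rotation `Y_α`. -/
def rotY (α : ℝ) : U 2 :=
  ⟨!![(Real.cos (α / 2) : ℂ), -(Real.sin (α / 2) : ℂ);
      (Real.sin (α / 2) : ℂ), (Real.cos (α / 2) : ℂ)], by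
    have h : (Real.cos (α / 2) : ℂ) ^ 2 + (Real.sin (α / 2) : ℂ) ^ 2 = 1 := by
      exact_mod_cast Real.cos_sq_add_sin_sq (α / 2)
    rw [Matrix.mem_unitaryGroup_iff, Matrix.star_eq_conjTranspose]
    generalize Real.cos (α / 2) = c at h ⊢
    generalize Real.sin (α / 2) = s at h ⊢
    ext i j
    fin_cases i <;> fin_cases j <;>
      simp [Matrix.mul_apply, Fin.sum_univ_two, Complex.conj_ofReal] <;> grind⟩

/-- The controlled-`Z` gate as a unitary matrix. -/
def czU : U 4 :=
  ⟨!![1, 0, 0, 0; 0, 1, 0, 0; 0, 0, 1, 0; 0, 0, 0, -1], by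
    rw [Matrix.mem_unitaryGroup_iff, Matrix.star_eq_conjTranspose]
    ext i j
    fin_cases i <;> fin_cases j <;> simp [Matrix.mul_apply, Fin.sum_univ_four]⟩

/-- The `iSWAP` gate as a unitary matrix. -/
def iswapU : U 4 :=
  ⟨!![1, 0, 0, 0; 0, 0, Complex.I, 0; 0, Complex.I, 0, 0; 0, 0, 0, 1], by
    rw [Matrix.mem_unitaryGroup_iff, Matrix.star_eq_conjTranspose]
    ext i j
    fin_cases i <;> fin_cases j <;> simp [Matrix.mul_apply, Fin.sum_univ_four]⟩

/-- The program `CZ`. -/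
def CZ : PU 4 := toPU czU

/-- The program `iSWAP`. -/
def ISWAP : PU 4 := toPU iswapU

/-! ### Circuits -/

/-- `P S n`: the programs of circuits with exactly `n` two-qubit gates drawn from `S`, with
arbitrary local gates before, between and after them. -/
def P (S : Set (PU 4)) : ℕ → Set (PU 4)
  | 0 => localGates
  | n + 1 => {g | ∃ h ∈ P S n, ∃ s ∈ S, ∃ l ∈ localGates, g = h * s * l}

/-- The least number of two-qubit gates in a circuit over `S` for `g` (`⊤` if there is none). -/
def depth (S : Set (PU 4)) (g : PU 4) : ℕ∞ := ⨅ (n : ℕ) (_ : g ∈ P S n), (n : ℕ∞)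

/-- The expected circuit depth with respect to the Haar measure. -/
def expectedDepthHaar (S : Set (PU 4)) : ℝ≥0∞ := ∫⁻ g, (depth S g : ℝ≥0∞) ∂(haarPU 4)

/-! ### The alcove and the coordinate `Π` -/

/-- Euclidean 4-space; the coordinates `δ₁, …, δ₄` are `δ 0, …, δ 3`. -/
abbrev E4 : Type := EuclideanSpace ℝ (Fin 4)

/-- The fundamental alcove of `SU(4)`. -/
def alcove : Set E4 :=
  {a | a 0 ≥ a 1 ∧ a 1 ≥ a 2 ∧ a 2 ≥ a 3 ∧ a 3 ≥ a 0 - 1 ∧ ∑ j, a j = 0}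

/-- The fundamental alcove of `SU(4) / {±1}`. -/
def alcoveC2 : Set E4 :=
  {a | a ∈ alcove ∧
    (a 2 + 1 / 2 > a 0 ∨ (a 2 + 1 / 2 = a 0 ∧ a 3 + 1 / 2 ≤ a 1))}

/-- The eigenvalues of `V`, with multiplicity, are `exp (2 π i a_j)`, where `a` is in the alcove. -/
def IsLogSpec (V : Matrix (Fin 4) (Fin 4) ℂ) (a : E4) : Prop :=
  a ∈ alcove ∧
    V.charpoly.roots =
      (Finset.univ : Finset (Fin 4)).val.map
        (fun j => Complex.exp (2 * (Real.pi : ℂ) * Complex.I * (a j : ℂ)))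

/-- The matrix `Q` conjugating local gates to orthogonal matrices. -/
def Q : Matrix (Fin 4) (Fin 4) ℂ :=
  ((1 / Real.sqrt 2 : ℝ) : ℂ) •
    !![1, 0, 0, Complex.I;
       0, Complex.I, 1, 0;
       0, Complex.I, -1, 0;
       1, 0, 0, -Complex.I]

/-- The Cartan double `γ(u^Q)`, where `u^Q = Q† u Q` and `γ(v) = v vᵀ`. -/
def cartanDouble (u : Matrix (Fin 4) (Fin 4) ℂ) : Matrix (Fin 4) (Fin 4) ℂ :=
  (Q.conjTranspose * u * Q) * (Q.conjTranspose * u * Q).transpose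

/-- `a` is the logarithmic spectrum of the Cartan double of the program `g`. The double is taken
of a lift `u` of `g` to `SU(4)`; changing the lift changes it at most by a sign, and the
representative in `alcoveC2` is taken. -/
def IsCoord (g : PU 4) (a : E4) : Prop :=
  a ∈ alcoveC2 ∧
    ∃ u : U 4, (u : Matrix (Fin 4) (Fin 4) ℂ).det = 1 ∧ toPU u = g ∧
      IsLogSpec (cartanDouble (u : Matrix (Fin 4) (Fin 4) ℂ)) a

/-- The map `Π : PU(4) → 𝔄_{C₂}`, sending `g` to the `a` with `IsCoord g a`. -/
def coord (g : PU 4) : E4 := Classical.epsilon (IsCoord g)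

/-- The vertices `e₁ = Π(I)`, `e₂ = Π(CZ)`, `e₃ = Π(iSWAP)`, `e₄ = Π(SWAP)`. -/
def e₁ : E4 := !₂[0, 0, 0, 0]

/-- See `e₁`. -/
def e₂ : E4 := !₂[1 / 4, 1 / 4, -1 / 4, -1 / 4]

/-- See `e₁`. -/
def e₃ : E4 := !₂[1 / 2, 0, 0, -1 / 2]

/-- See `e₁`. -/
def e₄ : E4 := !₂[1 / 4, 1 / 4, 1 / 4, -3 / 4]

/-! ### Volume in the alcove -/

/-- The three-dimensional space `∑ a_j = 0` containing the alcove. -/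
def traceless : Submodule ℝ E4 where
  carrier := {a | ∑ j, a j = 0}
  add_mem' := by
    intro a b ha hb
    simp only [Set.mem_ofPred_eq, PiLp.add_apply, Finset.sum_add_distrib] at ha hb ⊢
    rw [ha, hb, add_zero]
  zero_mem' := by simp
  smul_mem' := by
    intro c a ha
    simp only [Set.mem_ofPred_eq, PiLp.smul_apply, smul_eq_mul, ← Finset.mul_sum] at ha ⊢
    rw [ha, mul_zero]

/-- Three-dimensional Euclidean volume on the space `∑ a_j = 0`, as a measure on `ℝ⁴`. -/
def tracelessVolume : MeasureTheory.Measure E4 :=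
  (stdOrthonormalBasis ℝ traceless).toBasis.addHaar.map (Subtype.val : traceless → E4)

/-- Euclidean volume on `alcoveC2`, normalized so that `alcoveC2` has volume one. -/
def alcoveVolume : MeasureTheory.Measure E4 := ProbabilityTheory.cond tracelessVolume alcoveC2

/-- The expected circuit depth with respect to the volume of the alcove; the depth at a point is
that of the programs with this coordinate. -/
def expectedDepthAlcove (S : Set (PU 4)) : ℝ≥0∞ :=
  ∫⁻ x, ((⨅ (g : PU 4) (_ : coord g = x), depth S g : ℕ∞) : ℝ≥0∞) ∂alcoveVolume

end TwoQubit

end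

open TwoQubit

/-!
Both `iSWAP` and `CZ` are studied through a single invariant, the spectrum of the Cartan double.

In the basis of the columns of `Q`, local gates become the rotations of `ℝ⁴`. One inclusion is a
computation with the form `Q Qᵀ` (`spinFlip_tensor`), the other holds because `SO(4)` is generated by
rotations of coordinate planes, which are local (`isLocal_of_orthogonal`). Hence the double
`γ(V) = V Vᵀ` is conjugated by a rotation when `V` is multiplied by local gates. As a symmetric
unitary matrix is diagonalized by a real orthogonal matrix (`exists_orthogonal_diagonalization`), the
spectrum of the double is a complete invariant of gates up to local gates on both sides
(`exists_local_of_roots_eq`). Spectra of determinant one correspond to points of the alcove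
(`alcove_ext`, `exists_mem_alcove`). The lifts of a gate to `SU(4)` have doubles which agree up to
sign, and `alcoveC2` is a fundamental domain for this sign (`existsUnique_isCoord`).

The spectrum of the double of `u` is that of `u * spinFlip u`. For `u = s (A ⊗ B) s`, where `s` is
`iSWAP` or `CZ`, it is the spectrum of a product of two Hermitian matrices, conjugates of `Z ⊗ Z`, so
the trace is real. Four points of the unit circle with product one and real sum are permuted by
complex conjugation, which in the alcove says `a₀ = -a₃` and `a₁ = -a₂` (`isConjSymm_iff`).
Conversely, `X`-rotations for `A` and `B` realize all these spectra. This describes depth two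
(`DoublesToZZ.mem_P_two_iff_isConjSymm`), and the coordinates form the triangle with vertices `e₁`,
`e₂`, `e₃`. For depth three, write a gate `g` as `(g l s⁻¹) s l⁻¹` with `l` a rotation of the first
qubit by an angle `t`. The trace of the double of `g l s⁻¹` is a combination of `cos t` and `sin t`,
so that its imaginary part vanishes for some `t` (`DoublesToZZ.P_three`).

The triangle lies in a plane, so it has no volume. For the Haar measure, multiply a gate on both sides
by one-parameter groups of gates that are diagonal in the basis of the columns of `Q`. The trace of
the double becomes a trigonometric polynomial whose frequencies do not cancel against those of its
complex conjugate, so that it is real only countably often. By Fubini and the invariance of the Haar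
measure, the gates of depth two form a null set (`haarPU_P_iswap_two`). Gates of depth zero and one
have conjugation symmetric coordinates as well, so the depth is three almost everywhere.
-/

open scoped Kronecker ENNReal

noncomputable section

namespace TwoQubit

/-! ### Symmetric unitary matrices -/

theorem map_ofReal_mul {n : ℕ} (A B : Matrix (Fin n) (Fin n) ℝ) :
    (A * B).map Complex.ofReal = A.map Complex.ofReal * B.map Complex.ofReal :=
  Matrix.map_mul (f := Complex.ofRealHom)

theorem map_ofReal_one {n : ℕ} :
    (1 : Matrix (Fin n) (Fin n) ℝ).map Complex.ofReal = 1 :=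
  Matrix.map_one _ Complex.ofReal_zero Complex.ofReal_one

/-- Two commuting real symmetric matrices have a common orthonormal eigenbasis. -/
theorem exists_common_orthonormal_eigenbasis {n : ℕ} {A B : Matrix (Fin n) (Fin n) ℝ}
    (hA : A.IsHermitian) (hB : B.IsHermitian) (hAB : A * B = B * A) :
    ∃ (b : OrthonormalBasis (Fin n) ℝ (EuclideanSpace ℝ (Fin n))) (α β : Fin n → ℝ),
      ∀ k, A.mulVec (b k) = α k • (b k).ofLp ∧ B.mulVec (b k) = β k • (b k).ofLp := by
  classical
  have hA' := Matrix.isSymmetric_toEuclideanLin_iff.mpr hA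
  have hB' := Matrix.isSymmetric_toEuclideanLin_iff.mpr hB
  have hc : Commute (Matrix.toEuclideanLin A) (Matrix.toEuclideanLin B) := by
    ext v : 1
    simp [Matrix.toLpLin_apply, Matrix.mulVec_mulVec, hAB]
  have hI := LinearMap.IsSymmetric.directSum_isInternal_of_commute hA' hB' hc
  have hO := LinearMap.IsSymmetric.orthogonalFamily_eigenspace_inf_eigenspace hA' hB'
  have hI' := DirectSum.isInternal_ne_bot_iff.mpr hI
  have hfin := WellFoundedGT.finite_ne_bot_of_iSupIndep hI.submodule_iSupIndep
  have : Fintype {i : ℝ × ℝ // Module.End.eigenspace (Matrix.toEuclideanLin A) i.2 ⊓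
      Module.End.eigenspace (Matrix.toEuclideanLin B) i.1 ≠ ⊥} := hfin.fintype
  have hO' := hO.comp (Subtype.val_injective (p := fun i : ℝ × ℝ =>
      Module.End.eigenspace (Matrix.toEuclideanLin A) i.2 ⊓
      Module.End.eigenspace (Matrix.toEuclideanLin B) i.1 ≠ ⊥))
  have hn : Module.finrank ℝ (EuclideanSpace ℝ (Fin n)) = n := by simp
  refine ⟨hI'.subordinateOrthonormalBasis hn hO',
    fun k => (hI'.subordinateOrthonormalBasisIndex hn k hO').1.2,
    fun k => (hI'.subordinateOrthonormalBasisIndex hn k hO').1.1, fun k => ?_⟩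
  obtain ⟨h1, h2⟩ := hI'.subordinateOrthonormalBasis_subordinate hn k hO'
  rw [SetLike.mem_coe, Module.End.mem_eigenspace_iff] at h1 h2
  exact ⟨congrArg WithLp.ofLp h1, congrArg WithLp.ofLp h2⟩

/-- A symmetric unitary matrix is diagonalized by a real orthogonal matrix: its real and imaginary
parts are commuting symmetric matrices. -/
theorem exists_orthogonal_diagonalization {n : ℕ} {M : Matrix (Fin n) (Fin n) ℂ}
    (hU : M ∈ Matrix.unitaryGroup (Fin n) ℂ) (hs : M.transpose = M) :
    ∃ (O : Matrix (Fin n) (Fin n) ℝ) (d : Fin n → ℂ), O.transpose * O = 1 ∧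
      M = O.map Complex.ofReal * Matrix.diagonal d * (O.map Complex.ofReal).transpose := by
  set A : Matrix (Fin n) (Fin n) ℝ := M.map Complex.re with hAdef
  set B : Matrix (Fin n) (Fin n) ℝ := M.map Complex.im with hBdef
  have hM : M = A.map Complex.ofReal + Complex.I • B.map Complex.ofReal := by
    ext i j
    simp [hAdef, hBdef, mul_comm Complex.I, Complex.re_add_im]
  have hA : A.IsHermitian := by
    ext i j
    simpa [hAdef] using congrArg (fun N => (N i j).re) hs
  have hB : B.IsHermitian := by
    ext i j
    simpa [hBdef] using congrArg (fun N => (N i j).im) hs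
  have hAB : A * B = B * A := by
    have h1 := Matrix.mem_unitaryGroup_iff.mp hU
    ext i j
    have h2 := congrArg (fun N => (N i j).im) h1
    have h3 : ∀ k, M j k = M k j := fun k => congrArg (fun N => N k j) hs
    simp only [Matrix.mul_apply, Matrix.star_apply, h3, Complex.im_sum, Complex.mul_im,
      RCLike.star_def, Complex.conj_re, Complex.conj_im, Finset.sum_add_distrib] at h2
    have h4 : ((1 : Matrix (Fin n) (Fin n) ℂ) i j).im = 0 := by
      rw [Matrix.one_apply]; split_ifs <;> simp
    rw [h4] at h2
    simp only [Matrix.mul_apply, hAdef, hBdef, Matrix.map_apply]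
    simp only [mul_neg, Finset.sum_neg_distrib] at h2
    linarith
  obtain ⟨b, α, β, hb⟩ := exists_common_orthonormal_eigenbasis hA hB hAB
  set O : Matrix (Fin n) (Fin n) ℝ := Matrix.of fun i k => b k i with hOdef
  have hO : O.transpose * O = 1 := by
    ext i j
    have h := orthonormal_iff_ite.mp b.orthonormal j i
    simp only [PiLp.inner_apply, RCLike.inner_apply, conj_trivial] at h
    simp only [Matrix.mul_apply, Matrix.transpose_apply, hOdef, Matrix.of_apply, h,
      Matrix.one_apply]
    simp [eq_comm]
  have hO2 : O * O.transpose = 1 := mul_eq_one_comm.mp hO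
  have hOc : O.map Complex.ofReal * (O.map Complex.ofReal).transpose = 1 := by
    rw [← Matrix.transpose_map, ← map_ofReal_mul, hO2, map_ofReal_one]
  have key : ∀ (C : Matrix (Fin n) (Fin n) ℝ) (γ : Fin n → ℝ),
      (∀ k, C.mulVec (b k) = γ k • (b k).ofLp) →
      C.map Complex.ofReal * O.map Complex.ofReal =
        O.map Complex.ofReal * Matrix.diagonal fun k => (γ k : ℂ) := by
    intro C γ h
    have h1 : C * O = O * Matrix.diagonal γ := by
      ext i k
      have h2 := congrFun (h k) i
      rw [Matrix.mul_diagonal]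
      simp only [Matrix.mulVec, dotProduct, Pi.smul_apply, smul_eq_mul] at h2
      simp only [Matrix.mul_apply, hOdef, Matrix.of_apply, h2, mul_comm]
    rw [← map_ofReal_mul, h1, map_ofReal_mul, Matrix.diagonal_map Complex.ofReal_zero]
  refine ⟨O, fun k => (α k : ℂ) + Complex.I * β k, hO, ?_⟩
  have h5 : M * O.map Complex.ofReal =
      O.map Complex.ofReal * Matrix.diagonal fun k => (α k : ℂ) + Complex.I * β k := by
    rw [hM, add_mul, smul_mul_assoc, key A α fun k => (hb k).1, key B β fun k => (hb k).2,
      ← mul_smul_comm, ← mul_add]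
    congr 1
    ext i j
    by_cases h : i = j <;> simp [h]
  rw [← h5, mul_assoc, hOc, mul_one]

/-! ### Local gates and rotations of `ℝ⁴` -/

theorem tensor_val (A B : U 2) : (tensor A B : Matrix (Fin 4) (Fin 4) ℂ) =
    !![A 0 0 * B 0 0, A 0 0 * B 0 1, A 0 1 * B 0 0, A 0 1 * B 0 1;
       A 0 0 * B 1 0, A 0 0 * B 1 1, A 0 1 * B 1 0, A 0 1 * B 1 1;
       A 1 0 * B 0 0, A 1 0 * B 0 1, A 1 1 * B 0 0, A 1 1 * B 0 1;
       A 1 0 * B 1 0, A 1 0 * B 1 1, A 1 1 * B 1 0, A 1 1 * B 1 1] := by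
  ext i j
  fin_cases i <;> fin_cases j <;> rfl

theorem tensor_mul (A B C D : U 2) : tensor A B * tensor C D = tensor (A * C) (B * D) := by
  apply Subtype.ext
  simp only [tensor, Submonoid.coe_mul, Matrix.reindex_apply, Matrix.submatrix_mul_equiv,
    ← Matrix.mul_kronecker_mul]

theorem tensor_one : tensor 1 1 = 1 := by
  apply Subtype.ext
  simp [tensor]

theorem tensor_inv (A B : U 2) : (tensor A B)⁻¹ = tensor A⁻¹ B⁻¹ := by
  rw [inv_eq_iff_mul_eq_one, tensor_mul, mul_inv_cancel, mul_inv_cancel, tensor_one]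

theorem inv_sqrt_two_mul_self :
    ((1 / Real.sqrt 2 : ℝ) : ℂ) * ((1 / Real.sqrt 2 : ℝ) : ℂ) = 1 / 2 := by
  rw [← Complex.ofReal_mul, div_mul_div_comm, Real.mul_self_sqrt (by norm_num)]
  norm_num

theorem Q_conjTranspose : Q.conjTranspose = ((1 / Real.sqrt 2 : ℝ) : ℂ) •
    !![1, 0, 0, 1; 0, -Complex.I, -Complex.I, 0; 0, 1, -1, 0; -Complex.I, 0, 0, Complex.I] := by
  rw [Q, Matrix.conjTranspose_smul, RCLike.star_def, Complex.conj_ofReal]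
  congr 1
  ext i j
  fin_cases i <;> fin_cases j <;> simp

theorem Q_mul_mul_conjTranspose (R : Matrix (Fin 4) (Fin 4) ℂ) : Q * R * Q.conjTranspose =
    (1 / 2 : ℂ) • (!![1, 0, 0, Complex.I; 0, Complex.I, 1, 0; 0, Complex.I, -1, 0;
      1, 0, 0, -Complex.I] * R * !![1, 0, 0, 1; 0, -Complex.I, -Complex.I, 0; 0, 1, -1, 0;
      -Complex.I, 0, 0, Complex.I]) := by
  rw [Q_conjTranspose, Q, smul_mul_assoc, smul_mul_assoc, mul_smul_comm, smul_smul,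
    inv_sqrt_two_mul_self]

theorem Q_mul_conjTranspose : Q * Q.conjTranspose = 1 := by
  have h := Q_mul_mul_conjTranspose 1
  rw [mul_one, mul_one] at h
  rw [h]
  ext i j
  fin_cases i <;> fin_cases j <;> simp <;> norm_num

theorem conjTranspose_Q_mul : Q.conjTranspose * Q = 1 := mul_eq_one_comm.mp Q_mul_conjTranspose

/-- The rotation `diag(exp(-iα/2), exp(iα/2))`. -/
def rotZ (α : ℝ) : U 2 :=
  ⟨!![(Real.cos (α / 2) : ℂ) - Complex.I * (Real.sin (α / 2) : ℂ), 0;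
      0, (Real.cos (α / 2) : ℂ) + Complex.I * (Real.sin (α / 2) : ℂ)], by
    have h : (Real.cos (α / 2) : ℂ) ^ 2 + (Real.sin (α / 2) : ℂ) ^ 2 = 1 := by
      exact_mod_cast Real.cos_sq_add_sin_sq (α / 2)
    rw [Matrix.mem_unitaryGroup_iff, Matrix.star_eq_conjTranspose]
    generalize Real.cos (α / 2) = c at h ⊢
    generalize Real.sin (α / 2) = s at h ⊢
    have hI := Complex.I_mul_I
    ext i j
    fin_cases i <;> fin_cases j <;>
      simp [Matrix.mul_apply, Fin.sum_univ_two, Complex.conj_ofReal] <;> grind⟩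

/-- A real `4 × 4` matrix is local if it is a tensor product in the basis of the columns of `Q`. -/
def IsLocal (R : Matrix (Fin 4) (Fin 4) ℝ) : Prop :=
  ∃ A B : U 2, (tensor A B : Matrix (Fin 4) (Fin 4) ℂ) =
    Q * R.map Complex.ofReal * Q.conjTranspose

theorem IsLocal.mul {R S : Matrix (Fin 4) (Fin 4) ℝ} (hR : IsLocal R) (hS : IsLocal S) :
    IsLocal (R * S) := by
  obtain ⟨A, B, h⟩ := hR
  obtain ⟨C, D, h'⟩ := hS
  refine ⟨A * C, B * D, ?_⟩
  rw [← tensor_mul, Submonoid.coe_mul, h, h', map_ofReal_mul]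
  calc _ = Q * R.map Complex.ofReal * (Q.conjTranspose * Q) * S.map Complex.ofReal *
        Q.conjTranspose := by noncomm_ring
    _ = _ := by rw [conjTranspose_Q_mul]; noncomm_ring

theorem isLocal_of_mul_eq_one {R S : Matrix (Fin 4) (Fin 4) ℝ} (hR : IsLocal R) (h : R * S = 1) :
    IsLocal S := by
  obtain ⟨A, B, hAB⟩ := hR
  refine ⟨A⁻¹, B⁻¹, ?_⟩
  have h1 : (tensor A B : Matrix (Fin 4) (Fin 4) ℂ) *
      (Q * S.map Complex.ofReal * Q.conjTranspose) = 1 := by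
    rw [hAB]
    calc _ = Q * (R.map Complex.ofReal * (Q.conjTranspose * Q) * S.map Complex.ofReal) *
          Q.conjTranspose := by noncomm_ring
      _ = 1 := by
        rw [conjTranspose_Q_mul, mul_one, ← map_ofReal_mul, h, map_ofReal_one, mul_one,
          Q_mul_conjTranspose]
  have h2 : ((tensor A⁻¹ B⁻¹ : U 4) : Matrix (Fin 4) (Fin 4) ℂ) * (tensor A B : U 4) = 1 := by
    rw [← Submonoid.coe_mul, tensor_mul, inv_mul_cancel, inv_mul_cancel, tensor_one]
    rfl
  exact left_inv_eq_right_inv h2 h1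

/-- The rotation by `-θ` in the plane of the first two coordinates. -/
def givens01 (θ : ℝ) : Matrix (Fin 4) (Fin 4) ℝ :=
  !![Real.cos θ, Real.sin θ, 0, 0; -Real.sin θ, Real.cos θ, 0, 0; 0, 0, 1, 0; 0, 0, 0, 1]

/-- The rotation by `-θ` in the plane of the middle two coordinates. -/
def givens12 (θ : ℝ) : Matrix (Fin 4) (Fin 4) ℝ :=
  !![1, 0, 0, 0; 0, Real.cos θ, Real.sin θ, 0; 0, -Real.sin θ, Real.cos θ, 0; 0, 0, 0, 1]

/-- The rotation by `-θ` in the plane of the last two coordinates. -/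
def givens23 (θ : ℝ) : Matrix (Fin 4) (Fin 4) ℝ :=
  !![1, 0, 0, 0; 0, 1, 0, 0; 0, 0, Real.cos θ, Real.sin θ; 0, 0, -Real.sin θ, Real.cos θ]

theorem cos_sin_double_half (θ : ℝ) :
    (Real.cos (θ / 2) : ℂ) ^ 2 + (Real.sin (θ / 2) : ℂ) ^ 2 = 1 ∧
    (Real.cos θ : ℂ) = (Real.cos (θ / 2) : ℂ) ^ 2 - (Real.sin (θ / 2) : ℂ) ^ 2 ∧
    (Real.sin θ : ℂ) = 2 * (Real.sin (θ / 2) : ℂ) * (Real.cos (θ / 2) : ℂ) := by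
  refine ⟨by exact_mod_cast Real.cos_sq_add_sin_sq (θ / 2), ?_, ?_⟩
  · have h := Real.cos_two_mul' (θ / 2)
    rw [mul_div_cancel₀ θ two_ne_zero] at h
    exact_mod_cast h
  · have h := Real.sin_two_mul (θ / 2)
    rw [mul_div_cancel₀ θ two_ne_zero] at h
    exact_mod_cast h

theorem isLocal_givens01 (θ : ℝ) : IsLocal (givens01 θ) := by
  refine ⟨rotX θ, rotX θ, ?_⟩
  have hG : (givens01 θ).map Complex.ofReal =
      !![(Real.cos θ : ℂ), (Real.sin θ : ℂ), 0, 0; -(Real.sin θ : ℂ), (Real.cos θ : ℂ), 0, 0;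
        0, 0, 1, 0; 0, 0, 0, 1] := by
    ext i j
    fin_cases i <;> fin_cases j <;> simp [givens01]
  obtain ⟨h1, h2, h3⟩ := cos_sin_double_half θ
  have hI := Complex.I_mul_I
  rw [tensor_val, Q_mul_mul_conjTranspose, hG, h2, h3]
  simp only [rotX]
  generalize (Real.cos (θ / 2) : ℂ) = c at h1 ⊢
  generalize (Real.sin (θ / 2) : ℂ) = s at h1 ⊢
  ext i j
  fin_cases i <;> fin_cases j <;> simp <;> grind

theorem isLocal_givens12 (θ : ℝ) : IsLocal (givens12 θ) := by
  refine ⟨rotZ (-θ), rotZ θ, ?_⟩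
  have hG : (givens12 θ).map Complex.ofReal =
      !![1, 0, 0, 0; 0, (Real.cos θ : ℂ), (Real.sin θ : ℂ), 0;
        0, -(Real.sin θ : ℂ), (Real.cos θ : ℂ), 0; 0, 0, 0, 1] := by
    ext i j
    fin_cases i <;> fin_cases j <;> simp [givens12]
  obtain ⟨h1, h2, h3⟩ := cos_sin_double_half θ
  have hI := Complex.I_mul_I
  rw [tensor_val, Q_mul_mul_conjTranspose, hG, h2, h3]
  simp only [rotZ, neg_div, Real.cos_neg, Real.sin_neg, Complex.ofReal_neg]
  generalize (Real.cos (θ / 2) : ℂ) = c at h1 ⊢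
  generalize (Real.sin (θ / 2) : ℂ) = s at h1 ⊢
  ext i j
  fin_cases i <;> fin_cases j <;> simp <;> grind

theorem isLocal_givens23 (θ : ℝ) : IsLocal (givens23 θ) := by
  refine ⟨rotX (-θ), rotX θ, ?_⟩
  have hG : (givens23 θ).map Complex.ofReal =
      !![1, 0, 0, 0; 0, 1, 0, 0; 0, 0, (Real.cos θ : ℂ), (Real.sin θ : ℂ);
        0, 0, -(Real.sin θ : ℂ), (Real.cos θ : ℂ)] := by
    ext i j
    fin_cases i <;> fin_cases j <;> simp [givens23]
  obtain ⟨h1, h2, h3⟩ := cos_sin_double_half θ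
  have hI := Complex.I_mul_I
  rw [tensor_val, Q_mul_mul_conjTranspose, hG, h2, h3]
  simp only [rotX, neg_div, Real.cos_neg, Real.sin_neg, Complex.ofReal_neg]
  generalize (Real.cos (θ / 2) : ℂ) = c at h1 ⊢
  generalize (Real.sin (θ / 2) : ℂ) = s at h1 ⊢
  ext i j
  fin_cases i <;> fin_cases j <;> simp <;> grind

/-- A local element of `SO(4)`. -/
structure IsLocalRotation (L : Matrix (Fin 4) (Fin 4) ℝ) : Prop where
  isLocal : IsLocal L
  orthogonal : L.transpose * L = 1
  det_eq_one : L.det = 1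

theorem IsLocalRotation.mul {L M : Matrix (Fin 4) (Fin 4) ℝ} (hL : IsLocalRotation L)
    (hM : IsLocalRotation M) : IsLocalRotation (L * M) where
  isLocal := hL.isLocal.mul hM.isLocal
  orthogonal := by
    rw [Matrix.transpose_mul, mul_assoc, ← mul_assoc L.transpose, hL.orthogonal, one_mul,
      hM.orthogonal]
  det_eq_one := by rw [Matrix.det_mul, hL.det_eq_one, hM.det_eq_one, one_mul]

theorem isLocalRotation_givens01 (θ : ℝ) : IsLocalRotation (givens01 θ) where
  isLocal := isLocal_givens01 θ
  orthogonal := by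
    have h := Real.cos_sq_add_sin_sq θ
    ext i j
    fin_cases i <;> fin_cases j <;> simp [givens01, Matrix.mul_apply, Fin.sum_univ_four] <;> grind
  det_eq_one := by
    have h := Real.cos_sq_add_sin_sq θ
    simp [givens01, Matrix.det_succ_row_zero, Fin.sum_univ_succ, Fin.succAbove]
    grind

theorem isLocalRotation_givens12 (θ : ℝ) : IsLocalRotation (givens12 θ) where
  isLocal := isLocal_givens12 θ
  orthogonal := by
    have h := Real.cos_sq_add_sin_sq θ
    ext i j
    fin_cases i <;> fin_cases j <;> simp [givens12, Matrix.mul_apply, Fin.sum_univ_four] <;> grind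
  det_eq_one := by
    have h := Real.cos_sq_add_sin_sq θ
    simp [givens12, Matrix.det_succ_row_zero, Fin.sum_univ_succ, Fin.succAbove]
    grind

theorem isLocalRotation_givens23 (θ : ℝ) : IsLocalRotation (givens23 θ) where
  isLocal := isLocal_givens23 θ
  orthogonal := by
    have h := Real.cos_sq_add_sin_sq θ
    ext i j
    fin_cases i <;> fin_cases j <;> simp [givens23, Matrix.mul_apply, Fin.sum_univ_four] <;> grind
  det_eq_one := by
    have h := Real.cos_sq_add_sin_sq θ
    simp [givens23, Matrix.det_succ_row_zero, Fin.sum_univ_succ, Fin.succAbove]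
    grind

theorem givens01_mulVec (θ : ℝ) (v : Fin 4 → ℝ) : (givens01 θ).mulVec v =
    ![Real.cos θ * v 0 + Real.sin θ * v 1, -Real.sin θ * v 0 + Real.cos θ * v 1, v 2, v 3] := by
  ext i
  fin_cases i <;> simp [givens01, Matrix.mulVec, dotProduct, Fin.sum_univ_four]

theorem givens12_mulVec (θ : ℝ) (v : Fin 4 → ℝ) : (givens12 θ).mulVec v =
    ![v 0, Real.cos θ * v 1 + Real.sin θ * v 2, -Real.sin θ * v 1 + Real.cos θ * v 2, v 3] := by
  ext i
  fin_cases i <;> simp [givens12, Matrix.mulVec, dotProduct, Fin.sum_univ_four]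

theorem givens23_mulVec (θ : ℝ) (v : Fin 4 → ℝ) : (givens23 θ).mulVec v =
    ![v 0, v 1, Real.cos θ * v 2 + Real.sin θ * v 3, -Real.sin θ * v 2 + Real.cos θ * v 3] := by
  ext i
  fin_cases i <;> simp [givens23, Matrix.mulVec, dotProduct, Fin.sum_univ_four]

/-- A rotation of the plane moves a given vector to the nonnegative half of the first axis. -/
theorem exists_rotation_to_axis (x y : ℝ) :
    ∃ θ, 0 ≤ Real.cos θ * x + Real.sin θ * y ∧ -Real.sin θ * x + Real.cos θ * y = 0 ∧
      (Real.cos θ * x + Real.sin θ * y) ^ 2 = x ^ 2 + y ^ 2 := by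
  have hx := Complex.norm_mul_cos_arg (⟨x, y⟩ : ℂ)
  have hy := Complex.norm_mul_sin_arg (⟨x, y⟩ : ℂ)
  have h0 := norm_nonneg (⟨x, y⟩ : ℂ)
  refine ⟨Complex.arg ⟨x, y⟩, ?_⟩
  have h := Real.cos_sq_add_sin_sq (Complex.arg ⟨x, y⟩)
  simp only at hx hy
  generalize Complex.arg ⟨x, y⟩ = θ at *
  generalize ‖(⟨x, y⟩ : ℂ)‖ = r at *
  subst hx hy
  have e : Real.cos θ * (r * Real.cos θ) + Real.sin θ * (r * Real.sin θ) = r := by grind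
  exact ⟨by rw [e]; exact h0, by ring, by rw [e]; grind⟩

/-- A unit vector orthogonal to the first two basis vectors is moved to the third one by a local
rotation fixing these two. -/
theorem exists_localRotation_third {v : Fin 4 → ℝ} (h0 : v 0 = 0) (h1 : v 1 = 0)
    (hv : v 0 ^ 2 + v 1 ^ 2 + v 2 ^ 2 + v 3 ^ 2 = 1) :
    ∃ L, IsLocalRotation L ∧ L.mulVec (Pi.single 0 1) = Pi.single 0 1 ∧
      L.mulVec (Pi.single 1 1) = Pi.single 1 1 ∧ L.mulVec v = Pi.single 2 1 := by
  obtain ⟨θ, hp, hz, hn⟩ := exists_rotation_to_axis (v 2) (v 3)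
  refine ⟨givens23 θ, isLocalRotation_givens23 θ, ?_, ?_, ?_⟩
  · rw [givens23_mulVec]; ext i; fin_cases i <;> simp
  · rw [givens23_mulVec]; ext i; fin_cases i <;> simp
  · have hr : Real.cos θ * v 2 + Real.sin θ * v 3 = 1 := by nlinarith
    rw [givens23_mulVec, hr, hz, h0, h1]
    ext i; fin_cases i <;> simp

/-- A unit vector orthogonal to the first basis vector is moved to the second one by a local
rotation fixing the first. -/
theorem exists_localRotation_second {v : Fin 4 → ℝ} (h0 : v 0 = 0)
    (hv : v 0 ^ 2 + v 1 ^ 2 + v 2 ^ 2 + v 3 ^ 2 = 1) :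
    ∃ L, IsLocalRotation L ∧ L.mulVec (Pi.single 0 1) = Pi.single 0 1 ∧
      L.mulVec v = Pi.single 1 1 := by
  obtain ⟨θ, hp, hz, hn⟩ := exists_rotation_to_axis (v 2) (v 3)
  obtain ⟨φ, hp', hz', hn'⟩ :=
    exists_rotation_to_axis (v 1) (Real.cos θ * v 2 + Real.sin θ * v 3)
  refine ⟨givens12 φ * givens23 θ, (isLocalRotation_givens12 φ).mul (isLocalRotation_givens23 θ),
    ?_, ?_⟩
  · rw [← Matrix.mulVec_mulVec, givens23_mulVec, givens12_mulVec]; ext i; fin_cases i <;> simp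
  · have hr : Real.cos φ * v 1 + Real.sin φ * (Real.cos θ * v 2 + Real.sin θ * v 3) = 1 := by
      nlinarith
    rw [← Matrix.mulVec_mulVec, givens23_mulVec, givens12_mulVec]
    ext i; fin_cases i <;> simp [hr, h0] <;> linarith

theorem exists_localRotation_first {v : Fin 4 → ℝ}
    (hv : v 0 ^ 2 + v 1 ^ 2 + v 2 ^ 2 + v 3 ^ 2 = 1) :
    ∃ L, IsLocalRotation L ∧ L.mulVec v = Pi.single 0 1 := by
  obtain ⟨θ, hp, hz, hn⟩ := exists_rotation_to_axis (v 2) (v 3)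
  obtain ⟨φ, hp', hz', hn'⟩ :=
    exists_rotation_to_axis (v 1) (Real.cos θ * v 2 + Real.sin θ * v 3)
  obtain ⟨ψ, hp'', hz'', hn''⟩ := exists_rotation_to_axis (v 0)
    (Real.cos φ * v 1 + Real.sin φ * (Real.cos θ * v 2 + Real.sin θ * v 3))
  refine ⟨givens01 ψ * (givens12 φ * givens23 θ), (isLocalRotation_givens01 ψ).mul
    ((isLocalRotation_givens12 φ).mul (isLocalRotation_givens23 θ)), ?_⟩
  have hr : Real.cos ψ * v 0 + Real.sin ψ *
      (Real.cos φ * v 1 + Real.sin φ * (Real.cos θ * v 2 + Real.sin θ * v 3)) = 1 := by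
    nlinarith
  rw [← Matrix.mulVec_mulVec, ← Matrix.mulVec_mulVec, givens23_mulVec, givens12_mulVec,
    givens01_mulVec]
  ext i; fin_cases i <;> simp [hr] <;> linarith

theorem mulVec_dotProduct_mulVec {R : Matrix (Fin 4) (Fin 4) ℝ} (h : R.transpose * R = 1)
    (v w : Fin 4 → ℝ) : R.mulVec v ⬝ᵥ R.mulVec w = v ⬝ᵥ w := by
  rw [Matrix.dotProduct_mulVec, Matrix.vecMul_mulVec, ← Matrix.dotProduct_mulVec, h,
    Matrix.one_mulVec]

/-- The isomorphism between `SO(4)` and local gates: every rotation of `ℝ⁴` is a product of plane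
rotations, and these are local. -/
theorem isLocal_of_orthogonal {R : Matrix (Fin 4) (Fin 4) ℝ} (hR : R.transpose * R = 1)
    (hdet : R.det = 1) : IsLocal R := by
  have hsq : ∀ {S : Matrix (Fin 4) (Fin 4) ℝ} (_ : S.transpose * S = 1) (j : Fin 4),
      (S.mulVec (Pi.single j 1)) 0 ^ 2 + (S.mulVec (Pi.single j 1)) 1 ^ 2 +
        (S.mulVec (Pi.single j 1)) 2 ^ 2 + (S.mulVec (Pi.single j 1)) 3 ^ 2 = 1 := by
    intro S hS j
    have h := mulVec_dotProduct_mulVec hS (Pi.single j 1) (Pi.single j 1)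
    rw [single_one_dotProduct, Pi.single_eq_same] at h
    simp only [dotProduct, Fin.sum_univ_four, ← sq] at h
    exact h
  have hperp : ∀ {S : Matrix (Fin 4) (Fin 4) ℝ} (_ : S.transpose * S = 1) {i j : Fin 4}
      (_ : i ≠ j) (_ : S.mulVec (Pi.single i 1) = Pi.single i 1),
      (S.mulVec (Pi.single j 1)) i = 0 := by
    intro S hS i j hij hi
    have h := mulVec_dotProduct_mulVec hS (Pi.single i 1) (Pi.single j 1)
    rwa [hi, single_one_dotProduct, single_one_dotProduct, Pi.single_eq_of_ne hij] at h
  have horth : ∀ {L S : Matrix (Fin 4) (Fin 4) ℝ} (_ : IsLocalRotation L)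
      (_ : S.transpose * S = 1), (L * S).transpose * (L * S) = 1 := by
    intro L S hL hS
    rw [Matrix.transpose_mul, mul_assoc, ← mul_assoc L.transpose, hL.orthogonal, one_mul, hS]
  obtain ⟨L, hL, h0⟩ := exists_localRotation_first (hsq hR 0)
  rw [Matrix.mulVec_mulVec] at h0
  have hS := horth hL hR
  obtain ⟨M, hM, hM0, h1⟩ := exists_localRotation_second (hperp hS (by decide) h0) (hsq hS 1)
  have hT := horth hM hS
  have h0' : (M * (L * R)).mulVec (Pi.single 0 1) = Pi.single 0 1 := by
    rw [← Matrix.mulVec_mulVec, h0, hM0]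
  rw [Matrix.mulVec_mulVec] at h1
  obtain ⟨N, hN, hN0, hN1, h2⟩ := exists_localRotation_third (hperp hT (by decide) h0')
    (hperp hT (by decide) h1) (hsq hT 2)
  have hV := horth hN hT
  have h0'' : (N * (M * (L * R))).mulVec (Pi.single 0 1) = Pi.single 0 1 := by
    rw [← Matrix.mulVec_mulVec, h0', hN0]
  have h1'' : (N * (M * (L * R))).mulVec (Pi.single 1 1) = Pi.single 1 1 := by
    rw [← Matrix.mulVec_mulVec, h1, hN1]
  rw [Matrix.mulVec_mulVec] at h2
  have hdV : (N * (M * (L * R))).det = 1 := by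
    rw [Matrix.det_mul, Matrix.det_mul, Matrix.det_mul, hN.det_eq_one, hM.det_eq_one,
      hL.det_eq_one, hdet]
    norm_num
  have hlast := (hN.mul (hM.mul hL)).isLocal
  have hassoc : N * (M * (L * R)) = (N * (M * L)) * R := by simp only [mul_assoc]
  suffices hone : N * (M * (L * R)) = 1 from isLocal_of_mul_eq_one hlast (hassoc ▸ hone)
  generalize N * (M * (L * R)) = V at *
  have a0 := hperp hV (show (0 : Fin 4) ≠ 3 by decide) h0''
  have a1 := hperp hV (show (1 : Fin 4) ≠ 3 by decide) h1''
  have a2 := hperp hV (show (2 : Fin 4) ≠ 3 by decide) h2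
  rw [Matrix.mulVec_single_one] at h0'' h1'' h2 a0 a1 a2
  simp only [Matrix.col_apply] at a0 a1 a2
  have hV' : V = Matrix.diagonal ![1, 1, 1, V 3 3] := by
    ext i j
    have b0 := congrFun h0'' i
    have b1 := congrFun h1'' i
    have b2 := congrFun h2 i
    simp only [Matrix.col_apply] at b0 b1 b2
    fin_cases j
    · fin_cases i <;> simp_all
    · fin_cases i <;> simp_all
    · fin_cases i <;> simp_all
    · fin_cases i <;> simp_all
  rw [hV', Matrix.det_diagonal, Fin.prod_univ_four] at hdV
  simp at hdV
  rw [hV', hdV]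
  ext i j
  fin_cases i <;> fin_cases j <;> simp

/-! ### Phases -/

/-- The centre of `U(4)` consists of scalars: commuting with a diagonal matrix with distinct entries
forces a matrix to be diagonal, commuting with a cyclic shift makes the diagonal constant. -/
theorem exists_smul_one_of_mem_center {z : U 4} (hz : z ∈ Subgroup.center (U 4)) :
    ∃ c : ℂ, (z : Matrix (Fin 4) (Fin 4) ℂ) = c • 1 := by
  have hD : Matrix.diagonal ![1, Complex.I, -1, -Complex.I] ∈ Matrix.unitaryGroup (Fin 4) ℂ := by
    rw [Matrix.mem_unitaryGroup_iff, Matrix.star_eq_conjTranspose, Matrix.diagonal_conjTranspose,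
      Matrix.diagonal_mul_diagonal, ← Matrix.diagonal_one]
    congr 1
    ext i
    fin_cases i <;> simp
  have hS : !![0, 1, 0, 0; 0, 0, 1, 0; 0, 0, 0, 1; 1, 0, 0, 0] ∈
      Matrix.unitaryGroup (Fin 4) ℂ := by
    rw [Matrix.mem_unitaryGroup_iff, Matrix.star_eq_conjTranspose]
    ext i j
    fin_cases i <;> fin_cases j <;> simp [Matrix.mul_apply, Fin.sum_univ_four]
  have h1 := congrArg Subtype.val (Subgroup.mem_center_iff.mp hz ⟨_, hD⟩)
  have h2 := congrArg Subtype.val (Subgroup.mem_center_iff.mp hz ⟨_, hS⟩)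
  simp only [Submonoid.coe_mul] at h1 h2
  generalize (z : Matrix (Fin 4) (Fin 4) ℂ) = M at h1 h2
  refine ⟨M 0 0, ?_⟩
  have hI : Complex.I ^ 2 = -1 := Complex.I_sq
  have key : ∀ {a b x : ℂ}, a * x = x * b → a ≠ b → x = 0 := by
    intro a b x h hab
    have : (a - b) * x = 0 := by linear_combination h
    exact (mul_eq_zero.mp this).resolve_left (sub_ne_zero.mpr hab)
  have hdiag : ∀ i j, i ≠ j → M i j = 0 := by
    intro i j hij
    refine key (a := ![1, Complex.I, -1, -Complex.I] i) (b := ![1, Complex.I, -1, -Complex.I] j)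
      ?_ ?_
    · have h := congrFun (congrFun h1 i) j
      rwa [Matrix.diagonal_mul, Matrix.mul_diagonal] at h
    · fin_cases i <;> fin_cases j <;> simp [Complex.ext_iff] at hij ⊢ <;> norm_num
  have e1 := congrFun (congrFun h2 0) 1
  have e2 := congrFun (congrFun h2 1) 2
  have e3 := congrFun (congrFun h2 2) 3
  simp [Matrix.mul_apply, Fin.sum_univ_four] at e1 e2 e3
  ext i j
  by_cases h : i = j
  · subst h
    fin_cases i <;> simp [e1, e2, e3]
  · simp [hdiag i j h, h]

theorem toPU_eq_of_eq_smul {n : ℕ} {u v : U n} {c : ℂ}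
    (h : (v : Matrix (Fin n) (Fin n) ℂ) = c • (u : Matrix (Fin n) (Fin n) ℂ)) :
    toPU u = toPU v := by
  refine (QuotientGroup.mk'_eq_mk' _).mpr ⟨u⁻¹ * v, ?_, by group⟩
  have hz : ((u⁻¹ * v : U n) : Matrix (Fin n) (Fin n) ℂ) = c • 1 := by
    rw [Submonoid.coe_mul, h, mul_smul_comm, ← Submonoid.coe_mul, inv_mul_cancel]
    rfl
  refine Subgroup.mem_center_iff.mpr fun g => Subtype.ext ?_
  change (g : Matrix (Fin n) (Fin n) ℂ) * ((u⁻¹ * v : U n) : Matrix (Fin n) (Fin n) ℂ) =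
    ((u⁻¹ * v : U n) : Matrix (Fin n) (Fin n) ℂ) * g
  rw [hz, smul_mul_assoc, mul_smul_comm, one_mul, mul_one]

theorem exists_eq_smul_of_toPU_eq {u v : U 4} (h : toPU u = toPU v) :
    ∃ c : ℂ, (v : Matrix (Fin 4) (Fin 4) ℂ) = c • (u : Matrix (Fin 4) (Fin 4) ℂ) := by
  obtain ⟨z, hz, rfl⟩ := (QuotientGroup.mk'_eq_mk' _).mp h
  obtain ⟨c, hc⟩ := exists_smul_one_of_mem_center hz
  exact ⟨c, by rw [Submonoid.coe_mul, hc, mul_smul_comm, mul_one]⟩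

theorem smul_mem_unitaryGroup {n : ℕ} {c : ℂ} (hc : ‖c‖ = 1) (u : U n) :
    c • (u : Matrix (Fin n) (Fin n) ℂ) ∈ Matrix.unitaryGroup (Fin n) ℂ := by
  rw [Matrix.mem_unitaryGroup_iff, star_smul, smul_mul_smul_comm,
    Matrix.mem_unitaryGroup_iff.mp u.2,
    RCLike.star_def, Complex.mul_conj, Complex.normSq_eq_norm_sq, hc]
  simp

theorem norm_det_unitary {n : ℕ} (u : U n) : ‖(u : Matrix (Fin n) (Fin n) ℂ).det‖ = 1 := by
  have h := Matrix.det_of_mem_unitary u.2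
  exact CStarRing.norm_of_mem_unitary h

/-- Every class in `PU(n)` has a representative of determinant one. -/
theorem exists_smul_det_eq_one {n : ℕ} (hn : n ≠ 0) (u : U n) :
    ∃ (v : U n) (c : ℂ), ‖c‖ = 1 ∧
      (v : Matrix (Fin n) (Fin n) ℂ) = c • (u : Matrix (Fin n) (Fin n) ℂ) ∧
      (v : Matrix (Fin n) (Fin n) ℂ).det = 1 := by
  obtain ⟨c, hc⟩ := IsAlgClosed.exists_pow_nat_eq
    ((u : Matrix (Fin n) (Fin n) ℂ).det)⁻¹ (Nat.pos_of_ne_zero hn)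
  have hd := norm_det_unitary u
  have hc1 : ‖c‖ = 1 := by
    have h : ‖c‖ ^ n = 1 := by rw [← norm_pow, hc, norm_inv, hd, inv_one]
    exact (pow_eq_one_iff_of_nonneg (norm_nonneg c) hn).mp h
  refine ⟨⟨_, smul_mem_unitaryGroup hc1 u⟩, c, hc1, rfl, ?_⟩
  have h0 : (u : Matrix (Fin n) (Fin n) ℂ).det ≠ 0 := by
    intro h; rw [h, norm_zero] at hd; exact zero_ne_one hd
  rw [Matrix.det_smul, Fintype.card_fin, hc, inv_mul_cancel₀ h0]

theorem exists_toPU_eq_det_eq_one (g : PU 4) :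
    ∃ u : U 4, toPU u = g ∧ (u : Matrix (Fin 4) (Fin 4) ℂ).det = 1 := by
  obtain ⟨u, rfl⟩ := QuotientGroup.mk'_surjective _ g
  obtain ⟨v, c, -, hv, hd⟩ := exists_smul_det_eq_one (by norm_num) u
  exact ⟨v, (toPU_eq_of_eq_smul hv).symm, hd⟩

theorem exists_tensor_det_eq_one {l : PU 4} (hl : l ∈ localGates) :
    ∃ A B : U 2, l = toPU (tensor A B) ∧ (A : Matrix (Fin 2) (Fin 2) ℂ).det = 1 ∧
      (B : Matrix (Fin 2) (Fin 2) ℂ).det = 1 := by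
  obtain ⟨A, B, rfl⟩ := hl
  obtain ⟨A', c, -, hA, hA1⟩ := exists_smul_det_eq_one (by norm_num) A
  obtain ⟨B', d, -, hB, hB1⟩ := exists_smul_det_eq_one (by norm_num) B
  refine ⟨A', B', toPU_eq_of_eq_smul (c := c * d) ?_, hA1, hB1⟩
  rw [tensor_val, tensor_val, hA, hB]
  ext i j
  fin_cases i <;> fin_cases j <;> simp <;> ring

/-! ### The spin flip and the Cartan double -/

/-- The matrix `Y ⊗ Y`, up to sign: the symmetric form preserved by local gates. -/
def spinForm : Matrix (Fin 4) (Fin 4) ℂ :=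
  !![0, 0, 0, 1; 0, 0, -1, 0; 0, -1, 0, 0; 1, 0, 0, 0]

/-- The adjoint of `u` with respect to the form `spinForm`. -/
def spinFlip (u : Matrix (Fin 4) (Fin 4) ℂ) : Matrix (Fin 4) (Fin 4) ℂ :=
  spinForm * u.transpose * spinForm

theorem spinForm_mul_self : spinForm * spinForm = 1 := by
  ext i j
  fin_cases i <;> fin_cases j <;> simp [spinForm, Matrix.mul_apply, Fin.sum_univ_four]

theorem Q_mul_transpose : Q * Q.transpose = spinForm := by
  have h : (!![1, 0, 0, Complex.I; 0, Complex.I, 1, 0; 0, Complex.I, -1, 0;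
      1, 0, 0, -Complex.I] : Matrix (Fin 4) (Fin 4) ℂ).transpose =
      !![1, 0, 0, 1; 0, Complex.I, Complex.I, 0; 0, 1, -1, 0; Complex.I, 0, 0, -Complex.I] := by
    ext i j
    fin_cases i <;> fin_cases j <;> rfl
  rw [Q, Matrix.transpose_smul, smul_mul_smul_comm, inv_sqrt_two_mul_self, h]
  ext i j
  fin_cases i <;> fin_cases j <;> simp [spinForm] <;> norm_num

theorem spinFlip_mul (u v : Matrix (Fin 4) (Fin 4) ℂ) :
    spinFlip (u * v) = spinFlip v * spinFlip u := by
  rw [spinFlip, Matrix.transpose_mul]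
  calc _ = spinForm * v.transpose * 1 * u.transpose * spinForm := by noncomm_ring
    _ = _ := by rw [← spinForm_mul_self, spinFlip, spinFlip]; noncomm_ring

theorem spinFlip_smul (c : ℂ) (u : Matrix (Fin 4) (Fin 4) ℂ) :
    spinFlip (c • u) = c • spinFlip u := by
  rw [spinFlip, Matrix.transpose_smul, mul_smul_comm, smul_mul_assoc, spinFlip]

theorem det_spinFlip (u : Matrix (Fin 4) (Fin 4) ℂ) : (spinFlip u).det = u.det := by
  have h := congrArg Matrix.det spinForm_mul_self
  rw [Matrix.det_mul, Matrix.det_one] at h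
  rw [spinFlip, Matrix.det_mul, Matrix.det_mul, Matrix.det_transpose]
  linear_combination u.det * h

theorem cartanDouble_eq (u : Matrix (Fin 4) (Fin 4) ℂ) :
    cartanDouble u = Q.conjTranspose * (u * spinFlip u) * Q := by
  have h1 : Q.transpose = Q.conjTranspose * spinForm := by
    rw [← Q_mul_transpose, ← mul_assoc, conjTranspose_Q_mul, one_mul]
  have h2 : Q.transpose * Q.conjTranspose.transpose = 1 := by
    rw [← Matrix.transpose_mul, conjTranspose_Q_mul, Matrix.transpose_one]
  have h3 : (spinForm * Q) * Q.transpose = 1 := by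
    rw [mul_assoc, Q_mul_transpose, spinForm_mul_self]
  have h4 := left_inv_eq_right_inv h3 h2
  rw [cartanDouble, Matrix.transpose_mul, Matrix.transpose_mul, ← h4, spinFlip, ← Q_mul_transpose]
  noncomm_ring

theorem charpoly_mul_mul_of_mul_eq_one {n : ℕ} {A B : Matrix (Fin n) (Fin n) ℂ} (h : A * B = 1)
    (N : Matrix (Fin n) (Fin n) ℂ) : (A * N * B).charpoly = N.charpoly := by
  obtain ⟨M, rfl, rfl⟩ : ∃ M : (Matrix (Fin n) (Fin n) ℂ)ˣ, M.val = A ∧ M⁻¹.val = B :=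
    ⟨⟨A, B, h, mul_eq_one_comm.mp h⟩, rfl, rfl⟩
  rw [Matrix.coe_units_inv]
  exact Matrix.charpoly_units_conj M N

/-- The Cartan double has the spectrum of `u * spinFlip u`, in which `Q` no longer occurs. -/
theorem charpoly_cartanDouble (u : Matrix (Fin 4) (Fin 4) ℂ) :
    (cartanDouble u).charpoly = (u * spinFlip u).charpoly := by
  rw [cartanDouble_eq, charpoly_mul_mul_of_mul_eq_one conjTranspose_Q_mul]

theorem spinFlip_eq (u : Matrix (Fin 4) (Fin 4) ℂ) : spinFlip u =
    !![u 3 3, -u 2 3, -u 1 3, u 0 3;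
       -u 3 2, u 2 2, u 1 2, -u 0 2;
       -u 3 1, u 2 1, u 1 1, -u 0 1;
       u 3 0, -u 2 0, -u 1 0, u 0 0] := by
  ext i j
  fin_cases i <;> fin_cases j <;>
    simp [spinFlip, spinForm, Matrix.mul_apply, Matrix.vecMul, dotProduct, Fin.sum_univ_four]

theorem tensor_mul_spinFlip (A B : U 2) :
    (tensor A B : Matrix (Fin 4) (Fin 4) ℂ) * spinFlip (tensor A B : U 4) =
      ((A : Matrix (Fin 2) (Fin 2) ℂ).det * (B : Matrix (Fin 2) (Fin 2) ℂ).det) • 1 := by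
  rw [spinFlip_eq, tensor_val, Matrix.det_fin_two, Matrix.det_fin_two]
  ext i j
  fin_cases i <;> fin_cases j <;> simp <;> ring

/-- Local gates in `SU(4)` preserve the form `spinForm`. -/
theorem spinFlip_tensor {A B : U 2} (hA : (A : Matrix (Fin 2) (Fin 2) ℂ).det = 1)
    (hB : (B : Matrix (Fin 2) (Fin 2) ℂ).det = 1) :
    spinFlip (tensor A B : U 4) = (tensor A⁻¹ B⁻¹ : U 4) := by
  have h := tensor_mul_spinFlip A B
  rw [hA, hB, mul_one, one_smul] at h
  refine (left_inv_eq_right_inv ?_ h).symm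
  rw [← Submonoid.coe_mul, tensor_mul, inv_mul_cancel, inv_mul_cancel, tensor_one]
  rfl

/-! ### Local equivalence -/

theorem exists_perm_of_map_univ_eq {ι α : Type*} [Fintype ι] {f g : ι → α}
    (h : (Finset.univ : Finset ι).val.map f = (Finset.univ : Finset ι).val.map g) :
    ∃ σ : Equiv.Perm ι, f = g ∘ σ := by
  classical
  have hc : ∀ c, Nonempty ({i // f i = c} ≃ {i // g i = c}) := by
    intro c
    have h1 := congrArg (Multiset.count c) h
    rw [Multiset.count_map, Multiset.count_map] at h1
    refine ⟨Fintype.equivOfCardEq ?_⟩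
    rw [Fintype.card_subtype, Fintype.card_subtype]
    simpa [eq_comm, Finset.card] using h1
  exact ⟨Equiv.ofFiberEquiv fun c => (hc c).some, funext fun i => (Equiv.ofFiberEquiv_map _ i).symm⟩

theorem charpoly_roots_orthogonal_diagonal {n : ℕ} {O : Matrix (Fin n) (Fin n) ℝ} (d : Fin n → ℂ)
    (hO : O.transpose * O = 1) :
    (O.map Complex.ofReal * Matrix.diagonal d * (O.map Complex.ofReal).transpose).charpoly.roots =
      (Finset.univ : Finset (Fin n)).val.map d := by
  have h : O.map Complex.ofReal * (O.map Complex.ofReal).transpose = 1 := by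
    rw [← Matrix.transpose_map, ← map_ofReal_mul, mul_eq_one_comm.mp hO, map_ofReal_one]
  rw [charpoly_mul_mul_of_mul_eq_one h, Matrix.charpoly_diagonal]
  have := Polynomial.roots_multiset_prod_X_sub_C ((Finset.univ : Finset (Fin n)).val.map d)
  rwa [Multiset.map_map] at this

/-- A symmetric unitary matrix is diagonalized by a rotation, with its eigenvalues in any prescribed
order. -/
theorem exists_rotation_diagonalization {M : Matrix (Fin 4) (Fin 4) ℂ}
    (hU : M ∈ Matrix.unitaryGroup (Fin 4) ℂ) (hs : M.transpose = M) {d : Fin 4 → ℂ}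
    (hd : M.charpoly.roots = (Finset.univ : Finset (Fin 4)).val.map d) :
    ∃ O : Matrix (Fin 4) (Fin 4) ℝ, O.transpose * O = 1 ∧ O.det = 1 ∧
      M = O.map Complex.ofReal * Matrix.diagonal d * (O.map Complex.ofReal).transpose := by
  obtain ⟨O, d', hO, hM⟩ := exists_orthogonal_diagonalization hU hs
  have hroots := charpoly_roots_orthogonal_diagonal d' hO
  rw [← hM, hd] at hroots
  obtain ⟨σ, rfl⟩ := exists_perm_of_map_univ_eq hroots
  set O₁ : Matrix (Fin 4) (Fin 4) ℝ := O.submatrix id σ with hO₁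
  have h1 : O₁.transpose * O₁ = 1 := by
    rw [hO₁, Matrix.transpose_submatrix, ← Matrix.submatrix_mul _ _ σ id σ Function.bijective_id,
      hO, Matrix.submatrix_one_equiv]
  have h2 : M = O₁.map Complex.ofReal * Matrix.diagonal (d' ∘ σ) *
      (O₁.map Complex.ofReal).transpose := by
    rw [hM, hO₁, ← Matrix.submatrix_diagonal_equiv, ← Matrix.submatrix_map,
      Matrix.transpose_submatrix, Matrix.submatrix_mul_equiv, Matrix.submatrix_mul_equiv,
      Matrix.submatrix_id_id]
  have hdet : O₁.det * O₁.det = 1 := by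
    have h := congrArg Matrix.det h1
    rwa [Matrix.det_mul, Matrix.det_transpose, Matrix.det_one] at h
  -- flip the sign of the first column if necessary
  set D : Matrix (Fin 4) (Fin 4) ℝ := Matrix.diagonal ![O₁.det, 1, 1, 1] with hD
  have hDD : D * D = 1 := by
    rw [hD, Matrix.diagonal_mul_diagonal, ← Matrix.diagonal_one]
    congr 1
    ext i
    fin_cases i <;> simp [hdet]
  have hDc : ∀ e : Fin 4 → ℂ, D.map Complex.ofReal * Matrix.diagonal e * D.map Complex.ofReal =
      Matrix.diagonal e := by
    intro e
    have hc : D.map Complex.ofReal * Matrix.diagonal e =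
        Matrix.diagonal e * D.map Complex.ofReal := by
      rw [hD, Matrix.diagonal_map Complex.ofReal_zero, Matrix.diagonal_mul_diagonal,
        Matrix.diagonal_mul_diagonal]
      simp only [mul_comm]
    rw [hc, mul_assoc, ← map_ofReal_mul, hDD, map_ofReal_one, mul_one]
  have hDt : D.transpose = D := by rw [hD, Matrix.diagonal_transpose]
  refine ⟨O₁ * D, ?_, ?_, ?_⟩
  · rw [Matrix.transpose_mul, hDt, mul_assoc, ← mul_assoc O₁.transpose, h1, one_mul, hDD]
  · rw [Matrix.det_mul, hD, Matrix.det_diagonal, Fin.prod_univ_four]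
    simpa using hdet
  · rw [h2, map_ofReal_mul, Matrix.transpose_mul, ← Matrix.transpose_map (M := D), hDt]
    conv_lhs => rw [← hDc (d' ∘ σ)]
    simp only [mul_assoc]

/-- A unitary matrix that is orthogonal for the bilinear form as well is real. -/
theorem exists_rotation_of_unitary {R : Matrix (Fin 4) (Fin 4) ℂ}
    (hU : R ∈ Matrix.unitaryGroup (Fin 4) ℂ) (hR : R * R.transpose = 1) (hd : R.det = 1) :
    ∃ S : Matrix (Fin 4) (Fin 4) ℝ, S.transpose * S = 1 ∧ S.det = 1 ∧
      R = S.map Complex.ofReal := by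
  have h1 : star R = R.transpose :=
    left_inv_eq_right_inv (Matrix.mem_unitaryGroup_iff'.mp hU) hR
  have h2 : R = (R.map Complex.re).map Complex.ofReal := by
    ext i j
    have h := congrFun (congrFun h1 j) i
    rw [Matrix.star_apply, Matrix.transpose_apply, RCLike.star_def, Complex.conj_eq_iff_re] at h
    simp [h]
  have hinj : Function.Injective
      fun S : Matrix (Fin 4) (Fin 4) ℝ => S.map Complex.ofReal :=
    Matrix.map_injective Complex.ofReal_injective
  refine ⟨R.map Complex.re, ?_, ?_, h2⟩
  · refine mul_eq_one_comm.mp (hinj ?_)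
    simp only
    rw [map_ofReal_mul, map_ofReal_one, Matrix.transpose_map, ← h2, hR]
  · apply Complex.ofReal_injective
    have h := Complex.ofRealHom.map_det (R.map Complex.re)
    rw [Complex.ofRealHom_eq_coe] at h
    rw [h, Complex.ofReal_one, ← hd]
    conv_rhs => rw [h2]
    rfl

theorem Qconj_mem_unitaryGroup (u : U 4) :
    Q.conjTranspose * (u : Matrix (Fin 4) (Fin 4) ℂ) * Q ∈ Matrix.unitaryGroup (Fin 4) ℂ := by
  have hQ : Q ∈ Matrix.unitaryGroup (Fin 4) ℂ :=
    Matrix.mem_unitaryGroup_iff.mpr Q_mul_conjTranspose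
  exact mul_mem (mul_mem (Unitary.star_mem hQ) u.2) hQ

theorem det_Qconj (u : Matrix (Fin 4) (Fin 4) ℂ) : (Q.conjTranspose * u * Q).det = u.det := by
  have h := congrArg Matrix.det conjTranspose_Q_mul
  rw [Matrix.det_mul, Matrix.det_one] at h
  rw [Matrix.det_mul, Matrix.det_mul]
  linear_combination u.det * h

theorem cartanDouble_mem_unitaryGroup (u : U 4) :
    cartanDouble (u : Matrix (Fin 4) (Fin 4) ℂ) ∈ Matrix.unitaryGroup (Fin 4) ℂ :=
  mul_mem (Qconj_mem_unitaryGroup u)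
    (Matrix.transpose_mem_unitaryGroup_iff.mpr (Qconj_mem_unitaryGroup u))

theorem cartanDouble_transpose (u : Matrix (Fin 4) (Fin 4) ℂ) :
    (cartanDouble u).transpose = cartanDouble u := by
  rw [cartanDouble, Matrix.transpose_mul, Matrix.transpose_transpose]

/-- The Cartan decomposition: if the Cartan doubles of two gates in `SU(4)` have the same
eigenvalues, the gates differ by local gates on both sides. -/
theorem exists_local_of_roots_eq {u v : U 4} (hu : (u : Matrix (Fin 4) (Fin 4) ℂ).det = 1)
    (hv : (v : Matrix (Fin 4) (Fin 4) ℂ).det = 1) {d : Fin 4 → ℂ}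
    (hud : (cartanDouble (u : Matrix (Fin 4) (Fin 4) ℂ)).charpoly.roots =
      (Finset.univ : Finset (Fin 4)).val.map d)
    (hvd : (cartanDouble (v : Matrix (Fin 4) (Fin 4) ℂ)).charpoly.roots =
      (Finset.univ : Finset (Fin 4)).val.map d) :
    ∃ k ∈ localGates, ∃ l ∈ localGates, toPU u = k * toPU v * l := by
  obtain ⟨O, hO, hOd, hOu⟩ := exists_rotation_diagonalization (cartanDouble_mem_unitaryGroup u)
    (cartanDouble_transpose _) hud
  obtain ⟨N, hN, hNd, hNv⟩ := exists_rotation_diagonalization (cartanDouble_mem_unitaryGroup v)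
    (cartanDouble_transpose _) hvd
  have hVU := Qconj_mem_unitaryGroup u
  have hWU := Qconj_mem_unitaryGroup v
  have hVd := det_Qconj (u : Matrix (Fin 4) (Fin 4) ℂ)
  have hWd := det_Qconj (v : Matrix (Fin 4) (Fin 4) ℂ)
  have hVu : (u : Matrix (Fin 4) (Fin 4) ℂ) =
      Q * (Q.conjTranspose * (u : Matrix (Fin 4) (Fin 4) ℂ) * Q) * Q.conjTranspose := by
    calc _ = (Q * Q.conjTranspose) * (u : Matrix (Fin 4) (Fin 4) ℂ) * (Q * Q.conjTranspose) := by
          rw [Q_mul_conjTranspose, one_mul, mul_one]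
      _ = _ := by noncomm_ring
  have hWv : (v : Matrix (Fin 4) (Fin 4) ℂ) =
      Q * (Q.conjTranspose * (v : Matrix (Fin 4) (Fin 4) ℂ) * Q) * Q.conjTranspose := by
    calc _ = (Q * Q.conjTranspose) * (v : Matrix (Fin 4) (Fin 4) ℂ) * (Q * Q.conjTranspose) := by
          rw [Q_mul_conjTranspose, one_mul, mul_one]
      _ = _ := by noncomm_ring
  rw [cartanDouble] at hOu hNv
  rw [hu] at hVd
  rw [hv] at hWd
  generalize Q.conjTranspose * (u : Matrix (Fin 4) (Fin 4) ℂ) * Q = V at *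
  generalize Q.conjTranspose * (v : Matrix (Fin 4) (Fin 4) ℂ) * Q = W at *
  -- `K = O Nᵀ` conjugates the double of `W` to that of `V`
  set K : Matrix (Fin 4) (Fin 4) ℝ := O * N.transpose with hK
  have hNN := mul_eq_one_comm.mp hN
  have hKK : K.transpose * K = 1 := by
    rw [hK, Matrix.transpose_mul, Matrix.transpose_transpose, mul_assoc,
      ← mul_assoc O.transpose, hO, one_mul, hNN]
  have hKd : K.det = 1 := by
    rw [hK, Matrix.det_mul, Matrix.det_transpose, hOd, hNd, one_mul]
  have hKO : (K.map Complex.ofReal).transpose * O.map Complex.ofReal = N.map Complex.ofReal := by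
    rw [← Matrix.transpose_map, ← map_ofReal_mul, hK, Matrix.transpose_mul,
      Matrix.transpose_transpose, mul_assoc, hO, mul_one]
  have hconj : (K.map Complex.ofReal).transpose * (V * V.transpose) * K.map Complex.ofReal =
      W * W.transpose := by
    rw [hOu, hNv, ← hKO, Matrix.transpose_mul, Matrix.transpose_transpose]
    noncomm_ring
  have hKc : K.map Complex.ofReal ∈ Matrix.unitaryGroup (Fin 4) ℂ := by
    rw [Matrix.mem_unitaryGroup_iff']
    have : star (K.map Complex.ofReal) = (K.transpose).map Complex.ofReal := by
      ext i j
      simp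
    rw [this, ← map_ofReal_mul, hKK, map_ofReal_one]
  have hKs : star (K.map Complex.ofReal) = (K.map Complex.ofReal).transpose := by
    ext i j
    simp
  have hKdc : (K.map Complex.ofReal).det = 1 := by
    have h := Complex.ofRealHom.map_det K
    rw [hKd, map_one] at h
    exact h.symm
  have hWW := Matrix.mem_unitaryGroup_iff'.mp hWU
  have hWdet : (star W).det = 1 := by
    rw [Matrix.star_eq_conjTranspose, Matrix.det_conjTranspose, hWd, star_one]
  obtain ⟨R, hRR, hRd, hR⟩ := exists_rotation_of_unitary
    (R := star W * ((K.map Complex.ofReal).transpose * V))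
    (mul_mem (Unitary.star_mem hWU) (mul_mem (hKs ▸ Unitary.star_mem hKc) hVU))
    (by
      rw [Matrix.transpose_mul, Matrix.transpose_mul, Matrix.transpose_transpose]
      calc _ = star W * ((K.map Complex.ofReal).transpose * (V * V.transpose) *
            K.map Complex.ofReal) * (star W).transpose := by noncomm_ring
        _ = (star W * W) * (star W * W).transpose := by
          rw [hconj, Matrix.transpose_mul]; noncomm_ring
        _ = 1 := by rw [hWW, Matrix.transpose_one, one_mul])
    (by rw [Matrix.det_mul, Matrix.det_mul, Matrix.det_transpose, hKdc, hVd, hWdet]; norm_num)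
  obtain ⟨A, B, hAB⟩ := isLocal_of_orthogonal hKK hKd
  obtain ⟨C, D, hCD⟩ := isLocal_of_orthogonal hRR hRd
  refine ⟨toPU (tensor A B), ⟨A, B, rfl⟩, toPU (tensor C D), ⟨C, D, rfl⟩, ?_⟩
  rw [← map_mul, ← map_mul]
  congr 1
  apply Subtype.ext
  change (u : Matrix (Fin 4) (Fin 4) ℂ) = (tensor A B : Matrix (Fin 4) (Fin 4) ℂ) *
    (v : Matrix (Fin 4) (Fin 4) ℂ) * (tensor C D : Matrix (Fin 4) (Fin 4) ℂ)
  have hWW' := Matrix.mem_unitaryGroup_iff.mp hWU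
  have hKK' := Matrix.mem_unitaryGroup_iff.mp hKc
  rw [hKs] at hKK'
  rw [hAB, hCD, hVu, hWv, ← hR]
  calc _ = Q * ((K.map Complex.ofReal * (K.map Complex.ofReal).transpose) * V) *
        Q.conjTranspose := by rw [hKK', one_mul]
    _ = Q * K.map Complex.ofReal * (W * star W) * (K.map Complex.ofReal).transpose * V *
        Q.conjTranspose := by rw [hWW']; noncomm_ring
    _ = Q * K.map Complex.ofReal * (Q.conjTranspose * Q) * W * (Q.conjTranspose * Q) * star W *
        (K.map Complex.ofReal).transpose * V * Q.conjTranspose := by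
          rw [conjTranspose_Q_mul]; noncomm_ring
    _ = _ := by noncomm_ring

/-! ### The alcove -/

/-- The point `exp (2πix)` of the unit circle. -/
def phase (x : ℝ) : ℂ := Complex.exp (2 * (Real.pi : ℂ) * Complex.I * (x : ℂ))

theorem phase_add (x y : ℝ) : phase (x + y) = phase x * phase y := by
  rw [phase, phase, phase, ← Complex.exp_add]
  push_cast
  ring_nf

theorem phase_eq_one_iff (x : ℝ) : phase x = 1 ↔ ∃ n : ℤ, x = n := by
  rw [phase, Complex.exp_eq_one_iff]
  refine exists_congr fun n => ?_
  rw [mul_comm, mul_left_inj' Complex.two_pi_I_ne_zero]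
  exact_mod_cast Iff.rfl

theorem phase_zero : phase 0 = 1 := by simp [phase]

theorem phase_eq_phase_iff (x y : ℝ) : phase x = phase y ↔ ∃ n : ℤ, x - y = n := by
  have h : phase x = phase (x - y) * phase y := by rw [← phase_add, sub_add_cancel]
  rw [← phase_eq_one_iff, h, mul_eq_right₀ (show phase y ≠ 0 from Complex.exp_ne_zero _)]

theorem norm_phase (x : ℝ) : ‖phase x‖ = 1 := by
  rw [phase, show 2 * (Real.pi : ℂ) * Complex.I * (x : ℂ) =
    ((2 * Real.pi * x : ℝ) : ℂ) * Complex.I by push_cast; ring, Complex.norm_exp_ofReal_mul_I]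

theorem phase_arg {z : ℂ} (hz : ‖z‖ = 1) : phase (Complex.arg z / (2 * Real.pi)) = z := by
  have h := Complex.norm_mul_exp_arg_mul_I z
  rw [hz, Complex.ofReal_one, one_mul] at h
  conv_rhs => rw [← h]
  rw [phase]
  congr 1
  push_cast
  field_simp

theorem star_phase (x : ℝ) : (starRingEnd ℂ) (phase x) = phase (-x) := by
  rw [phase, phase, ← Complex.exp_conj]
  simp [Complex.conj_ofNat]

theorem phase_sub_one (x : ℝ) : phase (x - 1) = phase x :=
  (phase_eq_phase_iff _ _).mpr ⟨-1, by push_cast; ring⟩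

theorem phase_half : phase (1 / 2) = -1 := by
  rw [phase, show 2 * (Real.pi : ℂ) * Complex.I * ((1 / 2 : ℝ) : ℂ) = Real.pi * Complex.I by
    push_cast; ring, Complex.exp_pi_mul_I]

theorem phase_neg_half : phase (-(1 / 2)) = -1 := by
  rw [← star_phase, phase_half]
  simp

theorem fract_arg_phase (a x : ℝ) :
    Int.fract (Complex.arg (phase a) / (2 * Real.pi) - x) = Int.fract (a - x) := by
  obtain ⟨n, hn⟩ := (phase_eq_phase_iff _ _).mp (phase_arg (norm_phase a))
  rw [Int.fract_eq_fract]
  exact ⟨n, by rw [← hn]; ring⟩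

/-- The floors of `a j - x` are decreasing in `j` and differ by at most one, so their sum tells
which of them are nonnegative. -/
theorem le_apply_iff_of_mem_alcove {a : E4} (ha : a ∈ alcove) (x : ℝ) (j : Fin 4) :
    x ≤ a j ↔ (j : ℝ) - 3 ≤ -4 * x - ∑ i, Int.fract (a i - x) := by
  obtain ⟨h0, h1, h2, h3, hs⟩ := ha
  rw [Fin.sum_univ_four] at hs
  have e : -4 * x - ∑ i, Int.fract (a i - x) =
      ((⌊a 0 - x⌋ + ⌊a 1 - x⌋ + ⌊a 2 - x⌋ + ⌊a 3 - x⌋ : ℤ) : ℝ) := by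
    rw [Fin.sum_univ_four]
    simp only [Int.fract]
    push_cast
    linarith
  have f0 : ⌊a 1 - x⌋ ≤ ⌊a 0 - x⌋ := Int.floor_le_floor (by linarith)
  have f1 : ⌊a 2 - x⌋ ≤ ⌊a 1 - x⌋ := Int.floor_le_floor (by linarith)
  have f2 : ⌊a 3 - x⌋ ≤ ⌊a 2 - x⌋ := Int.floor_le_floor (by linarith)
  have f3 : ⌊a 0 - x⌋ - 1 ≤ ⌊a 3 - x⌋ := by
    rw [← Int.floor_sub_one]
    exact Int.floor_le_floor (by linarith)
  have hj : ((j : ℕ) : ℝ) - 3 = (((j : ℕ) : ℤ) - 3 : ℤ) := by push_cast; ring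
  rw [e, hj, Int.cast_le, ← sub_nonneg, ← Int.floor_nonneg]
  fin_cases j <;> simp only [Fin.zero_eta, Fin.mk_one, Fin.reduceFinMk] <;>
    generalize ⌊a 0 - x⌋ = n0 at * <;> generalize ⌊a 1 - x⌋ = n1 at * <;>
    generalize ⌊a 2 - x⌋ = n2 at * <;> generalize ⌊a 3 - x⌋ = n3 at * <;> simp <;> omega

/-- A point of the alcove is determined by the corresponding eigenvalues. -/
theorem alcove_ext {a b : E4} (ha : a ∈ alcove) (hb : b ∈ alcove)
    (h : (Finset.univ : Finset (Fin 4)).val.map (fun j => phase (a j)) =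
      (Finset.univ : Finset (Fin 4)).val.map fun j => phase (b j)) : a = b := by
  have hsum : ∀ x, ∑ i, Int.fract (a i - x) = ∑ i, Int.fract (b i - x) := by
    intro x
    have h1 := congrArg
      (fun s => (Multiset.map (fun z => Int.fract (Complex.arg z / (2 * Real.pi) - x)) s).sum) h
    simp only [Multiset.map_map, Function.comp_def, fract_arg_phase] at h1
    exact h1
  have hle : ∀ x j, x ≤ a j ↔ x ≤ b j := by
    intro x j
    rw [le_apply_iff_of_mem_alcove ha, le_apply_iff_of_mem_alcove hb, hsum]
  ext j
  exact le_antisymm ((hle _ j).mp le_rfl) ((hle _ j).mpr le_rfl)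

theorem map_univ_comp_perm {ι α : Type*} [Fintype ι] (f : ι → α) (σ : Equiv.Perm ι) :
    (Finset.univ : Finset ι).val.map (f ∘ σ) = (Finset.univ : Finset ι).val.map f := by
  rw [← Multiset.map_map, Multiset.map_univ_val_equiv]

/-- The alcove contains a point with given eigenvalues `exp (2πi t_j)` for decreasing `t_j` in
`[0, 1)` with integral sum `n`: subtract one from the `n` largest. -/
theorem exists_mem_alcove_of_decreasing {t : Fin 4 → ℝ} (m0 : t 1 ≤ t 0) (m1 : t 2 ≤ t 1)
    (m2 : t 3 ≤ t 2) (p3 : 0 ≤ t 3) (p0 : t 0 < 1) {n : ℤ} (hn : t 0 + t 1 + t 2 + t 3 = n) :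
    ∃ a ∈ alcove, (Finset.univ : Finset (Fin 4)).val.map (fun j => phase (t j)) =
      (Finset.univ : Finset (Fin 4)).val.map fun j => phase (a j) := by
  have hn0 : 0 ≤ n := by exact_mod_cast (by linarith : (0 : ℝ) ≤ n)
  have hn4 : n < 4 := by exact_mod_cast (by linarith : (n : ℝ) < 4)
  -- it suffices to find the point up to a rotation of the coordinates
  suffices h : ∃ a ∈ alcove, ∃ σ : Equiv.Perm (Fin 4), ∀ j, phase (a j) = phase (t (σ j)) by
    obtain ⟨a, ha, σ, h⟩ := h
    refine ⟨a, ha, ?_⟩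
    rw [← map_univ_comp_perm _ σ]
    congr 1
    ext j
    rw [h, Function.comp_apply]
  interval_cases n <;> push_cast at hn
  · refine ⟨!₂[t 0, t 1, t 2, t 3], ?_, 1, fun j => ?_⟩
    · simp only [alcove, Set.mem_ofPred_eq, Fin.sum_univ_four]
      refine ⟨?_, ?_, ?_, ?_, ?_⟩ <;> simp <;> linarith
    · fin_cases j <;> rfl
  · refine ⟨!₂[t 1, t 2, t 3, t 0 - 1], ?_, Equiv.addRight 1, fun j => ?_⟩
    · simp only [alcove, Set.mem_ofPred_eq, Fin.sum_univ_four]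
      refine ⟨?_, ?_, ?_, ?_, ?_⟩ <;> simp <;> linarith
    · fin_cases j <;> first | rfl | exact phase_sub_one _
  · refine ⟨!₂[t 2, t 3, t 0 - 1, t 1 - 1], ?_, Equiv.addRight 2, fun j => ?_⟩
    · simp only [alcove, Set.mem_ofPred_eq, Fin.sum_univ_four]
      refine ⟨?_, ?_, ?_, ?_, ?_⟩ <;> simp <;> linarith
    · fin_cases j <;> first | rfl | exact phase_sub_one _
  · refine ⟨!₂[t 3, t 0 - 1, t 1 - 1, t 2 - 1], ?_, Equiv.addRight 3, fun j => ?_⟩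
    · simp only [alcove, Set.mem_ofPred_eq, Fin.sum_univ_four]
      refine ⟨?_, ?_, ?_, ?_, ?_⟩ <;> simp <;> linarith
    · fin_cases j <;> first | rfl | exact phase_sub_one _

/-- Four points of the unit circle with product one come from a point of the alcove: take their
arguments in `[0, 1)` in decreasing order, and subtract one from the largest ones until the sum
vanishes. -/
theorem exists_mem_alcove {d : Fin 4 → ℂ} (hd : ∀ j, ‖d j‖ = 1) (hp : ∏ j, d j = 1) :
    ∃ a ∈ alcove, (Finset.univ : Finset (Fin 4)).val.map d =
      (Finset.univ : Finset (Fin 4)).val.map fun j => phase (a j) := by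
  set θ : Fin 4 → ℝ := fun j => Int.fract (Complex.arg (d j) / (2 * Real.pi)) with hθ
  have hθd : ∀ j, phase (θ j) = d j := by
    intro j
    conv_rhs => rw [← phase_arg (hd j)]
    exact (phase_eq_phase_iff _ _).mpr
      ⟨-⌊Complex.arg (d j) / (2 * Real.pi)⌋, by
        rw [hθ]; push_cast; rw [← Int.self_sub_floor]; ring⟩
  set σ := Tuple.sort (fun j => -θ j) with hσ
  have hm : Monotone ((fun j => -θ j) ∘ σ) := Tuple.monotone_sort _
  have m0 : θ (σ 1) ≤ θ (σ 0) := neg_le_neg_iff.mp (hm (by decide : (0 : Fin 4) ≤ 1))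
  have m1 : θ (σ 2) ≤ θ (σ 1) := neg_le_neg_iff.mp (hm (by decide : (1 : Fin 4) ≤ 2))
  have m2 : θ (σ 3) ≤ θ (σ 2) := neg_le_neg_iff.mp (hm (by decide : (2 : Fin 4) ≤ 3))
  have p3 : 0 ≤ θ (σ 3) := Int.fract_nonneg _
  have p0 : θ (σ 0) < 1 := Int.fract_lt_one _
  have hd' : (Finset.univ : Finset (Fin 4)).val.map d =
      (Finset.univ : Finset (Fin 4)).val.map fun j => phase (θ (σ j)) := by
    rw [← map_univ_comp_perm d σ]
    congr 1
    ext j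
    rw [hθd, Function.comp_apply]
  rw [hd']
  have hsum : ∃ n : ℤ, θ (σ 0) + θ (σ 1) + θ (σ 2) + θ (σ 3) = n := by
    rw [← phase_eq_one_iff, phase_add, phase_add, phase_add, hθd, hθd, hθd, hθd, ← hp,
      ← Equiv.prod_comp σ, Fin.prod_univ_four]
  obtain ⟨n, hn⟩ := hsum
  exact exists_mem_alcove_of_decreasing (t := fun j => θ (σ j)) m0 m1 m2 p3 p0 hn

/-! ### The coordinate of a gate -/

theorem exists_roots_cartanDouble {u : U 4} (hu : (u : Matrix (Fin 4) (Fin 4) ℂ).det = 1) :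
    ∃ d : Fin 4 → ℂ, (∀ j, ‖d j‖ = 1) ∧ ∏ j, d j = 1 ∧
      (cartanDouble (u : Matrix (Fin 4) (Fin 4) ℂ)).charpoly.roots =
        (Finset.univ : Finset (Fin 4)).val.map d := by
  have hU := cartanDouble_mem_unitaryGroup u
  obtain ⟨O, d, hO, hM⟩ := exists_orthogonal_diagonalization hU (cartanDouble_transpose _)
  have hroots := charpoly_roots_orthogonal_diagonal d hO
  have hOc : (O.map Complex.ofReal).transpose * O.map Complex.ofReal = 1 := by
    rw [← Matrix.transpose_map, ← map_ofReal_mul, hO, map_ofReal_one]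
  have hOs : star (O.map Complex.ofReal) = (O.map Complex.ofReal).transpose := by
    ext i j
    simp
  have hOU : O.map Complex.ofReal ∈ Matrix.unitaryGroup (Fin 4) ℂ := by
    rw [Matrix.mem_unitaryGroup_iff', hOs, hOc]
  have hD : Matrix.diagonal d = star (O.map Complex.ofReal) *
      cartanDouble (u : Matrix (Fin 4) (Fin 4) ℂ) * O.map Complex.ofReal := by
    rw [hM, hOs]
    calc _ = 1 * Matrix.diagonal d * 1 := by rw [one_mul, mul_one]
      _ = _ := by rw [← hOc]; noncomm_ring
  have hDU : Matrix.diagonal d ∈ Matrix.unitaryGroup (Fin 4) ℂ := by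
    rw [hD]
    exact mul_mem (mul_mem (Unitary.star_mem hOU) hU) hOU
  refine ⟨d, fun j => ?_, ?_, by rw [hM, hroots]⟩
  · rw [Matrix.mem_unitaryGroup_iff, Matrix.star_eq_conjTranspose, Matrix.diagonal_conjTranspose,
      Matrix.diagonal_mul_diagonal] at hDU
    have h := congrFun (congrFun hDU j) j
    rw [Matrix.diagonal_apply_eq, Matrix.one_apply_eq, Pi.star_apply, RCLike.star_def,
      Complex.mul_conj, Complex.normSq_eq_norm_sq] at h
    have h' : ‖d j‖ ^ 2 = 1 := by exact_mod_cast h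
    exact (pow_eq_one_iff_of_nonneg (norm_nonneg _) two_ne_zero).mp h'
  · have h1 : (cartanDouble (u : Matrix (Fin 4) (Fin 4) ℂ)).det = 1 := by
      rw [cartanDouble, Matrix.det_mul, Matrix.det_transpose, det_Qconj, hu, one_mul]
    have h2 := congrArg Matrix.det hOc
    rw [Matrix.det_mul, Matrix.det_one] at h2
    rw [hM, Matrix.det_mul, Matrix.det_mul, Matrix.det_diagonal] at h1
    linear_combination h1 - (∏ j, d j) * h2

theorem cartanDouble_smul (c : ℂ) (u : Matrix (Fin 4) (Fin 4) ℂ) :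
    cartanDouble (c • u) = c ^ 2 • cartanDouble u := by
  rw [cartanDouble_eq, cartanDouble_eq, spinFlip_smul, smul_mul_smul_comm, mul_smul_comm,
    smul_mul_assoc, sq]

theorem roots_cartanDouble_smul {u : U 4} {d : Fin 4 → ℂ}
    (h : (cartanDouble (u : Matrix (Fin 4) (Fin 4) ℂ)).charpoly.roots =
      (Finset.univ : Finset (Fin 4)).val.map d) (c : ℂ) :
    (cartanDouble (c • (u : Matrix (Fin 4) (Fin 4) ℂ))).charpoly.roots =
      (Finset.univ : Finset (Fin 4)).val.map fun j => c ^ 2 * d j := by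
  obtain ⟨O, hO, -, hM⟩ := exists_rotation_diagonalization (cartanDouble_mem_unitaryGroup u)
    (cartanDouble_transpose _) h
  rw [← charpoly_roots_orthogonal_diagonal (fun j => c ^ 2 * d j) hO, cartanDouble_smul, hM]
  have e : Matrix.diagonal (fun j => c ^ 2 * d j) = c ^ 2 • Matrix.diagonal d := by
    rw [← Matrix.diagonal_smul]
    rfl
  rw [e, mul_smul_comm, smul_mul_assoc]

theorem exists_isLogSpec {u : U 4} (hu : (u : Matrix (Fin 4) (Fin 4) ℂ).det = 1) :
    ∃ a, IsLogSpec (cartanDouble (u : Matrix (Fin 4) (Fin 4) ℂ)) a := by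
  obtain ⟨d, hd, hp, hr⟩ := exists_roots_cartanDouble hu
  obtain ⟨a, ha, h⟩ := exists_mem_alcove hd hp
  exact ⟨a, ha, hr.trans h⟩

/-- The symmetry of the alcove given by multiplying the eigenvalues by `-1`. -/
def alcoveFlip (a : E4) : E4 := !₂[a 2 + 1 / 2, a 3 + 1 / 2, a 0 - 1 / 2, a 1 - 1 / 2]

theorem alcoveFlip_mem {a : E4} (ha : a ∈ alcove) : alcoveFlip a ∈ alcove := by
  obtain ⟨h0, h1, h2, h3, hs⟩ := ha
  rw [Fin.sum_univ_four] at hs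
  simp only [alcove, alcoveFlip, Set.mem_ofPred_eq, Fin.sum_univ_four]
  refine ⟨?_, ?_, ?_, ?_, ?_⟩ <;> simp <;> linarith

theorem map_phase_alcoveFlip (a : E4) :
    ((Finset.univ : Finset (Fin 4)).val.map fun j => phase (alcoveFlip a j)) =
      (Finset.univ : Finset (Fin 4)).val.map fun j => -1 * phase (a j) := by
  rw [← map_univ_comp_perm _ (Equiv.addRight (2 : Fin 4))]
  congr 1
  ext j
  fin_cases j <;>
    simp [alcoveFlip, sub_eq_add_neg, phase_add, -one_div, phase_half, phase_neg_half]

/-- The set `alcoveC2` meets every orbit of `alcoveFlip`. -/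
theorem mem_alcoveC2_or_alcoveFlip_mem {a : E4} (ha : a ∈ alcove) :
    a ∈ alcoveC2 ∨ alcoveFlip a ∈ alcoveC2 := by
  have hf := alcoveFlip_mem ha
  simp only [alcoveC2, Set.mem_ofPred_eq, ha, hf, true_and]
  simp only [alcoveFlip]
  simp
  grind

/-- The set `alcoveC2` meets every orbit of `alcoveFlip` in one point only: the second clause of its
definition takes care of the boundary. -/
theorem eq_of_mem_alcoveC2_of_alcoveFlip_mem {a : E4} (ha : a ∈ alcoveC2)
    (h : alcoveFlip a ∈ alcoveC2) : alcoveFlip a = a := by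
  obtain ⟨-, h1⟩ := ha
  obtain ⟨-, h2⟩ := h
  simp only [alcoveFlip] at h2
  simp at h1 h2
  have h3 : a 0 = a 2 + 1 / 2 ∧ a 1 = a 3 + 1 / 2 := by
    rcases h1 with h1 | ⟨h1, h1'⟩ <;> rcases h2 with h2 | ⟨h2, h2'⟩ <;>
      constructor <;> linarith
  ext j
  fin_cases j <;> simp [alcoveFlip, h3.1, h3.2]

/-- Two lifts of a gate to `SU(4)` differ by a fourth root of unity. The statement records its
square, which is the factor between the Cartan doubles. -/
theorem smul_eq_of_toPU_eq {u v : U 4} (hu : (u : Matrix (Fin 4) (Fin 4) ℂ).det = 1)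
    (hv : (v : Matrix (Fin 4) (Fin 4) ℂ).det = 1) (h : toPU u = toPU v) :
    ∃ c : ℂ, (c ^ 2 = 1 ∨ c ^ 2 = -1) ∧
      (v : Matrix (Fin 4) (Fin 4) ℂ) = c • (u : Matrix (Fin 4) (Fin 4) ℂ) := by
  obtain ⟨c, hc⟩ := exists_eq_smul_of_toPU_eq h
  refine ⟨c, ?_, hc⟩
  rw [hc, Matrix.det_smul, hu, mul_one, Fintype.card_fin] at hv
  have h2 : (c ^ 2 - 1) * (c ^ 2 + 1) = 0 := by linear_combination hv
  rcases mul_eq_zero.mp h2 with h2 | h2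
  · exact Or.inl (sub_eq_zero.mp h2)
  · exact Or.inr (eq_neg_of_add_eq_zero_left h2)

theorem existsUnique_isCoord (g : PU 4) : ∃! a : E4, IsCoord g a := by
  obtain ⟨u, rfl, hu⟩ := exists_toPU_eq_det_eq_one g
  refine existsUnique_of_exists_of_unique ?_ ?_
  · obtain ⟨a, ha, hr⟩ := exists_isLogSpec hu
    rcases mem_alcoveC2_or_alcoveFlip_mem ha with h | h
    · exact ⟨a, h, u, hu, rfl, ha, hr⟩
    · refine ⟨alcoveFlip a, h, ⟨_, smul_mem_unitaryGroup Complex.norm_I u⟩, ?_,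
        (toPU_eq_of_eq_smul rfl).symm, alcoveFlip_mem ha, ?_⟩
      · rw [Matrix.det_smul, hu, Fintype.card_fin, Complex.I_pow_four, one_mul]
      · rw [roots_cartanDouble_smul hr, Complex.I_sq]
        exact (map_phase_alcoveFlip a).symm
  · rintro a b ⟨ha, v, hv, hvu, hla⟩ ⟨hb, w, hw, hwu, hlb⟩
    obtain ⟨c, hc, hwv⟩ := smul_eq_of_toPU_eq hv hw (hvu.trans hwu.symm)
    have hr := roots_cartanDouble_smul hla.2 c
    rw [← hwv, hlb.2] at hr
    rcases hc with hc | hc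
    · simp only [hc, one_mul] at hr
      exact alcove_ext hla.1 hlb.1 hr.symm
    · rw [hc] at hr
      have hba : b = alcoveFlip a :=
        alcove_ext hlb.1 (alcoveFlip_mem hla.1) (hr.trans (map_phase_alcoveFlip a).symm)
      rw [hba] at hb ⊢
      exact (eq_of_mem_alcoveC2_of_alcoveFlip_mem ha hb).symm

theorem isCoord_coord (g : PU 4) : IsCoord g (coord g) :=
  Classical.epsilon_spec (existsUnique_isCoord g).exists

theorem IsCoord.coord_eq {g : PU 4} {a : E4} (h : IsCoord g a) : coord g = a :=
  (existsUnique_isCoord g).unique (isCoord_coord g) h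

/-- Every point `a` of `alcoveC2` is a coordinate: of the gate which in the basis of the columns of
`Q` is diagonal with eigenvalues `exp (πi a_j)`. -/
theorem exists_coord_eq {a : E4} (ha : a ∈ alcoveC2) : ∃ g, coord g = a := by
  have hQ : Q ∈ Matrix.unitaryGroup (Fin 4) ℂ :=
    Matrix.mem_unitaryGroup_iff.mpr Q_mul_conjTranspose
  have hD : Matrix.diagonal (fun j => phase (a j / 2)) ∈ Matrix.unitaryGroup (Fin 4) ℂ := by
    rw [Matrix.mem_unitaryGroup_iff, Matrix.star_eq_conjTranspose, Matrix.diagonal_conjTranspose,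
      Matrix.diagonal_mul_diagonal, ← Matrix.diagonal_one]
    congr 1
    ext j
    rw [Pi.star_apply, RCLike.star_def, star_phase, ← phase_add, add_neg_cancel, phase_zero]
  have hu := mul_mem (mul_mem hQ hD) (Unitary.star_mem hQ)
  refine ⟨toPU ⟨_, hu⟩, IsCoord.coord_eq ⟨ha, ⟨_, hu⟩, ?_, rfl, ha.1, ?_⟩⟩
  · have h := congrArg Matrix.det Q_mul_conjTranspose
    rw [Matrix.det_mul, Matrix.det_one] at h
    have hs := ha.1.2.2.2.2
    rw [Fin.sum_univ_four] at hs
    rw [Matrix.det_mul, Matrix.det_mul, mul_right_comm, Matrix.star_eq_conjTranspose, h, one_mul,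
      Matrix.det_diagonal, Fin.prod_univ_four, ← phase_add, ← phase_add, ← phase_add, ← phase_zero]
    congr 1
    linarith
  · have h : cartanDouble (Q * Matrix.diagonal (fun j => phase (a j / 2)) * star Q) =
        Matrix.diagonal fun j => phase (a j) := by
      have h1 : Q.conjTranspose * (Q * Matrix.diagonal (fun j => phase (a j / 2)) * star Q) * Q =
          Matrix.diagonal fun j => phase (a j / 2) := by
        calc _ = (Q.conjTranspose * Q) * Matrix.diagonal (fun j => phase (a j / 2)) *
              (Q.conjTranspose * Q) := by
              rw [Matrix.star_eq_conjTranspose]; noncomm_ring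
          _ = _ := by rw [conjTranspose_Q_mul, one_mul, mul_one]
      rw [cartanDouble, h1, Matrix.diagonal_transpose, Matrix.diagonal_mul_diagonal]
      congr 1
      ext j
      rw [← phase_add, add_halves]
    rw [h, Matrix.charpoly_diagonal]
    have := Polynomial.roots_multiset_prod_X_sub_C
      ((Finset.univ : Finset (Fin 4)).val.map fun j => phase (a j))
    rwa [Multiset.map_map] at this

/-! ### Gates whose Cartan double has real trace -/

/-- Invariance under complex conjugation of the eigenvalues, which in the alcove is the map
`(a₀, a₁, a₂, a₃) ↦ (-a₃, -a₂, -a₁, -a₀)`. -/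
def IsConjSymm (a : E4) : Prop := a 0 = -a 3 ∧ a 1 = -a 2

theorem im_sum_phase_eq_zero_of_isConjSymm {a : E4} (h : IsConjSymm a) :
    (∑ j, phase (a j)).im = 0 := by
  rw [← Complex.conj_eq_iff_im, map_sum, Fin.sum_univ_four, Fin.sum_univ_four]
  simp only [star_phase, h.1, h.2, neg_neg]
  ring

open Polynomial in
/-- The polynomial with four roots on the unit circle of product one is self-conjugate as soon as
the sum of the roots is real, because its middle coefficient is real anyway. -/
theorem prod_X_sub_C_conj {d : Fin 4 → ℂ} (hd : ∀ j, ‖d j‖ = 1) (hp : ∏ j, d j = 1)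
    (him : (∑ j, d j).im = 0) :
    ∏ j, (X - C ((starRingEnd ℂ) (d j))) = ∏ j, (X - C (d j)) := by
  have hc : ∀ j, d j * (starRingEnd ℂ) (d j) = 1 := by
    intro j
    rw [Complex.mul_conj, Complex.normSq_eq_norm_sq, hd]
    simp
  rw [← Complex.conj_eq_iff_im, map_sum] at him
  rw [Fin.prod_univ_four] at hp
  rw [Fin.sum_univ_four, Fin.sum_univ_four] at him
  have c0 : (starRingEnd ℂ) (d 0) = d 1 * d 2 * d 3 := by
    linear_combination d 1 * d 2 * d 3 * hc 0 - (starRingEnd ℂ) (d 0) * hp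
  have c1 : (starRingEnd ℂ) (d 1) = d 0 * d 2 * d 3 := by
    linear_combination d 0 * d 2 * d 3 * hc 1 - (starRingEnd ℂ) (d 1) * hp
  have c2 : (starRingEnd ℂ) (d 2) = d 0 * d 1 * d 3 := by
    linear_combination d 0 * d 1 * d 3 * hc 2 - (starRingEnd ℂ) (d 2) * hp
  have c3 : (starRingEnd ℂ) (d 3) = d 0 * d 1 * d 2 := by
    linear_combination d 0 * d 1 * d 2 * hc 3 - (starRingEnd ℂ) (d 3) * hp
  rw [c0, c1, c2, c3] at him
  have hpC := congrArg C hp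
  have himC := congrArg C him
  simp only [C_mul, C_add, C_1] at hpC himC
  rw [Fin.prod_univ_four, Fin.prod_univ_four, c0, c1, c2, c3]
  simp only [C_mul]
  generalize C (d 0) = x at *
  generalize C (d 1) = y at *
  generalize C (d 2) = z at *
  generalize C (d 3) = w at *
  linear_combination (-X ^ 3 + X) * himC + (X ^ 2 * (x * y + x * z + x * w + y * z + y * w + z * w)
    - X * (x + y + z + w) * (x * y * z * w + 1) +
    (x * y * z * w) * (x * y * z * w + 1)) * hpC

/-- Eigenvalues with a real sum are permuted by complex conjugation, and a point of the alcove is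
determined by its eigenvalues. -/
theorem isConjSymm_iff {a : E4} (ha : a ∈ alcove) :
    IsConjSymm a ↔ (∑ j, phase (a j)).im = 0 := by
  refine ⟨im_sum_phase_eq_zero_of_isConjSymm, fun h => ?_⟩
  have hp : ∏ j, phase (a j) = 1 := by
    have hs := ha.2.2.2.2
    rw [Fin.sum_univ_four] at hs
    rw [Fin.prod_univ_four, ← phase_add, ← phase_add, ← phase_add, hs, phase_zero]
  have hpoly := prod_X_sub_C_conj (fun j => norm_phase (a j)) hp h
  have hroots : ∀ f : Fin 4 → ℂ, (∏ j, (Polynomial.X - Polynomial.C (f j))).roots =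
      (Finset.univ : Finset (Fin 4)).val.map f := by
    intro f
    have := Polynomial.roots_multiset_prod_X_sub_C ((Finset.univ : Finset (Fin 4)).val.map f)
    rwa [Multiset.map_map] at this
  have hmap := (hroots _).symm.trans ((congrArg Polynomial.roots hpoly).trans (hroots _))
  -- the point of the alcove with the conjugate eigenvalues
  set b : E4 := !₂[-a 3, -a 2, -a 1, -a 0] with hb
  have hbm : b ∈ alcove := by
    obtain ⟨h0, h1, h2, h3, hs⟩ := ha
    rw [Fin.sum_univ_four] at hs
    simp only [alcove, hb, Set.mem_ofPred_eq, Fin.sum_univ_four]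
    refine ⟨?_, ?_, ?_, ?_, ?_⟩ <;> simp <;> linarith
  have hab : a = b := by
    refine alcove_ext ha hbm (hmap.symm.trans ?_)
    rw [← map_univ_comp_perm _ Fin.revPerm]
    congr 1
    ext j
    fin_cases j <;> simp [star_phase, hb]
  constructor
  · conv_lhs => rw [hab]
    simp [hb]
  · conv_lhs => rw [hab]
    simp [hb]

theorem trace_eq_sum_of_roots {M : Matrix (Fin 4) (Fin 4) ℂ} {d : Fin 4 → ℂ}
    (h : M.charpoly.roots = (Finset.univ : Finset (Fin 4)).val.map d) :
    M.trace = ∑ j, d j := by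
  rw [Matrix.trace_eq_sum_roots_charpoly, h]
  rfl

/-- The coordinate of a gate in `SU(4)` is symmetric under conjugation if and only if the trace of
its Cartan double is real. -/
theorem isConjSymm_coord_iff {u : U 4} (hu : (u : Matrix (Fin 4) (Fin 4) ℂ).det = 1) :
    IsConjSymm (coord (toPU u)) ↔
      (cartanDouble (u : Matrix (Fin 4) (Fin 4) ℂ)).trace.im = 0 := by
  obtain ⟨-, v, hv, hvu, ha, hr⟩ := isCoord_coord (toPU u)
  obtain ⟨c, hc, huv⟩ := smul_eq_of_toPU_eq hv hu hvu
  rw [isConjSymm_iff ha, huv, cartanDouble_smul, Matrix.trace_smul, trace_eq_sum_of_roots hr]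
  rcases hc with hc | hc <;> simp [hc, phase]

theorem trace_cartanDouble (u : Matrix (Fin 4) (Fin 4) ℂ) :
    (cartanDouble u).trace = (u * spinFlip u).trace := by
  rw [cartanDouble_eq, mul_assoc, Matrix.trace_mul_comm, mul_assoc, Q_mul_conjTranspose, mul_one]

/-! ### Gates whose double is `Z ⊗ Z` -/

/-- The matrix `Z ⊗ Z`. -/
def zz : Matrix (Fin 4) (Fin 4) ℂ := !![1, 0, 0, 0; 0, -1, 0, 0; 0, 0, -1, 0; 0, 0, 0, 1]

theorem zz_mul_self : zz * zz = 1 := by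
  ext i j
  fin_cases i <;> fin_cases j <;> simp [zz]

theorem star_zz : star zz = zz := by
  rw [Matrix.star_eq_conjTranspose]
  ext i j
  fin_cases i <;> fin_cases j <;> simp [zz]

theorem det_zz : zz.det = 1 := by
  have h : zz = Matrix.diagonal ![1, -1, -1, 1] := by
    ext i j
    fin_cases i <;> fin_cases j <;> simp [zz]
  rw [h, Matrix.det_diagonal, Fin.prod_univ_four]
  simp

/-- The products of `s` with its spin flip, in both orders, are `ε Z ⊗ Z` with a sign `ε`. This
holds for `iSWAP` and for `CZ`, and is all that the results on depth two and three need. -/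
structure DoublesToZZ (s : U 4) (ε : ℂ) : Prop where
  sign : ε * ε = 1
  double_eq : (s : Matrix (Fin 4) (Fin 4) ℂ) * spinFlip (s : Matrix (Fin 4) (Fin 4) ℂ) = ε • zz
  coDouble_eq : spinFlip (s : Matrix (Fin 4) (Fin 4) ℂ) * (s : Matrix (Fin 4) (Fin 4) ℂ) = ε • zz

theorem spinFlip_iswapU : spinFlip (iswapU : Matrix (Fin 4) (Fin 4) ℂ) = iswapU := by
  rw [spinFlip_eq]
  ext i j
  fin_cases i <;> fin_cases j <;> simp [iswapU]

theorem iswapU_mul_self :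
    (iswapU : Matrix (Fin 4) (Fin 4) ℂ) * (iswapU : Matrix (Fin 4) (Fin 4) ℂ) = zz := by
  ext i j
  fin_cases i <;> fin_cases j <;> simp [iswapU, zz]

theorem doublesToZZ_iswapU : DoublesToZZ iswapU 1 where
  sign := one_mul 1
  double_eq := by rw [spinFlip_iswapU, iswapU_mul_self, one_smul]
  coDouble_eq := by rw [spinFlip_iswapU, iswapU_mul_self, one_smul]

theorem doublesToZZ_czU : DoublesToZZ czU (-1) where
  sign := by norm_num
  double_eq := by
    rw [spinFlip_eq]
    ext i j
    fin_cases i <;> fin_cases j <;> simp [czU, zz]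
  coDouble_eq := by
    rw [spinFlip_eq]
    ext i j
    fin_cases i <;> fin_cases j <;> simp [czU, zz]

theorem DoublesToZZ.det_mul_self {s : U 4} {ε : ℂ} (hs : DoublesToZZ s ε) :
    (s : Matrix (Fin 4) (Fin 4) ℂ).det * (s : Matrix (Fin 4) (Fin 4) ℂ).det = 1 := by
  have h := congrArg Matrix.det hs.double_eq
  rw [Matrix.det_mul, det_spinFlip, Matrix.det_smul, det_zz, mul_one, Fintype.card_fin] at h
  rw [h]
  linear_combination (ε ^ 2 + 1) * hs.sign

theorem det_tensor {A B : U 2} (hA : (A : Matrix (Fin 2) (Fin 2) ℂ).det = 1)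
    (hB : (B : Matrix (Fin 2) (Fin 2) ℂ).det = 1) :
    (tensor A B : Matrix (Fin 4) (Fin 4) ℂ).det = 1 := by
  simp only [tensor]
  rw [Matrix.det_reindex_self, Matrix.det_kronecker, hA, hB]
  simp

theorem inv_mul_tensor (A B : U 2) :
    (tensor A⁻¹ B⁻¹ : Matrix (Fin 4) (Fin 4) ℂ) * (tensor A B : Matrix (Fin 4) (Fin 4) ℂ) = 1 := by
  rw [← Submonoid.coe_mul, tensor_mul, inv_mul_cancel, inv_mul_cancel, tensor_one]
  rfl

theorem mul_inv_tensor (A B : U 2) :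
    (tensor A B : Matrix (Fin 4) (Fin 4) ℂ) * (tensor A⁻¹ B⁻¹ : Matrix (Fin 4) (Fin 4) ℂ) = 1 :=
  mul_eq_one_comm.mp (inv_mul_tensor A B)

/-- The spectrum of the Cartan double is invariant under local gates on both sides. -/
theorem charpoly_cartanDouble_local {A B C D : U 2}
    (hA : (A : Matrix (Fin 2) (Fin 2) ℂ).det = 1) (hB : (B : Matrix (Fin 2) (Fin 2) ℂ).det = 1)
    (hC : (C : Matrix (Fin 2) (Fin 2) ℂ).det = 1) (hD : (D : Matrix (Fin 2) (Fin 2) ℂ).det = 1)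
    (w : Matrix (Fin 4) (Fin 4) ℂ) :
    (cartanDouble ((tensor A B : Matrix (Fin 4) (Fin 4) ℂ) * w *
      (tensor C D : Matrix (Fin 4) (Fin 4) ℂ))).charpoly = (cartanDouble w).charpoly := by
  rw [charpoly_cartanDouble, charpoly_cartanDouble, spinFlip_mul, spinFlip_mul,
    spinFlip_tensor hA hB, spinFlip_tensor hC hD,
    ← charpoly_mul_mul_of_mul_eq_one (mul_inv_tensor A B) (w * spinFlip w)]
  congr 1
  calc _ = (tensor A B : Matrix (Fin 4) (Fin 4) ℂ) * w *
        ((tensor C D : Matrix (Fin 4) (Fin 4) ℂ) * (tensor C⁻¹ D⁻¹ : Matrix (Fin 4) (Fin 4) ℂ)) *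
        spinFlip w * (tensor A⁻¹ B⁻¹ : Matrix (Fin 4) (Fin 4) ℂ) := by noncomm_ring
    _ = _ := by rw [mul_inv_tensor]; noncomm_ring

/-- The spectrum of the Cartan double of `s (A ⊗ B) s` for a gate `s` doubling to `Z ⊗ Z` does not
depend on `s`. -/
theorem DoublesToZZ.charpoly_cartanDouble_mul_tensor_mul {s : U 4} {ε : ℂ}
    (hs : DoublesToZZ s ε) {A B : U 2}
    (hA : (A : Matrix (Fin 2) (Fin 2) ℂ).det = 1) (hB : (B : Matrix (Fin 2) (Fin 2) ℂ).det = 1) :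
    (cartanDouble ((s : Matrix (Fin 4) (Fin 4) ℂ) * (tensor A B : Matrix (Fin 4) (Fin 4) ℂ) *
      (s : Matrix (Fin 4) (Fin 4) ℂ))).charpoly =
    ((tensor A B : Matrix (Fin 4) (Fin 4) ℂ) * zz *
      (tensor A⁻¹ B⁻¹ : Matrix (Fin 4) (Fin 4) ℂ) * zz).charpoly := by
  have hss : (s : Matrix (Fin 4) (Fin 4) ℂ) * star (s : Matrix (Fin 4) (Fin 4) ℂ) = 1 :=
    Matrix.mem_unitaryGroup_iff.mp s.2
  have hf : spinFlip (s : Matrix (Fin 4) (Fin 4) ℂ) =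
      ε • (zz * star (s : Matrix (Fin 4) (Fin 4) ℂ)) := by
    rw [← smul_mul_assoc, ← hs.coDouble_eq, mul_assoc, hss, mul_one]
  rw [charpoly_cartanDouble, spinFlip_mul, spinFlip_mul,
    spinFlip_tensor hA hB, ← charpoly_mul_mul_of_mul_eq_one hss
      ((tensor A B : Matrix (Fin 4) (Fin 4) ℂ) * zz *
      (tensor A⁻¹ B⁻¹ : Matrix (Fin 4) (Fin 4) ℂ) * zz)]
  congr 1
  calc _ = (s : Matrix (Fin 4) (Fin 4) ℂ) * (tensor A B : Matrix (Fin 4) (Fin 4) ℂ) *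
        ((s : Matrix (Fin 4) (Fin 4) ℂ) * spinFlip (s : Matrix (Fin 4) (Fin 4) ℂ)) *
        (tensor A⁻¹ B⁻¹ : Matrix (Fin 4) (Fin 4) ℂ) *
        spinFlip (s : Matrix (Fin 4) (Fin 4) ℂ) := by noncomm_ring
    _ = (ε * ε) • ((s : Matrix (Fin 4) (Fin 4) ℂ) * (tensor A B : Matrix (Fin 4) (Fin 4) ℂ) * zz *
        (tensor A⁻¹ B⁻¹ : Matrix (Fin 4) (Fin 4) ℂ) *
        (zz * star (s : Matrix (Fin 4) (Fin 4) ℂ))) := by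
      rw [hs.double_eq, hf]
      simp only [mul_smul_comm, smul_mul_assoc, smul_smul]
    _ = _ := by rw [hs.sign, one_smul]; noncomm_ring

theorem rotX_mul (α β : ℝ) : rotX α * rotX β = rotX (α + β) := by
  apply Subtype.ext
  rw [Submonoid.coe_mul]
  simp only [rotX, add_div, Real.cos_add, Real.sin_add, Complex.ofReal_sub, Complex.ofReal_mul,
    Complex.ofReal_add]
  generalize (Real.cos (α / 2) : ℂ) = c
  generalize (Real.sin (α / 2) : ℂ) = s
  generalize (Real.cos (β / 2) : ℂ) = c'
  generalize (Real.sin (β / 2) : ℂ) = s'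
  have hI := Complex.I_mul_I
  ext i j
  fin_cases i <;> fin_cases j <;> simp <;> grind

theorem rotX_zero : rotX 0 = 1 := by
  apply Subtype.ext
  ext i j
  fin_cases i <;> fin_cases j <;> simp [rotX]

theorem rotX_inv (α : ℝ) : (rotX α)⁻¹ = rotX (-α) := by
  rw [inv_eq_iff_mul_eq_one, rotX_mul, add_neg_cancel, rotX_zero]

theorem det_rotX (α : ℝ) : (rotX α : Matrix (Fin 2) (Fin 2) ℂ).det = 1 := by
  have h := (cos_sin_double_half α).1
  rw [Matrix.det_fin_two]
  simp only [rotX]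
  generalize (Real.cos (α / 2) : ℂ) = c at h ⊢
  generalize (Real.sin (α / 2) : ℂ) = s at h ⊢
  simp
  linear_combination h - s ^ 2 * Complex.I_sq

theorem det_rotY (α : ℝ) : (rotY α : Matrix (Fin 2) (Fin 2) ℂ).det = 1 := by
  have h := (cos_sin_double_half α).1
  rw [Matrix.det_fin_two]
  simp only [rotY]
  generalize (Real.cos (α / 2) : ℂ) = c at h ⊢
  generalize (Real.sin (α / 2) : ℂ) = s at h ⊢
  simp
  linear_combination h

/-- The two-qubit Hadamard matrix, which diagonalizes `X`-rotations. -/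
def hadamard : Matrix (Fin 4) (Fin 4) ℂ :=
  !![1 / 2, 1 / 2, 1 / 2, 1 / 2; 1 / 2, -1 / 2, 1 / 2, -1 / 2;
     1 / 2, 1 / 2, -1 / 2, -1 / 2; 1 / 2, -1 / 2, -1 / 2, 1 / 2]

theorem hadamard_mul_self : hadamard * hadamard = 1 := by
  ext i j
  fin_cases i <;> fin_cases j <;> simp [hadamard] <;> norm_num

theorem tensor_rotX_mul_zz (α β : ℝ) :
    (tensor (rotX α) (rotX β) : Matrix (Fin 4) (Fin 4) ℂ) * zz =
      zz * (tensor (rotX (-α)) (rotX (-β)) : Matrix (Fin 4) (Fin 4) ℂ) := by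
  rw [tensor_val, tensor_val]
  simp only [rotX, neg_div, Real.cos_neg, Real.sin_neg, zz]
  ext i j
  fin_cases i <;> fin_cases j <;> simp [-Complex.ofReal_cos, -Complex.ofReal_sin]

theorem phase_eq_cos_add_sin (x : ℝ) :
    phase x = (Real.cos (2 * Real.pi * x) : ℂ) + Complex.I * (Real.sin (2 * Real.pi * x) : ℂ) := by
  rw [phase, show 2 * (Real.pi : ℂ) * Complex.I * (x : ℂ) =
    ((2 * Real.pi * x : ℝ) : ℂ) * Complex.I by push_cast; ring, Complex.exp_mul_I]
  push_cast
  ring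

theorem diagonal_fin_four (a b c d : ℂ) : Matrix.diagonal ![a, b, c, d] =
    !![a, 0, 0, 0; 0, b, 0, 0; 0, 0, c, 0; 0, 0, 0, d] := by
  ext i j
  fin_cases i <;> fin_cases j <;> rfl

theorem tensor_rotX_eq (x y : ℝ) :
    (tensor (rotX (2 * (Real.pi * (x + y)))) (rotX (2 * (Real.pi * (x - y)))) :
      Matrix (Fin 4) (Fin 4) ℂ) =
    hadamard * Matrix.diagonal ![phase (-x), phase (-y), phase y, phase x] * hadamard := by
  have h1 : phase x = phase ((x + y) / 2) * phase ((x - y) / 2) := by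
    rw [← phase_add]; congr 1; ring
  have h2 : phase y = phase ((x + y) / 2) * phase (-((x - y) / 2)) := by
    rw [← phase_add]; congr 1; ring
  have h3 : phase (-x) = phase (-((x + y) / 2)) * phase (-((x - y) / 2)) := by
    rw [← phase_add]; congr 1; ring
  have h4 : phase (-y) = phase (-((x + y) / 2)) * phase ((x - y) / 2) := by
    rw [← phase_add]; congr 1; ring
  have e1 : 2 * (Real.pi * (x + y)) / 2 = 2 * Real.pi * ((x + y) / 2) := by ring
  have e2 : 2 * (Real.pi * (x - y)) / 2 = 2 * Real.pi * ((x - y) / 2) := by ring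
  rw [h1, h2, h3, h4, tensor_val]
  simp only [rotX, e1, e2, phase_eq_cos_add_sin, mul_neg, Real.cos_neg, Real.sin_neg,
    Complex.ofReal_neg]
  generalize (Real.cos (2 * Real.pi * ((x + y) / 2)) : ℂ) = c
  generalize (Real.sin (2 * Real.pi * ((x + y) / 2)) : ℂ) = s
  generalize (Real.cos (2 * Real.pi * ((x - y) / 2)) : ℂ) = c'
  generalize (Real.sin (2 * Real.pi * ((x - y) / 2)) : ℂ) = s'
  rw [diagonal_fin_four, ← mul_one (!![_, _, _, _; _, _, _, _; _, _, _, _; _, _, _, _]),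
    ← hadamard_mul_self, ← mul_assoc]
  congr 1
  ext i j
  fin_cases i <;> fin_cases j <;> simp [hadamard] <;> ring

/-- Two uses of a gate doubling to `Z ⊗ Z`, with `X`-rotations in between, reach every conjugation
symmetric spectrum. -/
theorem DoublesToZZ.roots_cartanDouble_rotX {s : U 4} {ε : ℂ} (hs : DoublesToZZ s ε) {a : E4}
    (ha : IsConjSymm a) :
    (cartanDouble ((s : Matrix (Fin 4) (Fin 4) ℂ) *
      (tensor (rotX (Real.pi * (a 0 + a 1))) (rotX (Real.pi * (a 0 - a 1))) :
        Matrix (Fin 4) (Fin 4) ℂ) * (s : Matrix (Fin 4) (Fin 4) ℂ))).charpoly.roots =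
    (Finset.univ : Finset (Fin 4)).val.map fun j => phase (a j) := by
  have h := tensor_rotX_mul_zz (-(Real.pi * (a 0 + a 1))) (-(Real.pi * (a 0 - a 1)))
  rw [neg_neg, neg_neg] at h
  rw [hs.charpoly_cartanDouble_mul_tensor_mul (det_rotX _) (det_rotX _), rotX_inv, rotX_inv,
    mul_assoc, h,
    mul_assoc, ← mul_assoc zz, zz_mul_self, one_mul, ← Submonoid.coe_mul, tensor_mul, rotX_mul,
    rotX_mul, ← two_mul, ← two_mul, tensor_rotX_eq,
    charpoly_mul_mul_of_mul_eq_one hadamard_mul_self, Matrix.charpoly_diagonal]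
  have hr := Polynomial.roots_multiset_prod_X_sub_C ((Finset.univ : Finset (Fin 4)).val.map
    ![phase (-a 0), phase (-a 1), phase (a 1), phase (a 0)])
  rw [Multiset.map_map] at hr
  refine hr.trans ?_
  rw [← map_univ_comp_perm _ Fin.revPerm]
  congr 1
  ext j
  fin_cases j <;> simp [ha.1, ha.2]

/-! ### Depth two -/

theorem mem_P_two_iff {S g : PU 4} : g ∈ P {S} 2 ↔
    ∃ k ∈ localGates, ∃ l ∈ localGates, ∃ m ∈ localGates, g = k * S * l * S * m := by
  constructor
  · rintro ⟨_, ⟨k, hk, _, rfl, l, hl, rfl⟩, _, rfl, m, hm, rfl⟩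
    exact ⟨k, hk, l, hl, m, hm, rfl⟩
  · rintro ⟨k, hk, l, hl, m, hm, rfl⟩
    exact ⟨_, ⟨k, hk, S, rfl, l, hl, rfl⟩, S, rfl, m, hm, rfl⟩

theorem trace_eq_of_charpoly_eq {M N : Matrix (Fin 4) (Fin 4) ℂ} (h : M.charpoly = N.charpoly) :
    M.trace = N.trace := by
  rw [Matrix.trace_eq_sum_roots_charpoly, Matrix.trace_eq_sum_roots_charpoly, h]

/-- The trace of the product of two Hermitian matrices is real. -/
theorem im_trace_mul_eq_zero {M N : Matrix (Fin 4) (Fin 4) ℂ} (hM : star M = M)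
    (hN : star N = N) : (M * N).trace.im = 0 := by
  rw [← Complex.conj_eq_iff_im, ← RCLike.star_def, ← Matrix.trace_conjTranspose,
    ← Matrix.star_eq_conjTranspose, star_mul, hM, hN, Matrix.trace_mul_comm]

/-- A gate is reached by two uses of `s` and local gates if and only if its coordinate is symmetric
under conjugation. -/
theorem DoublesToZZ.mem_P_two_iff_isConjSymm {s : U 4} {ε : ℂ} (hs : DoublesToZZ s ε) {g : PU 4} :
    g ∈ P {toPU s} 2 ↔ IsConjSymm (coord g) := by
  have hdet : ∀ {A B : U 2}, (A : Matrix (Fin 2) (Fin 2) ℂ).det = 1 →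
      (B : Matrix (Fin 2) (Fin 2) ℂ).det = 1 →
      ((s * tensor A B * s : U 4) : Matrix (Fin 4) (Fin 4) ℂ).det = 1 := by
    intro A B hA hB
    rw [Submonoid.coe_mul, Submonoid.coe_mul, Matrix.det_mul, Matrix.det_mul, det_tensor hA hB,
      mul_one, hs.det_mul_self]
  rw [mem_P_two_iff]
  constructor
  · rintro ⟨k, hk, l, hl, m, hm, rfl⟩
    obtain ⟨A, B, rfl, hA, hB⟩ := exists_tensor_det_eq_one hk
    obtain ⟨C, D, rfl, hC, hD⟩ := exists_tensor_det_eq_one hl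
    obtain ⟨F, G, rfl, hF, hG⟩ := exists_tensor_det_eq_one hm
    have he : toPU (tensor A B) * toPU s * toPU (tensor C D) * toPU s * toPU (tensor F G) =
        toPU (tensor A B * (s * tensor C D * s) * tensor F G) := by
      simp only [map_mul, mul_assoc]
    have hd : ((tensor A B * (s * tensor C D * s) * tensor F G : U 4) :
        Matrix (Fin 4) (Fin 4) ℂ).det = 1 := by
      rw [Submonoid.coe_mul, Submonoid.coe_mul, Matrix.det_mul, Matrix.det_mul, det_tensor hA hB,
        det_tensor hF hG, hdet hC hD]
      norm_num
    rw [he, isConjSymm_coord_iff hd]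
    have h1 := charpoly_cartanDouble_local hA hB hF hG
      ((s : Matrix (Fin 4) (Fin 4) ℂ) * (tensor C D : Matrix (Fin 4) (Fin 4) ℂ) *
        (s : Matrix (Fin 4) (Fin 4) ℂ))
    rw [hs.charpoly_cartanDouble_mul_tensor_mul hC hD] at h1
    have h2 := trace_eq_of_charpoly_eq h1
    have h3 : star (tensor C D : Matrix (Fin 4) (Fin 4) ℂ) =
        (tensor C⁻¹ D⁻¹ : Matrix (Fin 4) (Fin 4) ℂ) := by
      rw [← tensor_inv]
      rfl
    change (cartanDouble ((tensor A B : Matrix (Fin 4) (Fin 4) ℂ) *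
      ((s : Matrix (Fin 4) (Fin 4) ℂ) * (tensor C D : Matrix (Fin 4) (Fin 4) ℂ) *
        (s : Matrix (Fin 4) (Fin 4) ℂ)) *
      (tensor F G : Matrix (Fin 4) (Fin 4) ℂ))).trace.im = 0
    rw [h2, ← h3]
    refine im_trace_mul_eq_zero ?_ star_zz
    rw [star_mul, star_mul, star_star, star_zz, mul_assoc]
  · intro ha
    obtain ⟨-, u, hu, hug, hl⟩ := isCoord_coord g
    obtain ⟨k, hk, m, hm, h⟩ := exists_local_of_roots_eq hu (hdet (det_rotX _) (det_rotX _)) hl.2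
      (hs.roots_cartanDouble_rotX ha)
    refine ⟨k, hk, toPU (tensor (rotX (Real.pi * (coord g 0 + coord g 1)))
      (rotX (Real.pi * (coord g 0 - coord g 1)))), ⟨_, _, rfl⟩, m, hm, ?_⟩
    refine (hug.symm.trans h).trans ?_
    simp only [map_mul, mul_assoc]

/-! ### Depth three -/

theorem tensor_rotX_one_conj_zz (t : ℝ) :
    (tensor (rotX t) 1 : Matrix (Fin 4) (Fin 4) ℂ) * zz *
      (tensor (rotX t)⁻¹ 1⁻¹ : Matrix (Fin 4) (Fin 4) ℂ) =
    (Real.cos t : ℂ) • zz + (Real.sin t : ℂ) •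
      !![0, 0, Complex.I, 0; 0, 0, 0, -Complex.I; -Complex.I, 0, 0, 0; 0, Complex.I, 0, 0] := by
  obtain ⟨h1, h2, h3⟩ := cos_sin_double_half t
  rw [rotX_inv, inv_one, tensor_val, tensor_val, h2, h3]
  simp only [rotX, neg_div, Real.cos_neg, Real.sin_neg, Complex.ofReal_neg, zz]
  generalize (Real.cos (t / 2) : ℂ) = c at h1 ⊢
  generalize (Real.sin (t / 2) : ℂ) = s at h1 ⊢
  have hI := Complex.I_mul_I
  ext i j
  fin_cases i <;> fin_cases j <;> simp <;> grind

/-- Every gate `g` is reached by three uses of `s` and local gates: removing the local gate `l⁻¹`, a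
rotation by `-t`, and then `s` from the end of the circuit leaves `g l s⁻¹`. The trace
of its Cartan double is a linear combination of `cos t` and `sin t`, so it is real for some `t`. -/
theorem DoublesToZZ.P_three {s : U 4} {ε : ℂ} (hs : DoublesToZZ s ε) :
    P {toPU s} 3 = Set.univ := by
  rw [Set.eq_univ_iff_forall]
  intro g
  obtain ⟨u, rfl, hu⟩ := exists_toPU_eq_det_eq_one g
  obtain ⟨v, c, hc, hv, hvd⟩ := exists_smul_det_eq_one (by norm_num) s⁻¹
  set M : Matrix (Fin 4) (Fin 4) ℂ :=
    !![0, 0, Complex.I, 0; 0, 0, 0, -Complex.I; -Complex.I, 0, 0, 0; 0, Complex.I, 0, 0]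
  set N : Matrix (Fin 4) (Fin 4) ℂ :=
    (c ^ 2 * ε) • (spinFlip (u : Matrix (Fin 4) (Fin 4) ℂ) * (u : Matrix (Fin 4) (Fin 4) ℂ))
  -- the angle for which the imaginary part of the trace vanishes
  obtain ⟨t, -, ht, -⟩ := exists_rotation_to_axis (-(N * M).trace.im) (N * zz).trace.im
  have hinv : (s : Matrix (Fin 4) (Fin 4) ℂ) * (s⁻¹ : U 4) = 1 := by
    rw [← Submonoid.coe_mul, mul_inv_cancel]; rfl
  have hsf : spinFlip ((s⁻¹ : U 4) : Matrix (Fin 4) (Fin 4) ℂ) *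
      spinFlip (s : Matrix (Fin 4) (Fin 4) ℂ) = 1 := by
    rw [← spinFlip_mul, hinv]
    simp [spinFlip, spinForm_mul_self]
  have hvv : (v : Matrix (Fin 4) (Fin 4) ℂ) * spinFlip (v : Matrix (Fin 4) (Fin 4) ℂ) =
      (c ^ 2 * ε) • zz := by
    have h1 : (spinFlip (s : Matrix (Fin 4) (Fin 4) ℂ) * (s : Matrix (Fin 4) (Fin 4) ℂ)) *
        (ε • zz) = 1 := by
      rw [hs.coDouble_eq, smul_mul_smul_comm, hs.sign, zz_mul_self, one_smul]
    have h2 : ((s⁻¹ : U 4) : Matrix (Fin 4) (Fin 4) ℂ) *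
        spinFlip ((s⁻¹ : U 4) : Matrix (Fin 4) (Fin 4) ℂ) *
        (spinFlip (s : Matrix (Fin 4) (Fin 4) ℂ) * (s : Matrix (Fin 4) (Fin 4) ℂ)) = 1 := by
      calc _ = ((s⁻¹ : U 4) : Matrix (Fin 4) (Fin 4) ℂ) *
            (spinFlip ((s⁻¹ : U 4) : Matrix (Fin 4) (Fin 4) ℂ) *
            spinFlip (s : Matrix (Fin 4) (Fin 4) ℂ)) * (s : Matrix (Fin 4) (Fin 4) ℂ) := by
            noncomm_ring
        _ = 1 := by rw [hsf, mul_one]; exact mul_eq_one_comm.mp hinv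
    rw [hv, spinFlip_smul, smul_mul_smul_comm, left_inv_eq_right_inv h2 h1, smul_smul, sq]
  have hd : ((u * tensor (rotX t) 1 * v : U 4) : Matrix (Fin 4) (Fin 4) ℂ).det = 1 := by
    rw [Submonoid.coe_mul, Submonoid.coe_mul, Matrix.det_mul, Matrix.det_mul, hu, hvd,
      det_tensor (det_rotX t) (by simp)]
    norm_num
  have htr : (cartanDouble ((u * tensor (rotX t) 1 * v : U 4) :
      Matrix (Fin 4) (Fin 4) ℂ)).trace = (N * ((tensor (rotX t) 1 : Matrix (Fin 4) (Fin 4) ℂ) * zz *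
      (tensor (rotX t)⁻¹ 1⁻¹ : Matrix (Fin 4) (Fin 4) ℂ))).trace := by
    rw [trace_cartanDouble, Submonoid.coe_mul, Submonoid.coe_mul, spinFlip_mul, spinFlip_mul,
      spinFlip_tensor (det_rotX t) (by simp)]
    calc _ = ((u : Matrix (Fin 4) (Fin 4) ℂ) * ((tensor (rotX t) 1 : Matrix (Fin 4) (Fin 4) ℂ) *
          ((v : Matrix (Fin 4) (Fin 4) ℂ) * spinFlip (v : Matrix (Fin 4) (Fin 4) ℂ)) *
          (tensor (rotX t)⁻¹ 1⁻¹ : Matrix (Fin 4) (Fin 4) ℂ) *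
          spinFlip (u : Matrix (Fin 4) (Fin 4) ℂ))).trace := by
          congr 1; noncomm_ring
      _ = _ := by
        rw [hvv, Matrix.trace_mul_comm, Matrix.mul_assoc, Matrix.trace_mul_comm]
        simp only [N, mul_smul_comm, smul_mul_assoc]
  have hP : toPU (u * tensor (rotX t) 1 * v) ∈ P {toPU s} 2 := by
    rw [hs.mem_P_two_iff_isConjSymm, isConjSymm_coord_iff hd, htr, tensor_rotX_one_conj_zz, mul_add,
      mul_smul_comm, mul_smul_comm, Matrix.trace_add, Matrix.trace_smul, Matrix.trace_smul,
      smul_eq_mul, smul_eq_mul, Complex.add_im, Complex.im_ofReal_mul, Complex.im_ofReal_mul]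
    linarith
  refine ⟨_, hP, toPU s, rfl, toPU (tensor (rotX t)⁻¹ 1⁻¹), ⟨_, _, rfl⟩, ?_⟩
  rw [← tensor_inv, map_inv, map_mul, map_mul, ← toPU_eq_of_eq_smul hv, map_inv]
  group

/-! ### Circuits for the vertices -/

theorem coord_toPU_eq {u : U 4} (hu : (u : Matrix (Fin 4) (Fin 4) ℂ).det = 1) {a : E4}
    (ha : a ∈ alcoveC2)
    (h : (cartanDouble (u : Matrix (Fin 4) (Fin 4) ℂ)).charpoly.roots =
      (Finset.univ : Finset (Fin 4)).val.map fun j => phase (a j)) :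
    coord (toPU u) = a :=
  IsCoord.coord_eq ⟨ha, u, hu, rfl, ha.1, h⟩

theorem e₁_mem : e₁ ∈ alcoveC2 := by
  simp only [alcoveC2, alcove, e₁, Set.mem_ofPred_eq, Fin.sum_univ_four]
  simp

theorem e₂_mem : e₂ ∈ alcoveC2 := by
  simp only [alcoveC2, alcove, e₂, Set.mem_ofPred_eq, Fin.sum_univ_four]
  simp
  norm_num

theorem e₃_mem : e₃ ∈ alcoveC2 := by
  simp only [alcoveC2, alcove, e₃, Set.mem_ofPred_eq, Fin.sum_univ_four]
  simp
  norm_num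

theorem e₄_mem : e₄ ∈ alcoveC2 := by
  simp only [alcoveC2, alcove, e₄, Set.mem_ofPred_eq, Fin.sum_univ_four]
  simp
  norm_num

theorem det_iswapU : (iswapU : Matrix (Fin 4) (Fin 4) ℂ).det = 1 := by
  simp [iswapU, Matrix.det_succ_row_zero, Fin.sum_univ_succ, Fin.succAbove]

theorem phase_quarter : phase (1 / 4) = Complex.I := by
  rw [phase, show 2 * (Real.pi : ℂ) * Complex.I * ((1 / 4 : ℝ) : ℂ) = Real.pi / 2 * Complex.I by
    push_cast; ring, Complex.exp_pi_div_two_mul_I]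

theorem phase_neg_quarter : phase (-(1 / 4)) = -Complex.I := by
  rw [← star_phase, phase_quarter, Complex.conj_I]

theorem phase_neg_three_quarters : phase (-(3 / 4)) = Complex.I := by
  rw [← phase_quarter, ← phase_sub_one (1 / 4)]
  norm_num

/-- The coordinate of two uses of `iSWAP` with `X`-rotations in between. The angles give a
conjugation symmetric spectrum `a`, and `b` is its rearrangement in the alcove. -/
theorem coord_iswap_rotX_iswap {α β : ℝ} {a : E4} (ha : IsConjSymm a)
    (hα : Real.pi * (a 0 + a 1) = α) (hβ : Real.pi * (a 0 - a 1) = β) {b : E4}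
    (hb : b ∈ alcoveC2) (σ : Equiv.Perm (Fin 4)) (hab : ∀ j, a j = b (σ j)) :
    coord (ISWAP * toPU (tensor (rotX α) (rotX β)) * ISWAP) = b := by
  rw [ISWAP, ← map_mul, ← map_mul]
  refine coord_toPU_eq ?_ hb ?_
  · rw [Submonoid.coe_mul, Submonoid.coe_mul, Matrix.det_mul, Matrix.det_mul,
      det_tensor (det_rotX _) (det_rotX _), det_iswapU]
    norm_num
  · rw [Submonoid.coe_mul, Submonoid.coe_mul, ← hα, ← hβ,
      doublesToZZ_iswapU.roots_cartanDouble_rotX ha, ← map_univ_comp_perm (fun j => phase (b j)) σ]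
    congr 1
    ext j
    rw [hab, Function.comp_apply]

theorem coord_iswap_mul_iswap : coord (ISWAP * ISWAP) = e₁ := by
  have h := coord_iswap_rotX_iswap (α := 0) (β := 0) (a := e₁) (by simp [IsConjSymm, e₁])
    (by simp [e₁]) (by simp [e₁]) e₁_mem 1 (fun _ => rfl)
  rwa [rotX_zero, tensor_one, map_one, mul_one] at h

theorem coord_iswap_one_rotX_iswap :
    coord (ISWAP * toPU (tensor 1 (rotX (Real.pi / 2))) * ISWAP) = e₂ := by
  have h := coord_iswap_rotX_iswap (α := 0) (β := Real.pi / 2)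
    (a := !₂[1 / 4, -1 / 4, 1 / 4, -1 / 4]) (by simp [IsConjSymm]; norm_num)
    (by simp; norm_num)
    (by simp; ring) e₂_mem (Equiv.swap 1 2) (fun j => by
      fin_cases j <;> simp [e₂, Equiv.swap_apply_def])
  rwa [rotX_zero] at h

theorem coord_iswap_rotX_rotX_iswap :
    coord (ISWAP * toPU (tensor (rotX (Real.pi / 2)) (rotX (Real.pi / 2))) * ISWAP) = e₃ :=
  coord_iswap_rotX_iswap (a := e₃) (by simp [IsConjSymm, e₃]; norm_num) (by simp [e₃]; ring)
    (by simp [e₃]; ring) e₃_mem 1 (fun _ => rfl)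

theorem cartanDouble_mul_self (u : Matrix (Fin 4) (Fin 4) ℂ) :
    cartanDouble u * cartanDouble u =
      Q.conjTranspose * ((u * spinFlip u) * (u * spinFlip u)) * Q := by
  rw [cartanDouble_eq]
  calc _ = Q.conjTranspose * (u * spinFlip u) * (Q * Q.conjTranspose) * (u * spinFlip u) * Q := by
        noncomm_ring
    _ = _ := by rw [Q_mul_conjTranspose]; noncomm_ring

theorem map_univ_fin_four {α : Type*} (f : Fin 4 → α) :
    (Finset.univ : Finset (Fin 4)).val.map f = {f 0, f 1, f 2, f 3} := rfl

/-- A Cartan double with vanishing trace whose square is the scalar `c ^ 2` has the eigenvalues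
`c, c, -c, -c`. -/
theorem roots_cartanDouble_of_sq {u : U 4} (hu : (u : Matrix (Fin 4) (Fin 4) ℂ).det = 1) {c : ℂ}
    (hc : c ≠ 0) {G : Matrix (Fin 4) (Fin 4) ℂ}
    (hG : (u : Matrix (Fin 4) (Fin 4) ℂ) * spinFlip (u : Matrix (Fin 4) (Fin 4) ℂ) = G)
    (hsq : G * G = (c ^ 2) • 1) (htr : G.trace = 0) :
    (cartanDouble (u : Matrix (Fin 4) (Fin 4) ℂ)).charpoly.roots = {c, c, -c, -c} := by
  obtain ⟨d, -, -, hd⟩ := exists_roots_cartanDouble hu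
  obtain ⟨O, hO, -, hM⟩ := exists_rotation_diagonalization (cartanDouble_mem_unitaryGroup u)
    (cartanDouble_transpose _) hd
  have h1 : cartanDouble (u : Matrix (Fin 4) (Fin 4) ℂ) *
      cartanDouble (u : Matrix (Fin 4) (Fin 4) ℂ) = (c ^ 2) • 1 := by
    rw [cartanDouble_mul_self, hG, hsq, mul_smul_comm, smul_mul_assoc, mul_one,
      conjTranspose_Q_mul]
  have hOc : (O.map Complex.ofReal).transpose * O.map Complex.ofReal = 1 := by
    rw [← Matrix.transpose_map, ← map_ofReal_mul, hO, map_ofReal_one]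
  have h2 : Matrix.diagonal d * Matrix.diagonal d = (c ^ 2) • 1 := by
    calc _ = (O.map Complex.ofReal).transpose * ((O.map Complex.ofReal * Matrix.diagonal d *
          (O.map Complex.ofReal).transpose) * (O.map Complex.ofReal * Matrix.diagonal d *
          (O.map Complex.ofReal).transpose)) * O.map Complex.ofReal := by
          have : ∀ A B D : Matrix (Fin 4) (Fin 4) ℂ, A * B = 1 →
              A * ((B * D * A) * (B * D * A)) * B = D * D := by
            intro A B D h
            calc _ = (A * B) * D * (A * B) * D * (A * B) := by noncomm_ring
              _ = _ := by rw [h, one_mul, mul_one, mul_one]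
          exact (this _ _ _ hOc).symm
      _ = _ := by rw [← hM, h1, mul_smul_comm, smul_mul_assoc, mul_one, hOc]
  have h3 : ∀ j, d j = c ∨ d j = -c := by
    intro j
    have h := congrFun (congrFun h2 j) j
    rw [Matrix.diagonal_mul_diagonal, Matrix.diagonal_apply_eq, Matrix.smul_apply,
      Matrix.one_apply_eq, smul_eq_mul, mul_one, sq] at h
    exact mul_self_eq_mul_self_iff.mp h
  have h4 := trace_eq_sum_of_roots hd
  rw [trace_cartanDouble, hG, htr, Fin.sum_univ_four] at h4
  rw [hd, map_univ_fin_four]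
  -- an unbalanced choice of signs would give a nonzero trace `m * c`
  have h5 : ∀ m : ℂ, m ≠ 0 → 0 = m * c → False := fun m hm h => mul_ne_zero hm hc h.symm
  rcases h3 0 with h0 | h0 <;> rcases h3 1 with h1 | h1 <;> rcases h3 2 with h2 | h2 <;>
    rcases h3 3 with h3 | h3 <;> simp only [h0, h1, h2, h3] at h4 ⊢ <;>
    first
    | exact (h5 2 (by norm_num) (by linear_combination h4)).elim
    | exact (h5 (-2) (by norm_num) (by linear_combination h4)).elim
    | exact (h5 4 (by norm_num) (by linear_combination h4)).elim
    | exact (h5 (-4) (by norm_num) (by linear_combination h4)).elim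
    | (simp only [Multiset.insert_eq_cons, ← Multiset.singleton_add]; abel)

theorem roots_cartanDouble_of_scalar {u : U 4} {c : ℂ}
    (hG : (u : Matrix (Fin 4) (Fin 4) ℂ) * spinFlip (u : Matrix (Fin 4) (Fin 4) ℂ) = c • 1) :
    (cartanDouble (u : Matrix (Fin 4) (Fin 4) ℂ)).charpoly.roots =
      (Finset.univ : Finset (Fin 4)).val.map fun _ => c := by
  have h : (c • 1 : Matrix (Fin 4) (Fin 4) ℂ) = Matrix.diagonal fun _ => c := by
    rw [← Matrix.diagonal_one, ← Matrix.diagonal_smul]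
    congr 1
    ext
    simp
  rw [charpoly_cartanDouble, hG, h, Matrix.charpoly_diagonal]
  have := Polynomial.roots_multiset_prod_X_sub_C
    ((Finset.univ : Finset (Fin 4)).val.map fun _ => c)
  rwa [Multiset.map_map] at this

theorem rotX_pi_div_two : (rotX (Real.pi / 2) : Matrix (Fin 2) (Fin 2) ℂ) =
    ((1 / Real.sqrt 2 : ℝ) : ℂ) • !![1, -Complex.I; -Complex.I, 1] := by
  have h : Real.pi / 2 / 2 = Real.pi / 4 := by ring
  simp only [rotX, h, Real.cos_pi_div_four, Real.sin_pi_div_four, Real.sqrt_div_self']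
  ext i j
  fin_cases i <;> fin_cases j <;> simp [mul_comm]

theorem rotX_neg_pi_div_two : (rotX (-(Real.pi / 2)) : Matrix (Fin 2) (Fin 2) ℂ) =
    ((1 / Real.sqrt 2 : ℝ) : ℂ) • !![1, Complex.I; Complex.I, 1] := by
  have h : -(Real.pi / 2) / 2 = -(Real.pi / 4) := by ring
  simp only [rotX, h, Real.cos_neg, Real.sin_neg, Real.cos_pi_div_four, Real.sin_pi_div_four,
    Real.sqrt_div_self']
  ext i j
  fin_cases i <;> fin_cases j <;> simp [mul_comm]

theorem rotY_pi_div_two : (rotY (Real.pi / 2) : Matrix (Fin 2) (Fin 2) ℂ) =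
    ((1 / Real.sqrt 2 : ℝ) : ℂ) • !![1, -1; 1, 1] := by
  have h : Real.pi / 2 / 2 = Real.pi / 4 := by ring
  simp only [rotY, h, Real.cos_pi_div_four, Real.sin_pi_div_four, Real.sqrt_div_self']
  ext i j
  fin_cases i <;> fin_cases j <;> simp

/-- The gate of a circuit with three uses of `iSWAP` and the local gates `A ⊗ B` and `C ⊗ D` between
them. -/
def circuitThree (A B C D : U 2) : U 4 :=
  iswapU * tensor A B * iswapU * tensor C D * iswapU

theorem toPU_circuitThree (A B C D : U 2) : toPU (circuitThree A B C D) =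
    ISWAP * toPU (tensor A B) * ISWAP * toPU (tensor C D) * ISWAP := by
  simp only [circuitThree, map_mul, ISWAP]

theorem circuitThree_val (A B C D : U 2) :
    (circuitThree A B C D : Matrix (Fin 4) (Fin 4) ℂ) =
      iswapU * (tensor A B : Matrix (Fin 4) (Fin 4) ℂ) * iswapU *
        (tensor C D : Matrix (Fin 4) (Fin 4) ℂ) * iswapU := rfl

theorem det_circuitThree {A B C D : U 2}
    (hA : (A : Matrix (Fin 2) (Fin 2) ℂ).det = 1) (hB : (B : Matrix (Fin 2) (Fin 2) ℂ).det = 1)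
    (hC : (C : Matrix (Fin 2) (Fin 2) ℂ).det = 1) (hD : (D : Matrix (Fin 2) (Fin 2) ℂ).det = 1) :
    (circuitThree A B C D : Matrix (Fin 4) (Fin 4) ℂ).det = 1 := by
  simp only [circuitThree_val, Matrix.det_mul, det_iswapU, det_tensor hA hB, det_tensor hC hD,
    one_mul]

theorem tensor_rotX_rotX : (tensor (rotX (Real.pi / 2)) (rotX (Real.pi / 2)) :
    Matrix (Fin 4) (Fin 4) ℂ) = (1 / 2 : ℂ) • !![1, -Complex.I, -Complex.I, -1;
      -Complex.I, 1, -1, -Complex.I; -Complex.I, -1, 1, -Complex.I;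
      -1, -Complex.I, -Complex.I, 1] := by
  rw [tensor_val, rotX_pi_div_two, ← inv_sqrt_two_mul_self]
  generalize ((1 / Real.sqrt 2 : ℝ) : ℂ) = r
  have hI := Complex.I_mul_I
  ext i j
  fin_cases i <;> fin_cases j <;> simp <;> grind

theorem tensor_rotY_rotY : (tensor (rotY (Real.pi / 2)) (rotY (Real.pi / 2)) :
    Matrix (Fin 4) (Fin 4) ℂ) = (1 / 2 : ℂ) • !![1, -1, -1, 1; 1, 1, -1, -1; 1, -1, 1, -1;
      1, 1, 1, 1] := by
  rw [tensor_val, rotY_pi_div_two, ← inv_sqrt_two_mul_self]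
  generalize ((1 / Real.sqrt 2 : ℝ) : ℂ) = r
  ext i j
  fin_cases i <;> fin_cases j <;> simp

theorem tensor_rotX_rotY : (tensor (rotX (Real.pi / 2)) (rotY (Real.pi / 2)) :
    Matrix (Fin 4) (Fin 4) ℂ) = (1 / 2 : ℂ) • !![1, -1, -Complex.I, Complex.I;
      1, 1, -Complex.I, -Complex.I; -Complex.I, Complex.I, 1, -1;
      -Complex.I, -Complex.I, 1, 1] := by
  rw [tensor_val, rotX_pi_div_two, rotY_pi_div_two, ← inv_sqrt_two_mul_self]
  generalize ((1 / Real.sqrt 2 : ℝ) : ℂ) = r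
  ext i j
  fin_cases i <;> fin_cases j <;> simp <;> ring

theorem tensor_one_rotX : (tensor 1 (rotX (Real.pi / 2)) :
    Matrix (Fin 4) (Fin 4) ℂ) = ((1 / Real.sqrt 2 : ℝ) : ℂ) • !![1, -Complex.I, 0, 0;
      -Complex.I, 1, 0, 0; 0, 0, 1, -Complex.I; 0, 0, -Complex.I, 1] := by
  rw [tensor_val, rotX_pi_div_two]
  ext i j
  fin_cases i <;> fin_cases j <;> simp

theorem tensor_rotX_neg_one : (tensor (rotX (-(Real.pi / 2))) 1 :
    Matrix (Fin 4) (Fin 4) ℂ) = ((1 / Real.sqrt 2 : ℝ) : ℂ) • !![1, 0, Complex.I, 0;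
      0, 1, 0, Complex.I; Complex.I, 0, 1, 0; 0, Complex.I, 0, 1] := by
  rw [tensor_val, rotX_neg_pi_div_two]
  ext i j
  fin_cases i <;> fin_cases j <;> simp

theorem circuitThree_XXYY : (circuitThree (rotX (Real.pi / 2)) (rotX (Real.pi / 2))
    (rotY (Real.pi / 2)) (rotY (Real.pi / 2)) : Matrix (Fin 4) (Fin 4) ℂ) =
    (1 / 2 : ℂ) • !![1, -Complex.I, -Complex.I, -1; 1, Complex.I, -Complex.I, 1;
      1, -Complex.I, Complex.I, 1; 1, Complex.I, Complex.I, -1] := by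
  rw [circuitThree_val, tensor_rotX_rotX, tensor_rotY_rotY]
  simp only [iswapU, mul_smul_comm, smul_mul_assoc, smul_smul]
  have hI := Complex.I_mul_I
  ext i j
  fin_cases i <;> fin_cases j <;> simp <;> grind

theorem circuitThree_XXXY : (circuitThree (rotX (Real.pi / 2)) (rotX (Real.pi / 2))
    (rotX (Real.pi / 2)) (rotY (Real.pi / 2)) : Matrix (Fin 4) (Fin 4) ℂ) =
    (1 / 2 : ℂ) • !![1, 1, -1, -1; -Complex.I, Complex.I, -Complex.I, Complex.I;
      1, 1, 1, 1; -Complex.I, Complex.I, Complex.I, -Complex.I] := by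
  rw [circuitThree_val, tensor_rotX_rotX, tensor_rotX_rotY]
  simp only [iswapU, mul_smul_comm, smul_mul_assoc, smul_smul]
  have hI := Complex.I_mul_I
  ext i j
  fin_cases i <;> fin_cases j <;> simp <;> grind

theorem circuitThree_XXXX : (circuitThree (rotX (Real.pi / 2)) (rotX (Real.pi / 2))
    (rotX (Real.pi / 2)) (rotX (Real.pi / 2)) : Matrix (Fin 4) (Fin 4) ℂ) =
    (1 / 2 : ℂ) • !![1 - Complex.I, 0, 0, -1 - Complex.I; 0, 1 + Complex.I, 1 - Complex.I, 0;
      0, 1 - Complex.I, 1 + Complex.I, 0; -1 - Complex.I, 0, 0, 1 - Complex.I] := by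
  rw [circuitThree_val, tensor_rotX_rotX]
  simp only [iswapU, mul_smul_comm, smul_mul_assoc, smul_smul]
  have hI := Complex.I_mul_I
  ext i j
  fin_cases i <;> fin_cases j <;> simp <;> grind

theorem circuitThree_IXXI : (circuitThree 1 (rotX (Real.pi / 2))
    (rotX (-(Real.pi / 2))) 1 : Matrix (Fin 4) (Fin 4) ℂ) =
    (1 / 2 : ℂ) • !![1 + Complex.I, -1 + Complex.I, 0, 0; 0, 0, -1 - Complex.I, 1 - Complex.I;
      1 - Complex.I, -1 - Complex.I, 0, 0; 0, 0, -1 + Complex.I, 1 + Complex.I] := by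
  rw [circuitThree_val, tensor_one_rotX, tensor_rotX_neg_one]
  simp only [iswapU, mul_smul_comm, smul_mul_assoc, smul_smul, inv_sqrt_two_mul_self]
  have hI := Complex.I_mul_I
  ext i j
  fin_cases i <;> fin_cases j <;> simp <;> grind

theorem coord_circuitThree_XXYY : coord (toPU (circuitThree (rotX (Real.pi / 2))
    (rotX (Real.pi / 2)) (rotY (Real.pi / 2)) (rotY (Real.pi / 2)))) = e₁ := by
  have hd := det_circuitThree (det_rotX (Real.pi / 2)) (det_rotX (Real.pi / 2))
    (det_rotY (Real.pi / 2)) (det_rotY (Real.pi / 2))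
  have hG : (circuitThree (rotX (Real.pi / 2)) (rotX (Real.pi / 2))
      (rotY (Real.pi / 2)) (rotY (Real.pi / 2)) : Matrix (Fin 4) (Fin 4) ℂ) *
      spinFlip (circuitThree (rotX (Real.pi / 2)) (rotX (Real.pi / 2))
      (rotY (Real.pi / 2)) (rotY (Real.pi / 2)) : U 4) = (-1 : ℂ) • 1 := by
    rw [circuitThree_XXYY, spinFlip_smul, spinFlip_eq, smul_mul_smul_comm]
    ext i j
    fin_cases i <;> fin_cases j <;> simp <;> norm_num
  have hr := roots_cartanDouble_smul (roots_cartanDouble_of_scalar hG) Complex.I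
  rw [toPU_eq_of_eq_smul (v := ⟨_, smul_mem_unitaryGroup Complex.norm_I _⟩) rfl]
  refine coord_toPU_eq ?_ e₁_mem (hr.trans ?_)
  · rw [Matrix.det_smul, hd, Fintype.card_fin, Complex.I_pow_four, one_mul]
  · congr 1
    ext j
    fin_cases j <;> simp [e₁, phase_zero]

theorem coord_circuitThree_XXXY : coord (toPU (circuitThree (rotX (Real.pi / 2))
    (rotX (Real.pi / 2)) (rotX (Real.pi / 2)) (rotY (Real.pi / 2)))) = e₂ := by
  have hd := det_circuitThree (det_rotX (Real.pi / 2)) (det_rotX (Real.pi / 2))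
    (det_rotX (Real.pi / 2)) (det_rotY (Real.pi / 2))
  have hG : (circuitThree (rotX (Real.pi / 2)) (rotX (Real.pi / 2))
      (rotX (Real.pi / 2)) (rotY (Real.pi / 2)) : Matrix (Fin 4) (Fin 4) ℂ) *
      spinFlip (circuitThree (rotX (Real.pi / 2)) (rotX (Real.pi / 2))
      (rotX (Real.pi / 2)) (rotY (Real.pi / 2)) : U 4) =
      !![0, 0, -Complex.I, 0; 0, 0, 0, Complex.I; -Complex.I, 0, 0, 0; 0, Complex.I, 0, 0] := by
    rw [circuitThree_XXXY, spinFlip_smul, spinFlip_eq, smul_mul_smul_comm]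
    have hI := Complex.I_mul_I
    ext i j
    fin_cases i <;> fin_cases j <;> simp <;> grind
  refine coord_toPU_eq hd e₂_mem ?_
  rw [roots_cartanDouble_of_sq hd Complex.I_ne_zero hG, map_univ_fin_four]
  · simp only [e₂]
    simp [-one_div, phase_quarter, neg_div, phase_neg_quarter]
  · ext i j
    fin_cases i <;> fin_cases j <;> simp
  · simp [Matrix.trace, Fin.sum_univ_four]

theorem coord_circuitThree_XXXX : coord (toPU (circuitThree (rotX (Real.pi / 2))
    (rotX (Real.pi / 2)) (rotX (Real.pi / 2)) (rotX (Real.pi / 2)))) = e₃ := by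
  have hd := det_circuitThree (det_rotX (Real.pi / 2)) (det_rotX (Real.pi / 2))
    (det_rotX (Real.pi / 2)) (det_rotX (Real.pi / 2))
  have hG : (circuitThree (rotX (Real.pi / 2)) (rotX (Real.pi / 2))
      (rotX (Real.pi / 2)) (rotX (Real.pi / 2)) : Matrix (Fin 4) (Fin 4) ℂ) *
      spinFlip (circuitThree (rotX (Real.pi / 2)) (rotX (Real.pi / 2))
      (rotX (Real.pi / 2)) (rotX (Real.pi / 2)) : U 4) =
      !![0, 0, 0, -1; 0, 0, 1, 0; 0, 1, 0, 0; -1, 0, 0, 0] := by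
    rw [circuitThree_XXXX, spinFlip_smul, spinFlip_eq, smul_mul_smul_comm]
    have hI := Complex.I_mul_I
    ext i j
    fin_cases i <;> fin_cases j <;> simp <;> grind
  refine coord_toPU_eq hd e₃_mem ?_
  rw [roots_cartanDouble_of_sq hd one_ne_zero hG, map_univ_fin_four]
  · simp only [e₃]
    simp only [Matrix.cons_val, phase_half, phase_zero, neg_div, phase_neg_half,
      Multiset.insert_eq_cons, ← Multiset.singleton_add]
    abel
  · ext i j
    fin_cases i <;> fin_cases j <;> simp
  · simp [Matrix.trace, Fin.sum_univ_four]

theorem coord_circuitThree_IXXI : coord (toPU (circuitThree 1 (rotX (Real.pi / 2))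
    (rotX (-(Real.pi / 2))) 1)) = e₄ := by
  have hd := det_circuitThree (A := 1) (D := 1) (by simp) (det_rotX (Real.pi / 2))
    (det_rotX (-(Real.pi / 2))) (by simp)
  have hG : (circuitThree 1 (rotX (Real.pi / 2))
      (rotX (-(Real.pi / 2))) 1 : Matrix (Fin 4) (Fin 4) ℂ) *
      spinFlip (circuitThree 1 (rotX (Real.pi / 2)) (rotX (-(Real.pi / 2))) 1 : U 4) =
      Complex.I • 1 := by
    rw [circuitThree_IXXI, spinFlip_smul, spinFlip_eq, smul_mul_smul_comm]
    have hI := Complex.I_mul_I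
    ext i j
    fin_cases i <;> fin_cases j <;> simp <;> grind
  refine coord_toPU_eq hd e₄_mem ((roots_cartanDouble_of_scalar hG).trans ?_)
  congr 1
  ext j
  fin_cases j <;> simp [e₄, -one_div, phase_quarter, neg_div, phase_neg_three_quarters]

/-! ### The triangle of coordinates of depth two -/

/-- The points of `alcoveC2` that are symmetric under complex conjugation of the eigenvalues. -/
def triangle : Set E4 := {δ | δ ∈ alcoveC2 ∧ δ 0 = -δ 3 ∧ δ 1 = -δ 2}

/-- The triangle in terms of its two free coordinates. -/
theorem mem_triangle_iff (δ : E4) : δ ∈ triangle ↔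
    δ 1 ≤ δ 0 ∧ 0 ≤ δ 1 ∧ δ 0 + δ 1 ≤ 1 / 2 ∧ δ 2 = -δ 1 ∧ δ 3 = -δ 0 := by
  constructor
  · rintro ⟨⟨⟨h1, h2, h3, h4, h5⟩, h6⟩, h7, h8⟩
    refine ⟨h1, by linarith, ?_, by linarith, by linarith⟩
    rcases h6 with h6 | ⟨h6, -⟩ <;> linarith
  · rintro ⟨h1, h2, h3, h4, h5⟩
    refine ⟨⟨⟨h1, by linarith, by linarith, by linarith, ?_⟩, ?_⟩, by linarith, by linarith⟩
    · rw [Fin.sum_univ_four]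
      linarith
    · rcases h3.lt_or_eq with h | h
      · left
        linarith
      · right
        constructor <;> linarith

theorem e₁_mem_triangle : e₁ ∈ triangle := by
  rw [mem_triangle_iff]; simp [e₁]

theorem e₂_mem_triangle : e₂ ∈ triangle := by
  rw [mem_triangle_iff]; simp [e₂]; norm_num

theorem e₃_mem_triangle : e₃ ∈ triangle := by
  rw [mem_triangle_iff]; simp [e₃]; norm_num

theorem convex_triangle : Convex ℝ triangle := by
  intro x hx y hy a b ha hb hab
  rw [mem_triangle_iff] at hx hy ⊢
  obtain ⟨h1, h2, h3, h4, h5⟩ := hx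
  obtain ⟨k1, k2, k3, k4, k5⟩ := hy
  simp only [PiLp.add_apply, PiLp.smul_apply, smul_eq_mul]
  refine ⟨by gcongr, by positivity, ?_, by rw [h4, k4]; ring, by rw [h5, k5]; ring⟩
  calc a * x 0 + b * y 0 + (a * x 1 + b * y 1) = a * (x 0 + x 1) + b * (y 0 + y 1) := by ring
    _ ≤ a * (1 / 2) + b * (1 / 2) := by gcongr
    _ = 1 / 2 := by rw [← add_mul, hab, one_mul]

theorem triangle_eq_convexHull : triangle = convexHull ℝ {e₁, e₂, e₃} := by
  apply Set.Subset.antisymm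
  · intro δ hδ
    obtain ⟨h1, h2, h3, h4, h5⟩ := (mem_triangle_iff δ).mp hδ
    -- the barycentric coordinates of `δ`
    have key := (convex_convexHull ℝ ({e₁, e₂, e₃} : Set E4)).sum_mem (t := Finset.univ)
      (w := ![1 - 2 * δ 0 - 2 * δ 1, 4 * δ 1, 2 * δ 0 - 2 * δ 1]) (z := ![e₁, e₂, e₃])
      (by intro i _; fin_cases i <;> simp <;> linarith)
      (by simp [Fin.sum_univ_three]; ring)
      (by intro i _; apply subset_convexHull; fin_cases i <;> simp)
    convert key
    ext i
    fin_cases i <;> simp [Fin.sum_univ_three, e₁, e₂, e₃] <;> linarith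
  · refine convexHull_min ?_ convex_triangle
    rintro x (rfl | rfl | rfl)
    exacts [e₁_mem_triangle, e₂_mem_triangle, e₃_mem_triangle]

theorem extremePoints_triangle : Set.extremePoints ℝ triangle = {e₁, e₂, e₃} := by
  apply Set.Subset.antisymm
  · rw [triangle_eq_convexHull]
    exact extremePoints_convexHull_subset
  · -- each vertex is exposed by a linear functional
    rintro x (rfl | rfl | rfl) <;> apply exposedPoints_subset_extremePoints
    · refine ⟨e₁_mem_triangle, -EuclideanSpace.proj 0, fun y hy => ?_⟩
      rw [mem_triangle_iff] at hy
      obtain ⟨h1, h2, h3, h4, h5⟩ := hy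
      simp only [neg_apply, PiLp.proj_apply]
      refine ⟨by simp [e₁]; linarith, fun h => ?_⟩
      simp [e₁] at h
      ext i
      fin_cases i <;> simp [e₁] <;> linarith
    · refine ⟨e₂_mem_triangle,
        EuclideanSpace.proj 0 + (2 : ℝ) • EuclideanSpace.proj 1, fun y hy => ?_⟩
      rw [mem_triangle_iff] at hy
      obtain ⟨h1, h2, h3, h4, h5⟩ := hy
      simp only [add_apply, smul_apply, PiLp.proj_apply, smul_eq_mul]
      refine ⟨by simp [e₂]; linarith, fun h => ?_⟩
      simp [e₂] at h
      ext i
      fin_cases i <;> simp [e₂] <;> linarith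
    · refine ⟨e₃_mem_triangle, EuclideanSpace.proj 0, fun y hy => ?_⟩
      rw [mem_triangle_iff] at hy
      obtain ⟨h1, h2, h3, h4, h5⟩ := hy
      simp only [PiLp.proj_apply]
      refine ⟨by simp [e₃]; linarith, fun h => ?_⟩
      simp [e₃] at h
      ext i
      fin_cases i <;> simp [e₃] <;> linarith

theorem P_iswap_two : P {ISWAP} 2 = {g | coord g 0 = -coord g 3 ∧ coord g 1 = -coord g 2} :=
  Set.ext fun _ => doublesToZZ_iswapU.mem_P_two_iff_isConjSymm

theorem P_cz_two : P {CZ} 2 = {g | coord g 0 = -coord g 3 ∧ coord g 1 = -coord g 2} :=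
  Set.ext fun _ => doublesToZZ_czU.mem_P_two_iff_isConjSymm

theorem image_coord_P_iswap_two : coord '' P {ISWAP} 2 = triangle := by
  rw [P_iswap_two]
  ext δ
  constructor
  · rintro ⟨g, hg, rfl⟩
    exact ⟨(isCoord_coord g).1, hg⟩
  · rintro ⟨hδ, h⟩
    obtain ⟨g, rfl⟩ := exists_coord_eq hδ
    exact ⟨g, h, rfl⟩

/-! ### Circuits of bounded depth are closed -/

instance (n : ℕ) : T2Space (PU n) := by
  have : IsClosed (Subgroup.center (U n) : Set (U n)) := by
    have h := Set.isClosed_centralizer (Set.univ : Set (U n))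
    rwa [Set.centralizer_univ] at h
  exact inferInstanceAs (T2Space (U n ⧸ Subgroup.center (U n)))

theorem continuous_toPU (n : ℕ) : Continuous (toPU : U n → PU n) :=
  QuotientGroup.continuous_mk

theorem continuous_tensor : Continuous fun p : U 2 × U 2 => tensor p.1 p.2 := by
  refine Continuous.subtype_mk (continuous_matrix fun i j => ?_) _
  simp only [Matrix.reindex_apply, Matrix.submatrix_apply, Matrix.kroneckerMap_apply]
  exact ((continuous_subtype_val.comp continuous_fst).matrix_elem _ _).mul
    ((continuous_subtype_val.comp continuous_snd).matrix_elem _ _)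

theorem isCompact_localGates : IsCompact localGates := by
  have h : localGates = Set.range fun p : U 2 × U 2 => toPU (tensor p.1 p.2) := by
    ext g
    simp only [localGates, Set.mem_ofPred_eq, Set.mem_range, Prod.exists, eq_comm]
  rw [h]
  exact isCompact_range ((continuous_toPU 4).comp continuous_tensor)

theorem isCompact_P (s : PU 4) (n : ℕ) : IsCompact (P {s} n) := by
  induction n with
  | zero => exact isCompact_localGates
  | succ n ih =>
    have h : P {s} (n + 1) = (fun p : PU 4 × PU 4 => p.1 * s * p.2) '' (P {s} n ×ˢ localGates) := by
      ext g
      constructor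
      · rintro ⟨h, hh, _, rfl, l, hl, rfl⟩
        exact ⟨(h, l), ⟨hh, hl⟩, rfl⟩
      · rintro ⟨⟨h, l⟩, ⟨hh, hl⟩, rfl⟩
        exact ⟨h, hh, s, rfl, l, hl, rfl⟩
    rw [h]
    exact (ih.prod isCompact_localGates).image (by fun_prop)

/-! ### Null sets of the Haar measure -/

instance (n : ℕ) : (haarPU n).IsHaarMeasure :=
  inferInstanceAs (MeasureTheory.Measure.haarMeasure _).IsHaarMeasure

instance (n : ℕ) : MeasureTheory.IsProbabilityMeasure (haarPU n) :=
  ⟨MeasureTheory.Measure.haarMeasure_self⟩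

/-- The Haar measure of the compact group `PU(n)` is right invariant, as its right translates are
left invariant probability measures. -/
instance (n : ℕ) : (haarPU n).IsMulRightInvariant where
  map_mul_right_eq_self g := by
    have : MeasureTheory.IsProbabilityMeasure ((haarPU n).map (· * g)) :=
      MeasureTheory.Measure.isProbabilityMeasure_map (measurable_mul_const g).aemeasurable
    exact MeasureTheory.Measure.isHaarMeasure_eq_of_isProbabilityMeasure _ _

/-- A closed set is null if, along two continuous curves `a` and `b`, the translates `a t * g * b t`
of every point `g` lie in it for countably many `t` only: by Fubini some translate of the set is
null. -/
theorem haarPU_eq_zero_of_countable {n : ℕ} {Z : Set (PU n)} (hZ : IsClosed Z) {a b : ℝ → PU n}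
    (ha : Continuous a) (hb : Continuous b) (h : ∀ g, {t | a t * g * b t ∈ Z}.Countable) :
    haarPU n Z = 0 := by
  have hc : Continuous fun p : PU n × ℝ => a p.2 * p.1 * b p.2 := by fun_prop
  have hm : MeasurableSet ((fun p : PU n × ℝ => a p.2 * p.1 * b p.2) ⁻¹' Z) :=
    (hZ.preimage hc).measurableSet
  have h0 : ((haarPU n).prod MeasureTheory.volume)
      ((fun p : PU n × ℝ => a p.2 * p.1 * b p.2) ⁻¹' Z) = 0 := by
    rw [MeasureTheory.Measure.measure_prod_null hm]
    exact Filter.Eventually.of_forall fun g => (h g).measure_zero _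
  rw [← MeasureTheory.Measure.prod_swap, MeasureTheory.Measure.map_apply measurable_swap hm] at h0
  obtain ⟨t, ht⟩ := (MeasureTheory.Measure.measure_ae_null_of_prod_null h0).exists
  have he : (haarPU n)
      (Prod.mk t ⁻¹' (Prod.swap ⁻¹' ((fun p : PU n × ℝ => a p.2 * p.1 * b p.2) ⁻¹' Z))) =
      (haarPU n) ((fun g => a t * g) ⁻¹' ((fun g => g * b t) ⁻¹' Z)) := rfl
  replace ht := he.symm.trans ht
  rw [MeasureTheory.measure_preimage_mul, MeasureTheory.measure_preimage_mul_right] at ht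
  exact ht

/-! ### The torus translates of a gate -/

/-- The gate whose conjugate by `Q` is diagonal with entries `exp (2πi t w_j)`. -/
def torus (w : Fin 4 → ℝ) (t : ℝ) : U 4 :=
  ⟨Q * Matrix.diagonal (fun j => phase (t * w j)) * Q.conjTranspose, by
    have hQ : Q ∈ Matrix.unitaryGroup (Fin 4) ℂ :=
      Matrix.mem_unitaryGroup_iff.mpr Q_mul_conjTranspose
    refine mul_mem (mul_mem hQ ?_) (Unitary.star_mem hQ)
    rw [Matrix.mem_unitaryGroup_iff, Matrix.star_eq_conjTranspose, Matrix.diagonal_conjTranspose,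
      Matrix.diagonal_mul_diagonal, ← Matrix.diagonal_one]
    congr 1
    ext j
    rw [Pi.star_apply, RCLike.star_def, Complex.mul_conj, Complex.normSq_eq_norm_sq, norm_phase]
    simp⟩

theorem continuous_torus (w : Fin 4 → ℝ) : Continuous (torus w) := by
  refine Continuous.subtype_mk ((continuous_const.matrix_mul
    (Continuous.matrix_diagonal ?_)).matrix_mul continuous_const) _
  unfold phase
  fun_prop

theorem prod_phase (w : Fin 4 → ℝ) : ∏ j, phase (w j) = phase (∑ j, w j) := by
  rw [Fin.prod_univ_four, Fin.sum_univ_four, phase_add, phase_add, phase_add]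

theorem det_torus {w : Fin 4 → ℝ} (hw : ∑ j, w j = 0) (t : ℝ) :
    (torus w t : Matrix (Fin 4) (Fin 4) ℂ).det = 1 := by
  change (Q * Matrix.diagonal (fun j => phase (t * w j)) * Q.conjTranspose).det = 1
  rw [Matrix.det_mul_right_comm, Q_mul_conjTranspose, one_mul, Matrix.det_diagonal,
    prod_phase fun j => t * w j, ← Finset.mul_sum, hw, mul_zero, phase_zero]

theorem trace_cartanDouble_torus (v w : Fin 4 → ℝ) (t : ℝ) (u : Matrix (Fin 4) (Fin 4) ℂ) :
    (cartanDouble ((torus v t : Matrix (Fin 4) (Fin 4) ℂ) * u *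
      (torus w t : Matrix (Fin 4) (Fin 4) ℂ))).trace =
    ∑ p : Fin 4 × Fin 4, (Q.conjTranspose * u * Q) p.1 p.2 ^ 2 *
      phase (2 * (t * (v p.1 + w p.2))) := by
  have h : Q.conjTranspose * ((torus v t : Matrix (Fin 4) (Fin 4) ℂ) * u *
      (torus w t : Matrix (Fin 4) (Fin 4) ℂ)) * Q =
      Matrix.diagonal (fun j => phase (t * v j)) * (Q.conjTranspose * u * Q) *
        Matrix.diagonal (fun j => phase (t * w j)) := by
    simp only [torus]
    calc _ = (Q.conjTranspose * Q) * Matrix.diagonal (fun j => phase (t * v j)) *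
          (Q.conjTranspose * u * Q) * Matrix.diagonal (fun j => phase (t * w j)) *
          (Q.conjTranspose * Q) := by noncomm_ring
      _ = _ := by rw [conjTranspose_Q_mul]; noncomm_ring
  rw [cartanDouble, h, Matrix.trace, Fintype.sum_prod_type]
  refine Finset.sum_congr rfl fun i _ => ?_
  rw [Matrix.diag_apply, Matrix.mul_apply]
  refine Finset.sum_congr rfl fun j _ => ?_
  rw [Matrix.transpose_apply, Matrix.mul_diagonal, Matrix.diagonal_mul,
    show 2 * (t * (v i + w j)) = t * v i + t * w j + (t * v i + t * w j) by ring, phase_add,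
    phase_add]
  ring

theorem phase_pow (x : ℝ) (n : ℕ) : phase x ^ n = phase (n * x) := by
  induction n with
  | zero => simp [phase_zero]
  | succ n ih => rw [pow_succ, ih, ← phase_add]; congr 1; push_cast; ring

theorem countable_phase_preimage {s : Set ℂ} (hs : s.Finite) : {t : ℝ | phase t ∈ s}.Countable := by
  have h : {t : ℝ | phase t ∈ s} = ⋃ z ∈ s, {t : ℝ | phase t = z} := by
    ext t
    simp
  rw [h]
  refine hs.countable.biUnion fun z _ => ?_
  by_cases hz : ∃ x, phase x = z
  · obtain ⟨x, rfl⟩ := hz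
    refine (Set.countable_range fun n : ℤ => x + n).mono fun t ht => ?_
    obtain ⟨n, hn⟩ := (phase_eq_phase_iff _ _).mp ht
    exact ⟨n, by linarith⟩
  · convert Set.countable_empty
    exact Set.eq_empty_iff_forall_notMem.mpr fun t ht => hz ⟨t, ht⟩

/-- The weights of the left torus are `0, 1, 2, 3`, made traceless. -/
def leftWeight (i : Fin 4) : ℝ := (i : ℕ) - 3 / 2

/-- The weights `0, 4, 8, 13` of the right torus before they are made traceless. They are chosen
such that their sums with `0, 1, 2, 3` are distinct, and such that the total
`0 + 1 + 2 + 3 + 0 + 4 + 8 + 13 = 31` is odd. -/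
def rightExponent : Fin 4 → ℕ := ![0, 4, 8, 13]

/-- The traceless weights of the right torus. -/
def rightWeight (j : Fin 4) : ℝ := rightExponent j - 25 / 4

/-- The exponents of the monomials in the trace of the Cartan double. -/
def torusExponent (p : Fin 4 × Fin 4) : ℕ := p.1 + rightExponent p.2

theorem torusExponent_injective : Function.Injective torusExponent := by decide

theorem torusExponent_le (p : Fin 4 × Fin 4) : torusExponent p ≤ 16 := by
  revert p
  decide

/-- A nonzero trigonometric polynomial with the frequencies `4 * torusExponent p - 31` takes real
values only countably often: these frequencies are `1` modulo `4`
and those of the complex conjugate are `3`, so that nothing cancels. -/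
theorem countable_im_eq_zero {c : Fin 4 × Fin 4 → ℂ} (hc : c ≠ 0) :
    {t : ℝ | (∑ p, c p * phase ((4 * torusExponent p - 31) * t)).im = 0}.Countable := by
  obtain ⟨q, hq⟩ := Function.ne_iff.mp hc
  -- the difference of the sum and its conjugate, times the power `33` of the variable
  let f : Polynomial ℂ := ∑ p, (Polynomial.C (c p) * Polynomial.X ^ (4 * torusExponent p + 2) -
    Polynomial.C ((starRingEnd ℂ) (c p)) * Polynomial.X ^ (64 - 4 * torusExponent p))
  have hf : f ≠ 0 := by
    intro h
    have h1 := congrArg (fun g => g.coeff (4 * torusExponent q + 2)) h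
    simp only [f, Polynomial.finsetSum_coeff, Polynomial.coeff_sub, Polynomial.coeff_C_mul_X_pow,
      Polynomial.coeff_zero] at h1
    rw [Finset.sum_eq_single q] at h1
    · have := torusExponent_le q
      rw [if_pos rfl, if_neg (by omega), sub_zero] at h1
      exact hq h1
    · intro p _ hp
      have := torusExponent_le p
      have h2 : torusExponent q ≠ torusExponent p := fun h => hp (torusExponent_injective h).symm
      rw [if_neg (by omega), if_neg (by omega), sub_zero]
    · simp
  refine (countable_phase_preimage (f.rootSet_finite ℂ)).mono fun t ht => ?_
  rw [Set.mem_ofPred_eq, Polynomial.mem_rootSet]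
  refine ⟨hf, ?_⟩
  rw [Set.mem_ofPred_eq, ← Complex.conj_eq_iff_im, map_sum] at ht
  have h3 : phase (33 * t) * (∑ p, c p * phase ((4 * torusExponent p - 31) * t) -
      ∑ p, (starRingEnd ℂ) (c p * phase ((4 * torusExponent p - 31) * t))) = 0 := by
    rw [ht, sub_self, mul_zero]
  rw [← Finset.sum_sub_distrib, Finset.mul_sum] at h3
  simp only [f, map_sum, map_sub, map_mul, map_pow, Polynomial.aeval_X, Polynomial.aeval_C]
  refine Eq.trans (Finset.sum_congr rfl fun p _ => ?_) h3
  have := torusExponent_le p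
  have h4 : ((4 * torusExponent p + 2 : ℕ) : ℝ) * t = 33 * t + (4 * torusExponent p - 31) * t := by
    push_cast
    ring
  have h5 : ((64 - 4 * torusExponent p : ℕ) : ℝ) * t =
      33 * t + -((4 * torusExponent p - 31) * t) := by
    rw [Nat.cast_sub (by omega)]
    push_cast
    ring
  rw [map_mul, star_phase, phase_pow, phase_pow, h4, h5, phase_add, phase_add,
    Algebra.algebraMap_self, RingHom.id_apply, RingHom.id_apply]
  ring

/-- The gates reached by two uses of `iSWAP` form a null set: along a generic torus through any
gate, the trace of the Cartan double is real only countably often. -/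
theorem haarPU_P_iswap_two : haarPU 4 (P {ISWAP} 2) = 0 := by
  refine haarPU_eq_zero_of_countable (isCompact_P ISWAP 2).isClosed
    ((continuous_toPU 4).comp (continuous_torus leftWeight))
    ((continuous_toPU 4).comp (continuous_torus rightWeight)) fun g => ?_
  obtain ⟨u, rfl, hu⟩ := exists_toPU_eq_det_eq_one g
  have hV : Q.conjTranspose * (u : Matrix (Fin 4) (Fin 4) ℂ) * Q ≠ 0 := by
    intro h
    have h1 := (Matrix.mem_unitaryGroup_iff.mp (Qconj_mem_unitaryGroup u))
    rw [h, zero_mul] at h1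
    exact zero_ne_one h1
  have hc : (fun p : Fin 4 × Fin 4 =>
      (Q.conjTranspose * (u : Matrix (Fin 4) (Fin 4) ℂ) * Q) p.1 p.2 ^ 2) ≠ 0 := by
    intro h
    refine hV (Matrix.ext fun i j => ?_)
    exact pow_eq_zero_iff (two_ne_zero) |>.mp (congrFun h (i, j))
  have hcount := (countable_im_eq_zero hc).preimage_of_injOn
    (f := fun t : ℝ => t / 2) fun x _ y _ h => by simpa using h
  refine hcount.mono fun t ht => ?_
  have hl : ∑ j, leftWeight j = 0 := by simp [Fin.sum_univ_four, leftWeight]; norm_num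
  have hr : ∑ j, rightWeight j = 0 := by
    simp [Fin.sum_univ_four, rightWeight, rightExponent]; norm_num
  have hd : ((torus leftWeight t * u * torus rightWeight t : U 4) :
      Matrix (Fin 4) (Fin 4) ℂ).det = 1 := by
    rw [Submonoid.coe_mul, Submonoid.coe_mul, Matrix.det_mul, Matrix.det_mul, det_torus hl,
      det_torus hr, hu, one_mul, one_mul]
  have h2 : toPU (torus leftWeight t * u * torus rightWeight t) ∈ P {ISWAP} 2 := by
    rw [map_mul, map_mul]
    exact ht
  rw [ISWAP, doublesToZZ_iswapU.mem_P_two_iff_isConjSymm, isConjSymm_coord_iff hd,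
    Submonoid.coe_mul, Submonoid.coe_mul, trace_cartanDouble_torus] at h2
  rw [Set.mem_preimage, Set.mem_ofPred_eq, ← h2]
  congr 1
  refine Finset.sum_congr rfl fun p _ => ?_
  congr 2
  rw [leftWeight, rightWeight, torusExponent]
  push_cast
  ring

/-! ### The volume of the alcove -/

theorem tracelessVolume_apply {s : Set E4} (hs : MeasurableSet s) : tracelessVolume s =
    (stdOrthonormalBasis ℝ traceless).toBasis.addHaar ((Subtype.val : traceless → E4) ⁻¹' s) :=
  MeasureTheory.Measure.map_apply measurable_subtype_coe hs

theorem measurableSet_alcoveC2 : MeasurableSet alcoveC2 := by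
  have h : ∀ i : Fin 4, Measurable fun a : E4 => a i := fun i => by fun_prop
  have h0 := h 0
  have h1 := h 1
  have h2 := h 2
  have h3 := h 3
  refine .inter (.inter (measurableSet_le h1 h0) <| .inter (measurableSet_le h2 h1) <|
    .inter (measurableSet_le h3 h2) <| .inter (measurableSet_le (h0.sub_const 1) h3) <|
    measurableSet_eq_fun (by fun_prop) measurable_const) <|
    .union (measurableSet_lt h0 (h2.add_const _)) <|
    .inter (measurableSet_eq_fun (h2.add_const _) h0) (measurableSet_le (h3.add_const _) h1)

theorem norm_le_of_mem_alcove {a : E4} (ha : a ∈ alcove) : ‖a‖ ≤ 2 := by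
  obtain ⟨h1, h2, h3, h4, h5⟩ := ha
  rw [Fin.sum_univ_four] at h5
  have h : ∀ x : ℝ, -1 ≤ x → x ≤ 1 → x ^ 2 ≤ 1 := fun x hx hx' => by nlinarith
  rw [EuclideanSpace.norm_eq, Real.sqrt_le_left (by norm_num), Fin.sum_univ_four]
  simp only [Real.norm_eq_abs, sq_abs]
  have k0 := h (a 0) (by linarith) (by linarith)
  have k1 := h (a 1) (by linarith) (by linarith)
  have k2 := h (a 2) (by linarith) (by linarith)
  have k3 := h (a 3) (by linarith) (by linarith)
  linarith

theorem tracelessVolume_alcoveC2_ne_top : tracelessVolume alcoveC2 ≠ ∞ := by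
  rw [tracelessVolume_apply measurableSet_alcoveC2]
  refine ((MeasureTheory.measure_mono fun a ha => ?_).trans_lt
    (MeasureTheory.measure_closedBall_lt_top (x := (0 : traceless)) (r := 2))).ne
  rw [mem_closedBall_zero_iff]
  exact norm_le_of_mem_alcove ha.1

theorem tracelessVolume_alcoveC2_ne_zero : tracelessVolume alcoveC2 ≠ 0 := by
  rw [tracelessVolume_apply measurableSet_alcoveC2]
  -- the strict inequalities cut out a nonempty open subset
  let V : Set E4 := {a | a 1 < a 0 ∧ a 2 < a 1 ∧ a 3 < a 2 ∧ a 0 - 1 < a 3 ∧ a 0 < a 2 + 1 / 2}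
  have h : ∀ i : Fin 4, Continuous fun a : E4 => a i := fun i => by fun_prop
  have hV : IsOpen V := (isOpen_lt (h 1) (h 0)).inter <| (isOpen_lt (h 2) (h 1)).inter <|
    (isOpen_lt (h 3) (h 2)).inter <| (isOpen_lt ((h 0).sub continuous_const) (h 3)).inter <|
    isOpen_lt (h 0) ((h 2).add continuous_const)
  have hV' : (Subtype.val : traceless → E4) ⁻¹' V ⊆ Subtype.val ⁻¹' alcoveC2 :=
    fun a ⟨h1, h2, h3, h4, h5⟩ => ⟨⟨h1.le, h2.le, h3.le, h4.le, a.2⟩, Or.inl h5⟩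
  have hne : ((Subtype.val : traceless → E4) ⁻¹' V).Nonempty := by
    refine ⟨⟨!₂[3 / 16, 1 / 16, -1 / 16, -3 / 16], ?_⟩, ?_⟩
    · change ∑ j, _ = (0 : ℝ)
      simp [Fin.sum_univ_four]
      norm_num
    · simp only [V, Set.mem_preimage, Set.mem_ofPred_eq]
      simp
      norm_num
  exact fun h0 => ((hV.preimage continuous_subtype_val).measure_pos _ hne).ne'
    (MeasureTheory.measure_mono_null hV' h0)

instance : MeasureTheory.IsProbabilityMeasure alcoveVolume :=
  ProbabilityTheory.cond_isProbabilityMeasure_of_finite tracelessVolume_alcoveC2_ne_zero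
    tracelessVolume_alcoveC2_ne_top

/-- The triangle lies in the proper subspace `a₀ + a₃ = 0`. -/
theorem alcoveVolume_triangle : alcoveVolume triangle = 0 := by
  have hm : MeasurableSet {a : E4 | a 0 + a 3 = 0} :=
    measurableSet_eq_fun (by fun_prop) measurable_const
  refine MeasureTheory.measure_mono_null (t := {a : E4 | a 0 + a 3 = 0})
    (fun a ha => by rw [Set.mem_ofPred_eq, ha.2.1, neg_add_cancel]) ?_
  refine ProbabilityTheory.cond_absolutelyContinuous ?_
  rw [tracelessVolume_apply hm]
  let W : Submodule ℝ traceless := LinearMap.ker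
    ((EuclideanSpace.proj 0 + EuclideanSpace.proj 3 : E4 →L[ℝ] ℝ).toLinearMap ∘ₗ traceless.subtype)
  have hW : W ≠ ⊤ := by
    intro h
    have hx : (⟨!₂[1, -1, 0, 0], by
      change ∑ j, _ = (0 : ℝ)
      simp [Fin.sum_univ_four]⟩ : traceless) ∈ W := h ▸ Submodule.mem_top
    simp [W] at hx
  convert MeasureTheory.Measure.addHaar_submodule
    (stdOrthonormalBasis ℝ traceless).toBasis.addHaar W hW
  ext a
  simp [W]

/-! ### Expected depth -/

theorem isConjSymm_coord_of_mem_localGates {g : PU 4} (hg : g ∈ localGates) :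
    IsConjSymm (coord g) := by
  obtain ⟨A, B, rfl, hA, hB⟩ := exists_tensor_det_eq_one hg
  rw [isConjSymm_coord_iff (det_tensor hA hB), trace_cartanDouble, spinFlip_tensor hA hB,
    mul_inv_tensor]
  simp

theorem isConjSymm_coord_of_mem_P_iswap_one {g : PU 4} (hg : g ∈ P {ISWAP} 1) :
    IsConjSymm (coord g) := by
  obtain ⟨k, hk, _, rfl, l, hl, rfl⟩ := hg
  obtain ⟨A, B, rfl, hA, hB⟩ := exists_tensor_det_eq_one hk
  obtain ⟨C, D, rfl, hC, hD⟩ := exists_tensor_det_eq_one hl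
  have hd : ((tensor A B * iswapU * tensor C D : U 4) : Matrix (Fin 4) (Fin 4) ℂ).det = 1 := by
    rw [Submonoid.coe_mul, Submonoid.coe_mul, Matrix.det_mul, Matrix.det_mul, det_tensor hA hB,
      det_tensor hC hD, det_iswapU]
    norm_num
  have he : toPU (tensor A B) * ISWAP * toPU (tensor C D) =
      toPU (tensor A B * iswapU * tensor C D) := by
    simp only [map_mul, ISWAP]
  rw [he, isConjSymm_coord_iff hd, Submonoid.coe_mul, Submonoid.coe_mul,
    trace_eq_of_charpoly_eq (charpoly_cartanDouble_local hA hB hC hD _), trace_cartanDouble,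
    doublesToZZ_iswapU.double_eq]
  simp [zz, Matrix.trace, Fin.sum_univ_four]

theorem depth_iswap_le (g : PU 4) : depth {ISWAP} g ≤ 3 :=
  iInf₂_le 3 (show g ∈ P {toPU iswapU} 3 by rw [doublesToZZ_iswapU.P_three]; trivial)

/-- Circuits with fewer than three uses of `iSWAP` have conjugation symmetric coordinates. -/
theorem three_le_depth_iswap {g : PU 4} (hg : ¬ IsConjSymm (coord g)) :
    3 ≤ depth {ISWAP} g := by
  refine le_iInf₂ fun n hn => ?_
  by_contra! h
  have h' : n < 3 := by exact_mod_cast h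
  interval_cases n
  · exact hg (isConjSymm_coord_of_mem_localGates hn)
  · exact hg (isConjSymm_coord_of_mem_P_iswap_one hn)
  · exact hg (doublesToZZ_iswapU.mem_P_two_iff_isConjSymm.mp hn)

theorem expectedDepthHaar_iswap : expectedDepthHaar {ISWAP} = 3 := by
  have h : ∀ᵐ g ∂haarPU 4, (depth {ISWAP} g : ℝ≥0∞) = 3 := by
    filter_upwards [MeasureTheory.measure_eq_zero_iff_ae_notMem.mp haarPU_P_iswap_two] with g hg
    rw [(depth_iswap_le g).antisymm (three_le_depth_iswap fun h =>
      hg (doublesToZZ_iswapU.mem_P_two_iff_isConjSymm.mpr h))]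
    rfl
  rw [expectedDepthHaar, MeasureTheory.lintegral_congr_ae h, MeasureTheory.lintegral_const,
    MeasureTheory.measure_univ, mul_one]

theorem expectedDepthAlcove_iswap : expectedDepthAlcove {ISWAP} = 3 := by
  have h : ∀ᵐ x ∂alcoveVolume,
      ((⨅ (g : PU 4) (_ : coord g = x), depth {ISWAP} g : ℕ∞) : ℝ≥0∞) = 3 := by
    filter_upwards [MeasureTheory.measure_eq_zero_iff_ae_notMem.mp alcoveVolume_triangle,
      ProbabilityTheory.ae_cond_mem measurableSet_alcoveC2] with x hx hx'
    obtain ⟨g, hg⟩ := exists_coord_eq hx'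
    have h3 : ⨅ (g : PU 4) (_ : coord g = x), depth {ISWAP} g = 3 := by
      refine le_antisymm (iInf₂_le_of_le g hg (depth_iswap_le g)) (le_iInf₂ fun k hk => ?_)
      refine three_le_depth_iswap fun h => hx ⟨hx', ?_⟩
      rwa [hk] at h
    rw [h3]
    rfl
  rw [expectedDepthAlcove, MeasureTheory.lintegral_congr_ae h, MeasureTheory.lintegral_const,
    MeasureTheory.measure_univ, mul_one]

end TwoQubit

end

theorem mainTheorem7 :
    -- the coordinate is well defined
    (∀ g : PU 4, ∃! a : E4, IsCoord g a) ∧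
    -- depth two
    P {ISWAP} 2 = P {CZ} 2 ∧
    coord '' P {ISWAP} 2 =
      {δ | δ ∈ alcoveC2 ∧ δ 0 = -δ 3 ∧ δ 1 = -δ 2} ∧
    P {ISWAP} 2 =
      {g | coord g 0 = -coord g 3 ∧ coord g 1 = -coord g 2} ∧
    coord '' P {ISWAP} 2 =
      convexHull ℝ {e₁, e₂, e₃} ∧
    Set.extremePoints ℝ (coord '' P {ISWAP} 2) =
      {e₁, e₂, e₃} ∧
    -- circuits with two gates realizing the vertices
    coord (ISWAP * ISWAP) = e₁ ∧
    coord (ISWAP *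
      toPU (tensor 1 (rotX (Real.pi / 2))) * ISWAP) =
        e₂ ∧
    coord (ISWAP *
      toPU (tensor (rotX (Real.pi / 2)) (rotX (Real.pi / 2))) *
      ISWAP) = e₃ ∧
    -- depth three
    P {ISWAP} 3 = P {CZ} 3 ∧
    P {ISWAP} 3 = Set.univ ∧
    coord '' P {ISWAP} 3 = alcoveC2 ∧
    -- circuits with three gates; the rightmost factor acts first
    coord (ISWAP *
      toPU (tensor (rotX (Real.pi / 2)) (rotX (Real.pi / 2))) *
      ISWAP *
      toPU (tensor (rotY (Real.pi / 2)) (rotY (Real.pi / 2))) *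
      ISWAP) = e₁ ∧
    coord (ISWAP *
      toPU (tensor (rotX (Real.pi / 2)) (rotX (Real.pi / 2))) *
      ISWAP *
      toPU (tensor (rotX (Real.pi / 2)) (rotY (Real.pi / 2))) *
      ISWAP) = e₂ ∧
    coord (ISWAP *
      toPU (tensor (rotX (Real.pi / 2)) (rotX (Real.pi / 2))) *
      ISWAP *
      toPU (tensor (rotX (Real.pi / 2)) (rotX (Real.pi / 2))) *
      ISWAP) = e₃ ∧
    coord (ISWAP *
      toPU (tensor 1 (rotX (Real.pi / 2))) *
      ISWAP *
      toPU (tensor (rotX (-(Real.pi / 2))) 1) *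
      ISWAP) = e₄ ∧
    -- volume and expected depth, for the Haar measure and for the volume of the alcove
    haarPU 4 (P {ISWAP} 2) = 0 ∧
    alcoveVolume (coord '' P {ISWAP} 2) = 0 ∧
    expectedDepthHaar {ISWAP} = 3 ∧
    expectedDepthAlcove {ISWAP} = 3 := by
  have hsurj : P {ISWAP} 3 = Set.univ := doublesToZZ_iswapU.P_three
  refine ⟨existsUnique_isCoord, P_iswap_two.trans P_cz_two.symm, image_coord_P_iswap_two,
    P_iswap_two, image_coord_P_iswap_two.trans triangle_eq_convexHull, ?_,
    coord_iswap_mul_iswap, coord_iswap_one_rotX_iswap, coord_iswap_rotX_rotX_iswap,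
    hsurj.trans doublesToZZ_czU.P_three.symm, hsurj, ?_, ?_, ?_, ?_, ?_,
    haarPU_P_iswap_two, ?_, expectedDepthHaar_iswap, expectedDepthAlcove_iswap⟩
  · rw [image_coord_P_iswap_two, extremePoints_triangle]
  · rw [hsurj, Set.image_univ]
    ext a
    exact ⟨fun ⟨g, hg⟩ => hg ▸ (isCoord_coord g).1, exists_coord_eq⟩
  · rw [← toPU_circuitThree, coord_circuitThree_XXYY]
  · rw [← toPU_circuitThree, coord_circuitThree_XXXY]
  · rw [← toPU_circuitThree, coord_circuitThree_XXXX]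
  · rw [← toPU_circuitThree, coord_circuitThree_IXXI]
  · rw [image_coord_P_iswap_two, alcoveVolume_triangle]
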